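/- Let $n>2$, let $\mathbb R^{n,+}=\{x\in\mathbb R^n : x_n>0\}$, and let $Cl_n$ be the real Clifford algebra generated by $\mathbb R^n$ with $e_ie_j+e_je_i=-2\delta_{ij}$. Every $A\in Cl_n$ is uniquely $A=B+Ce_n$ with $B,C$ in the subalgebra $Cl_{n-1}$ generated by $e_1,\dots,e_{n-1}$; put $P(A)=B$, $Q(A)=C$ and $Q'(A)=-e_nQ(A)e_n$. Let $D=\sum_{j=1}^n e_j\frac{\partial}{\partial x_j}$ and $Mf=Df+\frac{n-2}{x_n}Q'(f)$. A $C^2$ function $h$ with values in $Cl_{n-1}$ on an open subset of $\mathbb R^{n,+}$ is called hyperbolic harmonic if $\Delta h-\frac{n-2}{x_n}\frac{\partial h}{\partial x_n}=0$. For $x\ne y$ in $\mathbb R^{n,+}$ put $$G(x,y)=\int_{\|x-y\|/\|x-\hat y\|}^{1}\frac{(1-t^2)^{n-2}}{t^{n-1}}\,dt,\qquad p(x,y)=DG(x,y),$$ where $\hat y=(y_1,\dots,y_{n-1},-y_n)$ and $D$ acts in the variable $x$. Let $\omega_n$ be the surface area of the unit sphere in $\mathbb R^n$. **Theorem (Green's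 formula).** Let $U$ be a domain in $\mathbb R^{n,+}$ and let $h:U\to Cl_{n-1}$ be hyperbolic harmonic. Let $S\subset U$ be a compact piecewise $C^1$ surface bounding a bounded subdomain $V$ of $U$; that is, $S=\partial V$ has finite surface area and, outside a subset of surface measure zero, is a $C^1$ hypersurface with $V$ on one side of it. Let $n(x)$ be the unit normal to $S$ at $x$ pointing out of $V$, and $\sigma$ the surface measure of $S$. Then for each $y\in V$ the integrand below is integrable over $S$ and $$h(y)=-\frac{1}{2^{n-2}\omega_n}\,P\left(\int_S\Big(G(x,y)\,\frac{n(x)}{x_n^{n-2}}\,Mh(x)-p(x,y)\,\frac{n(x)}{x_n^{n-2}}\,h(x)\Big)\,d\sigma(x)\right).$$ -/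

import Mathlib

open MeasureTheory Set
open scoped RealInnerProductSpace

noncomputable section

namespace HyperbolicClifford

/-! ### Euclidean space, upper half space, reflection -/

/-- Euclidean space `ℝⁿ`. -/
abbrev E (n : ℕ) : Type := EuclideanSpace ℝ (Fin n)

/-- The index of the last coordinate `x_n`. -/
def last (n : ℕ) [NeZero n] : Fin n := ⟨n - 1, Nat.sub_lt (NeZero.pos n) one_pos⟩

/-- Upper half space `{x ∈ ℝⁿ : x_n > 0}`. -/
def upperHalfSpace (n : ℕ) [NeZero n] : Set (E n) := {x | 0 < x (last n)}

/-- The reflection `x ↦ x̂`, which changes the sign of the last coordinate. -/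
def reflect (n : ℕ) [NeZero n] : E n →ₗ[ℝ] E n where
  toFun x := WithLp.toLp 2 fun i => if i = last n then -x i else x i
  map_add' x y := by
    ext i
    by_cases hi : i = last n
    · simp [hi, add_comm]
    · simp [hi]
  map_smul' c x := by
    ext i
    by_cases hi : i = last n <;> simp [hi]

theorem reflect_apply {n : ℕ} [NeZero n] (x : E n) (i : Fin n) :
    reflect n x i = if i = last n then -x i else x i := rfl

/-! ### The Clifford algebra `Cl_n` -/

/-- The negative definite quadratic form `x ↦ -‖x‖²` on `ℝⁿ`. -/
def negForm (n : ℕ) : QuadraticForm ℝ (E n) := -(LinearMap.BilinMap.toQuadraticMap (innerₗ (E n)))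

theorem negForm_apply {n : ℕ} (x : E n) : negForm n x = -‖x‖ ^ 2 := by
  simp [negForm]

/-- The real Clifford algebra of `ℝⁿ` with the negative definite form. -/
abbrev Cl (n : ℕ) : Type := CliffordAlgebra (negForm n)

/-- A vector of `ℝⁿ` as an element of `Cl_n`. -/
def vec {n : ℕ} : E n →ₗ[ℝ] Cl n := CliffordAlgebra.ι (negForm n)

/-- The standard basis vector `e_i` of `ℝⁿ`. -/
def stdVec {n : ℕ} (i : Fin n) : E n := EuclideanSpace.single i 1

/-- The generator `e_i` of `Cl_n`. -/
def e {n : ℕ} (i : Fin n) : Cl n := vec (stdVec i)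

theorem vec_mul_self {n : ℕ} (x : E n) : vec x * vec x = algebraMap ℝ (Cl n) (-‖x‖ ^ 2) := by
  rw [vec, CliffordAlgebra.ι_sq_scalar, negForm_apply]

theorem e_mul_self {n : ℕ} (i : Fin n) : e i * e i = (-1 : Cl n) := by
  simp [e, vec_mul_self, stdVec]

theorem e_mul_e {n : ℕ} {i j : Fin n} (hij : i ≠ j) : e i * e j = -(e j * e i : Cl n) := by
  have h := vec_mul_self (stdVec i + stdVec j)
  have hn : ‖stdVec i + stdVec j‖ ^ 2 = (2 : ℝ) := by
    rw [norm_add_sq_real]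
    simp [stdVec, EuclideanSpace.inner_single_left, hij]
    norm_num
  rw [hn, map_add] at h
  change (e i + e j) * (e i + e j) = _ at h
  rw [add_mul, mul_add, mul_add, e_mul_self, e_mul_self] at h
  have h2 : (algebraMap ℝ (Cl n)) (-2) = -1 + -1 := by
    rw [show (-2 : ℝ) = -1 + -1 by norm_num, map_add, map_neg, map_one]
  rw [h2] at h
  have h3 : e i * e j + e j * e i = (0 : Cl n) := by
    have : (e i * e j + e j * e i : Cl n)
        = (-1 + e i * e j + (e j * e i + -1)) - (-1 + -1) := by abel
    rw [this, h, sub_self]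
  exact eq_neg_of_add_eq_zero_left h3

/-- The coordinates `(a_A)_A`, `A ⊆ {1, …, n}`, of an element of `Cl_n`, obtained from the linear
identification of `Cl_n` with the exterior algebra. -/
def coords (n : ℕ) : Cl n ≃ₗ[ℝ] EuclideanSpace ℝ (Finset (Fin n)) :=
  (CliffordAlgebra.equivExterior (negForm n)).trans
    (((EuclideanSpace.basisFun (Fin n) ℝ).toBasis.ExteriorAlgebra.equivFun).trans
      (WithLp.linearEquiv 2 ℝ (Finset (Fin n) → ℝ)).symm)

/-- `Cl_n` carries the norm `‖A‖ = (∑ a_A²)^{1/2}`. -/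
instance (n : ℕ) : NormedAddCommGroup (Cl n) :=
  NormedAddCommGroup.induced (Cl n) (EuclideanSpace ℝ (Finset (Fin n))) (coords n)
    (coords n).injective

instance (n : ℕ) : NormedSpace ℝ (Cl n) :=
  NormedSpace.induced ℝ (Cl n) (EuclideanSpace ℝ (Finset (Fin n))) (coords n)

instance (n : ℕ) : FiniteDimensional ℝ (Cl n) :=
  LinearEquiv.finiteDimensional (coords n).symm

instance (n : ℕ) : CompleteSpace (Cl n) := FiniteDimensional.complete ℝ (Cl n)

/-! ### The splitting `Cl_n = Cl_{n-1} + Cl_{n-1} e_n` -/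

/-- `Cl_{n-1}`, the subalgebra of `Cl_n` generated by `e_1, …, e_{n-1}`. -/
def ClBase (n : ℕ) [NeZero n] : Subalgebra ℝ (Cl n) :=
  Algebra.adjoin ℝ {A | ∃ i : Fin n, i ≠ last n ∧ A = e i}

/-- The automorphism `A ↦ Â` of `Cl_n` with `(B + C e_n)^ = B - C e_n` for `B, C ∈ Cl_{n-1}`. -/
def hat (n : ℕ) [NeZero n] : Cl n →ₐ[ℝ] Cl n :=
  CliffordAlgebra.map
    { reflect n with
      map_app' := fun x => by
        change negForm n (reflect n x) = negForm n x
        rw [negForm_apply, negForm_apply, EuclideanSpace.norm_sq_eq, EuclideanSpace.norm_sq_eq]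
        congr 1
        refine Finset.sum_congr rfl fun i _ => ?_
        rw [reflect_apply]
        split_ifs <;> simp }

/-- The projection `P : Cl_n → Cl_{n-1}`, `P (B + C e_n) = B`; see `eq_P_add_Q_mul` and
`P_Q_unique`. -/
def P {n : ℕ} [NeZero n] (A : Cl n) : Cl n := (1 / 2 : ℝ) • (A + hat n A)

/-- The projection `Q : Cl_n → Cl_{n-1}`, `Q (B + C e_n) = C`. -/
def Q {n : ℕ} [NeZero n] (A : Cl n) : Cl n := -(1 / 2 : ℝ) • ((A - hat n A) * e (last n))

/-- `Q'(A) = -e_n Q(A) e_n`. -/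
def Q' {n : ℕ} [NeZero n] (A : Cl n) : Cl n := -(e (last n) * Q A * e (last n))

theorem hat_vec {n : ℕ} [NeZero n] (x : E n) : hat n (vec x) = vec (reflect n x) :=
  CliffordAlgebra.map_apply_ι _ x

theorem hat_e_last {n : ℕ} [NeZero n] : hat n (e (last n)) = -e (last n) := by
  rw [e, hat_vec, ← map_neg]
  congr 1
  ext i
  by_cases hi : i = last n
  · simp [reflect_apply, hi]
  · simp [reflect_apply, stdVec, hi]

theorem hat_e_of_ne {n : ℕ} [NeZero n] {j : Fin n} (hj : j ≠ last n) : hat n (e j) = e j := by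
  rw [e, hat_vec]
  congr 1
  ext i
  by_cases hi : i = last n
  · simp [reflect_apply, stdVec, hi, hj.symm]
  · simp [reflect_apply, hi]

theorem hat_of_mem {n : ℕ} [NeZero n] {B : Cl n} (hB : B ∈ ClBase n) : hat n B = B := by
  induction hB using Algebra.adjoin_induction with
  | mem x hx => obtain ⟨i, hi, rfl⟩ := hx; exact hat_e_of_ne hi
  | algebraMap r => exact (hat n).commutes r
  | add x y _ _ hx hy => rw [map_add, hx, hy]
  | mul x y _ _ hx hy => rw [map_mul, hx, hy]

theorem P_add_mul {n : ℕ} [NeZero n] {B C : Cl n} (hB : B ∈ ClBase n) (hC : C ∈ ClBase n) :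
    P (B + C * e (last n)) = B := by
  rw [P, map_add, map_mul, hat_of_mem hB, hat_of_mem hC, hat_e_last]
  have : B + C * e (last n) + (B + C * -e (last n)) = (2 : ℝ) • B := by
    rw [two_smul, mul_neg]; abel
  rw [this, smul_smul]; norm_num

theorem Q_add_mul {n : ℕ} [NeZero n] {B C : Cl n} (hB : B ∈ ClBase n) (hC : C ∈ ClBase n) :
    Q (B + C * e (last n)) = C := by
  rw [Q, map_add, map_mul, hat_of_mem hB, hat_of_mem hC, hat_e_last]
  have : B + C * e (last n) - (B + C * -e (last n)) = (2 : ℝ) • (C * e (last n)) := by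
    rw [two_smul, mul_neg]; abel
  rw [this, smul_mul_assoc, mul_assoc, e_mul_self, smul_smul]; norm_num

theorem exists_splitting {n : ℕ} [NeZero n] (A : Cl n) :
    ∃ B ∈ ClBase n, ∃ C ∈ ClBase n, A = B + C * e (last n) := by
  induction A using CliffordAlgebra.right_induction with
  | algebraMap r => exact ⟨_, (ClBase n).algebraMap_mem r, 0, (ClBase n).zero_mem, by simp⟩
  | add x y hx hy =>
    obtain ⟨B, hB, C, hC, rfl⟩ := hx
    obtain ⟨B', hB', C', hC', rfl⟩ := hy
    exact ⟨B + B', add_mem hB hB', C + C', add_mem hC hC', by rw [add_mul]; abel⟩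
  | mul_ι m x hx =>
    obtain ⟨B, hB, C, hC, rfl⟩ := hx
    have key : ∀ i : Fin n, ∃ B' ∈ ClBase n, ∃ C' ∈ ClBase n,
        (B + C * e (last n)) * e i = B' + C' * e (last n) := by
      intro i
      by_cases hi : i = last n
      · subst hi
        exact ⟨-C, neg_mem hC, B, hB, by rw [add_mul, mul_assoc, e_mul_self]; simp [add_comm]⟩
      · have hei : e i ∈ ClBase n := Algebra.subset_adjoin ⟨i, hi, rfl⟩
        refine ⟨B * e i, mul_mem hB hei, -(C * e i), neg_mem (mul_mem hC hei), ?_⟩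
        rw [add_mul, mul_assoc, e_mul_e (Ne.symm hi)]
        simp [mul_assoc]
    choose B' hB' C' hC' h' using key
    have hm : CliffordAlgebra.ι (negForm n) m = ∑ i, m i • e i := by
      have hm' : m = ∑ i, m i • stdVec i := by
        ext j
        simp [stdVec, Finset.sum_apply, Pi.single_apply]
      conv_lhs => rw [hm']
      simp [map_sum, e, vec]
    refine ⟨∑ i, m i • B' i, sum_mem fun i _ => (ClBase n).smul_mem (hB' i) _,
      ∑ i, m i • C' i, sum_mem fun i _ => (ClBase n).smul_mem (hC' i) _, ?_⟩
    rw [hm, Finset.mul_sum, Finset.sum_mul, ← Finset.sum_add_distrib]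
    refine Finset.sum_congr rfl fun i _ => ?_
    rw [mul_smul_comm, h', smul_add, smul_mul_assoc]

theorem P_mem {n : ℕ} [NeZero n] (A : Cl n) : P A ∈ ClBase n := by
  obtain ⟨B, hB, C, hC, rfl⟩ := exists_splitting A
  rwa [P_add_mul hB hC]

theorem Q_mem {n : ℕ} [NeZero n] (A : Cl n) : Q A ∈ ClBase n := by
  obtain ⟨B, hB, C, hC, rfl⟩ := exists_splitting A
  rwa [Q_add_mul hB hC]

theorem eq_P_add_Q_mul {n : ℕ} [NeZero n] (A : Cl n) : A = P A + Q A * e (last n) := by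
  obtain ⟨B, hB, C, hC, rfl⟩ := exists_splitting A
  rw [P_add_mul hB hC, Q_add_mul hB hC]

theorem P_Q_unique {n : ℕ} [NeZero n] {A B C : Cl n} (hB : B ∈ ClBase n) (hC : C ∈ ClBase n)
    (h : A = B + C * e (last n)) : B = P A ∧ C = Q A := by
  subst h
  exact ⟨(P_add_mul hB hC).symm, (Q_add_mul hB hC).symm⟩

/-! ### The Dirac operators and the hyperbolic Laplacian -/

/-- The Euclidean Dirac operator `D f = ∑ e_j ∂f/∂x_j`. -/
def dirac {n : ℕ} (f : E n → Cl n) (x : E n) : Cl n := ∑ j, e j * fderiv ℝ f x (stdVec j)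

/-- The Dirac-Hodge operator `M f = D f + (n-2)/x_n Q'(f)`. -/
def diracHodge {n : ℕ} [NeZero n] (f : E n → Cl n) (x : E n) : Cl n :=
  dirac f x + (((n : ℝ) - 2) / x (last n)) • Q' (f x)

/-- The hyperbolic Laplacian `Δ f - (n-2)/x_n ∂f/∂x_n`, where `Δ` is the Euclidean Laplacian. -/
def hyperbolicLaplacian {n : ℕ} [NeZero n] (f : E n → Cl n) (x : E n) : Cl n :=
  Laplacian.laplacian f x - (((n : ℝ) - 2) / x (last n)) • fderiv ℝ f x (stdVec (last n))

/-- `h` is a (`C²`, `Cl_{n-1}`-valued) hyperbolic harmonic function on `U`. -/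
def IsHyperbolicHarmonicOn {n : ℕ} [NeZero n] (h : E n → Cl n) (U : Set (E n)) : Prop :=
  ContDiffOn ℝ 2 h U ∧ (∀ x ∈ U, h x ∈ ClBase n) ∧ ∀ x ∈ U, hyperbolicLaplacian h x = 0

/-! ### The kernels -/

/-- `G(x,y) = ∫_{‖x-y‖/‖x-ŷ‖}^1 (1-t²)^{n-2} / t^{n-1} dt`. -/
def G {n : ℕ} [NeZero n] (x y : E n) : ℝ :=
  ∫ t in (‖x - y‖ / ‖x - reflect n y‖)..1, (1 - t ^ 2) ^ (n - 2) / t ^ (n - 1)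

/-- `p(x,y) = D G(x,y)`, the Dirac operator acting in the variable `x`. -/
def p {n : ℕ} [NeZero n] (x y : E n) : Cl n :=
  dirac (fun z => algebraMap ℝ (Cl n) (G z y)) x

/-- `ω_n`, the surface area of the unit sphere of `ℝⁿ`. -/
def sphereArea (n : ℕ) : ℝ := (volume : Measure (E n)).toSphere.real univ

/-! ### Piecewise `C¹` surfaces -/

/-- The boundary of `V` is a `C¹` hypersurface near its point `x`, with `V` on one side of it, and
`ν` is the unit normal at `x` that points out of `V`: near `x` the set `V` is `{ρ < 0}` and its
boundary is `{ρ = 0}` for a `C¹` function `ρ` with `∇ρ(x) ≠ 0`, and `ν = ∇ρ(x) / ‖∇ρ(x)‖`. -/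
def IsOuterUnitNormal {n : ℕ} (V : Set (E n)) (x ν : E n) : Prop :=
  ∃ (W : Set (E n)) (ρ : E n → ℝ), IsOpen W ∧ x ∈ W ∧ ContDiffOn ℝ 1 ρ W ∧ gradient ρ x ≠ 0 ∧
    V ∩ W = {z ∈ W | ρ z < 0} ∧ frontier V ∩ W = {z ∈ W | ρ z = 0} ∧ x ∈ frontier V ∧
    ν = ‖gradient ρ x‖⁻¹ • gradient ρ x

/-- The points at which the boundary of `V` is a `C¹` hypersurface with `V` on one side. -/
def regularBoundary {n : ℕ} (V : Set (E n)) : Set (E n) := {x | ∃ ν, IsOuterUnitNormal V x ν}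

/-- `S` is a compact piecewise `C¹` surface bounding the open set `V`: `S` is the boundary of `V`,
has finite surface area, and is a `C¹` hypersurface with `V` on one side away from a (closed) set
of edges, corners, … of surface measure zero. Here `μHE[n - 1]` is the `(n-1)`-dimensional
Hausdorff measure, normalized to be the surface measure. -/
structure IsPiecewiseC1Boundary {n : ℕ} (S V : Set (E n)) : Prop where
  isCompact : IsCompact S
  eq_frontier : S = frontier V
  area_lt_top : μHE[n - 1] S < ⊤
  singular_null : μHE[n - 1] (S \ regularBoundary V) = 0

end HyperbolicClifford

end

open HyperbolicClifford

/-! ### Hyperplane integrals as limits of slabs; comparable measures -/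

namespace HyperbolicClifford

open Filter Topology Measure Module

variable {X : Type*} [NormedAddCommGroup X] [NormedSpace ℝ X]

/-! Since `h` is `Cl_{n-1}`-valued, `Q'` kills it and `Mh = Dh`. Expanding the normal as `∑ ν_i e_i`
turns the integrand into `∑ ν_i F_i` with `F_i` = `greenForm`, so after applying `P` the surface
integral is the flux of `greenField`. Its divergence is computed in `green_algebra`. The terms with
one derivative on `G` and one on `h` cancel after renaming indices. Off-diagonal second derivatives
cancel because `e_i e_j` is antisymmetric, and `P` kills `e_j e_n B` for `j ≠ n`, `B ∈ Cl_{n-1}`.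
The hyperbolic Laplace equation removes the remaining terms in `G`, leaving `div(x_n^{2-n} ∇G) h`.
This vanishes off `y`, because `x_n^{2-n} ∇G` is an explicit difference of two fields with equal
divergence (`hasFDerivAt_G`, `sum_fderiv_weight_mul_fderiv_G`).

Instead of excising a ball around `y`, the field is multiplied by `1 - bump((x - y)/r)`. The flux
through `S` then equals, up to sign, an integral over a fixed annulus of `r^{n-1}` times the field
at `y + r z` (`sum_integral_frontier_eq_integral_scaled`). As `r → 0` the term with `G` is `O(r)`,
while `r^{n-1} x_n^{2-n} ∇G` tends to `-2^{n-2} z/‖z‖^n`; polar coordinates give `2^{n-2} ω_n h(y)`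
(`tendsto_integral_greenField`).

The other half is the Gauss-Green formula `gaussGreen` for a boundary that is `C¹` only outside a
set of zero surface measure. Near a regular point the boundary is straightened by a `C¹` map that is
`(1 + c)`-bi-Lipschitz and hence distorts surface measure by at most `(1 + c)^{n-1}`. Gauss-Green
therefore holds there up to `ε ∫ ‖f‖` (`IsOuterUnitNormal.exists_local_estimate`). These errors add
up under a partition of unity without growing, so `ε → 0` gives equality without an area formula.
The singular set is compact and null, hence covered by finitely many balls with `∑ r_i^{n-1}` small,
and so is removed by cutoffs whose gradients are small in `L¹` (`exists_cutoff`). -/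

theorem exists_measurePreserving_hyperplane_prod {n : ℕ} (ν : E n) (hν : ‖ν‖ = 1) :
    ∃ A : ℝ × (ℝ ∙ ν)ᗮ ≃ᵐ E n, (∀ q, A q = q.1 • ν + q.2) ∧
      MeasurePreserving A (volume.prod volume) volume := by
  set L := LinearIsometryEquiv.toSpanUnitSingleton (𝕜 := ℝ) ν hν
  have h1 := ((ℝ ∙ ν).measurePreserving_measurableEquivProd (P := E n) 0)
  rw [InnerProductSpace.euclideanHausdorffMeasure_eq_volume] at h1
  have h2 : MeasurePreserving (Prod.map L (id : (ℝ ∙ ν)ᗮ → (ℝ ∙ ν)ᗮ)) (volume.prod volume)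
      (volume.prod volume) := L.measurePreserving.prod (MeasurePreserving.id _)
  refine ⟨(L.toHomeomorph.toMeasurableEquiv.prodCongr (MeasurableEquiv.refl _)).trans
    ((ℝ ∙ ν).measurableEquivProd (P := E n) 0).symm, ?_, ?_⟩
  · intro q
    simp [L, Submodule.measurableEquivProd_symm_apply]
    rfl
  · exact h1.symm.comp h2

/-- The inclusion of the subspace is an isometry, and `μHE` is normalized to agree with Lebesgue
measure on a Euclidean space of its own dimension. -/
theorem setIntegral_hyperplane {n : ℕ} (ν : E n) (hν : ‖ν‖ = 1) (m : E n → X) :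
    ∫ w : (ℝ ∙ ν)ᗮ, m w = ∫ u in {u : E n | ⟪ν, u⟫ = 0}, m u ∂μHE[n - 1] := by
  have hn : n ≠ 0 := by
    rintro rfl
    rw [Subsingleton.elim ν 0] at hν
    simp at hν
  obtain ⟨k, rfl⟩ := Nat.exists_eq_succ_of_ne_zero hn
  have : Fact (finrank ℝ (E (k + 1)) = k + 1) := ⟨by simp⟩
  have hν0 : ν ≠ 0 := by rintro rfl; simp at hν
  have hr : finrank ℝ (ℝ ∙ ν)ᗮ = k := Submodule.finrank_orthogonal_span_singleton hν0
  have hiso : Isometry (Subtype.val : (ℝ ∙ ν)ᗮ → E (k + 1)) := isometry_subtype_coe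
  have h1 := hiso.map_euclideanHausdorffMeasure (d := k)
  have h2 : (μHE[k] : Measure (ℝ ∙ ν)ᗮ) = volume := by
    rw [← InnerProductSpace.euclideanHausdorffMeasure_eq_volume, hr]
  have h3 : range (Subtype.val : (ℝ ∙ ν)ᗮ → E (k + 1)) = {u | ⟪ν, u⟫ = 0} := by
    rw [Subtype.range_coe]
    ext u
    simp [Submodule.mem_orthogonal_singleton_iff_inner_right]
  have hemb : MeasurableEmbedding (Subtype.val : (ℝ ∙ ν)ᗮ → E (k + 1)) :=
    MeasurableEmbedding.subtype_coe (Submodule.closed_of_finiteDimensional _).measurableSet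
  rw [h3, h2] at h1
  simp only [Nat.succ_eq_add_one, Nat.add_sub_cancel]
  rw [← h1, hemb.integral_map]

/-- By Fubini the integral is that of an approximate identity against the slice integrals `M s`.
Rescaling `s = δτ` gives `∫ θ(τ) M(δτ) dτ`, which is continuous in `δ` up to `δ = 0`. -/
theorem tendsto_integral_slab [CompleteSpace X] {n : ℕ} (ν : E n) (hν : ‖ν‖ = 1) (m : E n → X)
    (hm : Continuous m) (hc : HasCompactSupport m) (θ : ℝ → ℝ) (hθ : Continuous θ)
    (hθc : HasCompactSupport θ) (hθ1 : ∫ t, θ t = 1) :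
    Tendsto (fun δ : ℝ => ∫ u, (δ⁻¹ * θ (δ⁻¹ * ⟪ν, u⟫)) • m u) (𝓝[>] 0)
      (𝓝 (∫ u in {u : E n | ⟪ν, u⟫ = 0}, m u ∂μHE[n - 1])) := by
  obtain ⟨A, hA, hAm⟩ := exists_measurePreserving_hyperplane_prod ν hν
  set M : ℝ → X := fun s => ∫ w : (ℝ ∙ ν)ᗮ, m (s • ν + w) with hMdef
  obtain ⟨R, hR⟩ := hc.isCompact.isBounded.subset_closedBall (0 : E n)
  have hinner : ∀ (s : ℝ) (w : (ℝ ∙ ν)ᗮ), ⟪ν, s • ν + w⟫ = s := by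
    intro s w
    have : ⟪ν, (w : E n)⟫ = 0 := Submodule.mem_orthogonal_singleton_iff_inner_right.1 w.2
    rw [inner_add_right, this, inner_smul_right, real_inner_self_eq_norm_sq, hν]
    simp
  have hnorm : ∀ (s : ℝ) (w : (ℝ ∙ ν)ᗮ), ‖w‖ ≤ ‖s • ν + (w : E n)‖ := by
    intro s w
    have h0 : ⟪ν, (w : E n)⟫ = 0 := Submodule.mem_orthogonal_singleton_iff_inner_right.1 w.2
    have h1 : ‖s • ν + (w : E n)‖ ^ 2 = ‖s • ν‖ ^ 2 + ‖(w : E n)‖ ^ 2 := by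
      rw [norm_add_sq_real, inner_smul_left, h0]; simp
    have h2 : ‖(w : E n)‖ ^ 2 ≤ ‖s • ν + (w : E n)‖ ^ 2 := by rw [h1]; nlinarith [sq_nonneg ‖s • ν‖]
    exact (sq_le_sq₀ (norm_nonneg _) (norm_nonneg _)).1 h2
  -- Orthogonal projection shortens vectors, so one compact ball carries every slice; continuity of
  -- `M` then follows from continuity of a parametric integral over a compact set.
  have hMset : M = fun s => ∫ w in Metric.closedBall (0 : (ℝ ∙ ν)ᗮ) R, m (s • ν + w) := by
    funext s
    rw [setIntegral_eq_integral_of_forall_compl_eq_zero]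
    intro w hw
    by_contra hne
    have := hR (subset_tsupport m hne)
    rw [mem_closedBall_zero_iff] at this
    exact hw (mem_closedBall_zero_iff.2 ((hnorm s w).trans this))
  have hMcont : Continuous M := by
    rw [hMset]
    exact continuous_parametric_integral_of_continuous (by fun_prop) (isCompact_closedBall _ _)
  have hF : ∀ δ : ℝ, 0 < δ → ∫ u, (δ⁻¹ * θ (δ⁻¹ * ⟪ν, u⟫)) • m u
      = ∫ τ in tsupport θ, θ τ • M (δ * τ) := by
    intro δ hδ
    have hcs : HasCompactSupport fun u => (δ⁻¹ * θ (δ⁻¹ * ⟪ν, u⟫)) • m u := hc.smul_left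
    have hint : Integrable (fun u => (δ⁻¹ * θ (δ⁻¹ * ⟪ν, u⟫)) • m u) :=
      Continuous.integrable_of_hasCompactSupport (by fun_prop) hcs
    rw [← hAm.integral_comp' (g := fun u => (δ⁻¹ * θ (δ⁻¹ * ⟪ν, u⟫)) • m u), integral_prod]
    · simp only [hA, hinner]
      rw [setIntegral_eq_integral_of_forall_compl_eq_zero]
      · have := integral_comp_mul_left (fun s => (δ⁻¹ * θ (δ⁻¹ * s)) • M s) δ
        rw [abs_of_pos (inv_pos.2 hδ)] at this
        rw [show (∫ τ, θ τ • M (δ * τ)) =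
          δ • ∫ τ, (δ⁻¹ * θ (δ⁻¹ * (δ * τ))) • M (δ * τ) by
            rw [← integral_smul]
            congr 1; funext τ
            rw [smul_smul, ← mul_assoc, mul_inv_cancel₀ hδ.ne', one_mul, ← mul_assoc,
              inv_mul_cancel₀ hδ.ne', one_mul], this, smul_smul, mul_inv_cancel₀ hδ.ne', one_smul]
        congr 1; funext s
        rw [hMdef, ← integral_smul]
      · intro τ hτ
        rw [image_eq_zero_of_notMem_tsupport hτ, zero_smul]
    · exact hAm.integrable_comp_of_integrable hint
  have hcont : Continuous fun δ : ℝ => ∫ τ in tsupport θ, θ τ • M (δ * τ) :=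
    continuous_parametric_integral_of_continuous (by fun_prop) hθc.isCompact
  have h0 : ∫ τ in tsupport θ, θ τ • M (0 * τ) =
      ∫ u in {u : E n | ⟪ν, u⟫ = 0}, m u ∂μHE[n - 1] := by
    simp only [zero_mul]
    rw [integral_smul_const, setIntegral_eq_integral_of_forall_compl_eq_zero, hθ1, one_smul,
      ← setIntegral_hyperplane ν hν]
    · simp [hMdef]
    · intro τ hτ
      exact image_eq_zero_of_notMem_tsupport hτ
  have hl := (hcont.tendsto 0).mono_left (nhdsWithin_le_nhds (s := Ioi 0))
  rw [h0] at hl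
  exact hl.congr' (by filter_upwards [self_mem_nhdsWithin] with δ hδ using (hF δ hδ).symm)

/-- Write `∫k dμ' - ∫k dμ = (K-1)∫k dμ - ∫k d(Kμ - μ')`. The first term costs `K - 1`. The second
costs `K - (2 - K)`, because `μ ≤ K μ'` gives `∫‖k‖ dμ' ≥ (2 - K) ∫‖k‖ dμ`. -/
theorem norm_integral_sub_integral_le {α : Type*} [MeasurableSpace α] {μ μ' : Measure α}
    [IsFiniteMeasure μ] [IsFiniteMeasure μ'] {K : NNReal} (hK : 1 ≤ K) (h1 : μ' ≤ K • μ)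
    (h2 : μ ≤ K • μ') {k : α → X} (hk : Integrable k μ) :
    ‖∫ x, k x ∂μ' - ∫ x, k x ∂μ‖ ≤ 3 * ((K : ℝ) - 1) * ∫ x, ‖k x‖ ∂μ := by
  have hkK : Integrable k (K • μ) := hk.smul_measure_nnreal
  have hk' : Integrable k μ' := hkK.mono_measure h1
  have hadd := sub_add_cancel_of_le h1
  have hkτ : Integrable k (K • μ - μ') := hkK.mono_measure sub_le
  have e1 : ∫ x, k x ∂(K • μ - μ') + ∫ x, k x ∂μ' = (K : ℝ) • ∫ x, k x ∂μ := by
    rw [← integral_add_measure hkτ hk', hadd, integral_smul_nnreal_measure]; rfl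
  have e2 : ∫ x, ‖k x‖ ∂(K • μ - μ') + ∫ x, ‖k x‖ ∂μ' = (K : ℝ) * ∫ x, ‖k x‖ ∂μ := by
    rw [← integral_add_measure hkτ.norm hk'.norm, hadd, integral_smul_nnreal_measure]; rfl
  have e3 : ∫ x, ‖k x‖ ∂μ ≤ K * ∫ x, ‖k x‖ ∂μ' := by
    have := integral_mono_measure h2 (Eventually.of_forall fun x => norm_nonneg (k x))
      hk'.norm.smul_measure_nnreal
    rw [integral_smul_nnreal_measure] at this
    exact this
  have e4 : ‖∫ x, k x ∂(K • μ - μ')‖ ≤ ∫ x, ‖k x‖ ∂(K • μ - μ') := norm_integral_le_integral_norm _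
  have e5 : ‖∫ x, k x ∂μ‖ ≤ ∫ x, ‖k x‖ ∂μ := norm_integral_le_integral_norm _
  have hK' : (1 : ℝ) ≤ K := by exact_mod_cast hK
  have e6 : ∫ x, k x ∂μ' - ∫ x, k x ∂μ =
      ((K : ℝ) - 1) • ∫ x, k x ∂μ - ∫ x, k x ∂(K • μ - μ') := by
    rw [sub_smul, ← e1, one_smul]; abel
  have e7 : 0 ≤ ∫ x, ‖k x‖ ∂μ := integral_nonneg fun x => norm_nonneg _
  have e8 : 0 ≤ ∫ x, ‖k x‖ ∂μ' := integral_nonneg fun x => norm_nonneg _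
  rw [e6]
  refine (norm_sub_le _ _).trans ?_
  rw [norm_smul, Real.norm_of_nonneg (by linarith)]
  have e9 : (2 - (K : ℝ)) * ∫ x, ‖k x‖ ∂μ ≤ ∫ x, ‖k x‖ ∂μ' := by
    by_cases h : (K : ℝ) ≤ 2
    · nlinarith [mul_le_mul_of_nonneg_left e3 (sub_nonneg.2 h), mul_nonneg (sq_nonneg ((K : ℝ) - 1)) e8]
    · nlinarith
  nlinarith [mul_le_mul_of_nonneg_left e5 (sub_nonneg.2 hK')]

end HyperbolicClifford

/-! ### Outer normals and the local flattening of the boundary -/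

namespace HyperbolicClifford

open Filter Topology Measure Module
open scoped NNReal

variable {X : Type*} [NormedAddCommGroup X] [NormedSpace ℝ X]

theorem toDual_gradient {n : ℕ} (f : E n → ℝ) (x : E n) :
    InnerProductSpace.toDual ℝ (E n) (gradient f x) = fderiv ℝ f x := by
  simp [gradient]

theorem inner_gradient {n : ℕ} (f : E n → ℝ) (x v : E n) : ⟪gradient f x, v⟫ = fderiv ℝ f x v := by
  rw [gradient, InnerProductSpace.toDual_symm_apply]

theorem IsOuterUnitNormal.norm_eq {n : ℕ} {V : Set (E n)} {x ν : E n}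
    (h : IsOuterUnitNormal V x ν) : ‖ν‖ = 1 := by
  obtain ⟨W, ρ, -, -, -, h0, -, -, -, rfl⟩ := h
  rw [norm_smul, norm_inv, norm_norm, inv_mul_cancel₀ (norm_ne_zero_iff.2 h0)]

theorem IsOuterUnitNormal.exists_normalized {n : ℕ} {V : Set (E n)} {x ν : E n}
    (h : IsOuterUnitNormal V x ν) :
    ∃ (W : Set (E n)) (ρ : E n → ℝ), IsOpen W ∧ x ∈ W ∧ ContDiffOn ℝ 1 ρ W ∧ gradient ρ x = ν ∧
      V ∩ W = {z ∈ W | ρ z < 0} ∧ frontier V ∩ W = {z ∈ W | ρ z = 0} ∧ x ∈ frontier V := by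
  obtain ⟨W, ρ, hW, hx, hρ, h0, h1, h2, h3, rfl⟩ := h
  have hc : 0 < ‖gradient ρ x‖⁻¹ := inv_pos.2 (norm_pos_iff.2 h0)
  refine ⟨W, fun z => ‖gradient ρ x‖⁻¹ * ρ z, hW, hx, contDiffOn_const.mul hρ, ?_, ?_, ?_, h3⟩
  · have hd : DifferentiableAt ℝ ρ x :=
      (hρ.contDiffAt (hW.mem_nhds hx)).differentiableAt one_ne_zero
    have := (hd.hasGradientAt.hasFDerivAt.const_mul ‖gradient ρ x‖⁻¹)
    refine HasGradientAt.gradient (hasGradientAt_iff_hasFDerivAt.2 ?_)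
    convert! this using 1
    simp
  · rw [h1]; ext z
    simp only [mem_ofPred_eq, mul_neg_iff, hc, hc.not_gt, true_and, false_and, or_false]
  · rw [h2]; ext z
    simp only [mem_ofPred_eq, mul_eq_zero, hc.ne', false_or]

/-- The derivative of the normalized `ρ` along `v` is `⟪ν, v⟫`, and `ρ x = 0`, so its sign decides
on which side of the boundary the ray starts. This describes `ν` through `V` alone. -/
theorem IsOuterUnitNormal.eventually {n : ℕ} {V : Set (E n)} {x ν : E n}
    (h : IsOuterUnitNormal V x ν) (v : E n) :
    (⟪ν, v⟫ < 0 → ∀ᶠ t : ℝ in 𝓝[>] 0, x + t • v ∈ V) ∧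
      (0 < ⟪ν, v⟫ → ∀ᶠ t : ℝ in 𝓝[>] 0, x + t • v ∉ V) := by
  obtain ⟨W, ρ, hW, hx, hρ, h0, h1, h2, h3⟩ := h.exists_normalized
  have hd : DifferentiableAt ℝ ρ x :=
    (hρ.contDiffAt (hW.mem_nhds hx)).differentiableAt one_ne_zero
  have hx0 : ρ x = 0 := by
    have : x ∈ frontier V ∩ W := ⟨h3, hx⟩
    rw [h2] at this
    exact this.2
  have hl : HasDerivAt (fun t : ℝ => x + t • v) v 0 := by
    simpa using ((hasDerivAt_id (0 : ℝ)).smul_const v).const_add x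
  have hφ : HasDerivAt (fun t : ℝ => ρ (x + t • v)) ⟪ν, v⟫ 0 := by
    have hd' : HasFDerivAt ρ (fderiv ℝ ρ x) (x + (0 : ℝ) • v) := by simpa using hd.hasFDerivAt
    have := hd'.comp_hasDerivAt 0 hl
    rwa [← inner_gradient, h0] at this
  have hs := (hasDerivAt_iff_tendsto_slope.1 hφ).mono_left
    (nhdsWithin_mono (0 : ℝ) (fun t (ht : t ∈ Ioi (0 : ℝ)) => (ne_of_gt ht : t ≠ 0)))
  have hWe : ∀ᶠ t : ℝ in 𝓝[>] 0, x + t • v ∈ W := by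
    have : Tendsto (fun t : ℝ => x + t • v) (𝓝 0) (𝓝 x) := by
      simpa using hl.continuousAt.tendsto
    exact (this.mono_left nhdsWithin_le_nhds).eventually (hW.mem_nhds hx)
  constructor
  · intro hneg
    filter_upwards [hs.eventually (gt_mem_nhds hneg), hWe, self_mem_nhdsWithin] with t ht htW ht0
    have ht0' : (0 : ℝ) < t := ht0
    simp only [slope_def_field, zero_smul, add_zero, hx0, sub_zero] at ht
    have : x + t • v ∈ V ∩ W := by
      rw [h1]
      refine ⟨htW, ?_⟩
      by_contra hcon
      exact absurd ht (not_lt.2 (div_nonneg (not_lt.1 hcon) ht0'.le))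
    exact this.1
  · intro hpos
    filter_upwards [hs.eventually (lt_mem_nhds hpos), hWe, self_mem_nhdsWithin] with t ht htW ht0 hV
    have ht0' : (0 : ℝ) < t := ht0
    simp only [slope_def_field, zero_smul, add_zero, hx0, sub_zero] at ht
    have : x + t • v ∈ V ∩ W := ⟨hV, htW⟩
    rw [h1] at this
    exact absurd ht (not_lt.2 (div_nonpos_of_nonpos_of_nonneg this.2.le ht0'.le))

/-- If the two differed, the direction `ν' - ν` would enter `V` according to `ν` and leave it
according to `ν'`. Hence the normal may be computed from any local defining function. -/
theorem IsOuterUnitNormal.unique {n : ℕ} {V : Set (E n)} {x ν ν' : E n}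
    (h : IsOuterUnitNormal V x ν) (h' : IsOuterUnitNormal V x ν') : ν = ν' := by
  by_contra hne
  have h1 : ⟪ν, ν'⟫ < 1 := by
    refine lt_of_le_of_ne ?_ fun h1 => hne ((inner_eq_one_iff_of_norm_eq_one h.norm_eq h'.norm_eq).1 h1)
    have := real_inner_le_norm ν ν'
    rwa [h.norm_eq, h'.norm_eq, mul_one] at this
  have e1 := (h.eventually (ν' - ν)).1 (by
    rw [inner_sub_right, real_inner_self_eq_norm_sq, h.norm_eq]; linarith)
  have e2 := (h'.eventually (ν' - ν)).2 (by
    rw [inner_sub_right, real_inner_self_eq_norm_sq, h'.norm_eq, real_inner_comm]; linarith)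
  obtain ⟨t, ht⟩ := (e1.and e2).exists
  exact ht.2 ht.1

/-- The map `Ψ` replaces the `ν₀`-coordinate of `x` by `ρ x`. With `∇ρ(x₀) = ν₀` its derivative at
`x₀` is the identity, so on a small ball it is as close to an isometry as desired, and the inverse
function theorem applies. -/
theorem IsOuterUnitNormal.exists_flattening {n : ℕ} {V : Set (E n)} {x₀ ν₀ : E n}
    (h : IsOuterUnitNormal V x₀ ν₀) {c : ℝ≥0} (hc0 : 0 < c) (hc1 : c < 1) :
    ∃ (φ : OpenPartialHomeomorph (E n) (E n)) (ρ : E n → ℝ) (D : E n → E n →L[ℝ] E n),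
      x₀ ∈ φ.source ∧ V ∩ φ.source = {z ∈ φ.source | ρ z < 0} ∧
      frontier V ∩ φ.source = {z ∈ φ.source | ρ z = 0} ∧ ContDiffOn ℝ 1 ρ φ.source ∧
      (∀ x ∈ φ.source, ⟪ν₀, φ x⟫ = ρ x) ∧ ContinuousOn D φ.source ∧
      (∀ x ∈ φ.source, HasFDerivAt φ (D x) x) ∧
      (∀ x ∈ φ.source, (D x).det ≠ 0 ∧ |(|(D x).det|)⁻¹ - 1| ≤ c) ∧
      LipschitzOnWith (1 + c) φ φ.source ∧ LipschitzOnWith (1 + c) φ.symm φ.target ∧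
      ∀ x ∈ φ.source, ‖gradient ρ x - ν₀‖ ≤ c := by
  obtain ⟨W, ρ, hW, hx, hρ, h0, h1, h2, h3⟩ := h.exists_normalized
  have hν := h.norm_eq
  have hnt : Nontrivial (E n) := ⟨ν₀, 0, by rintro rfl; simp at hν⟩
  set Ψ : E n → E n := fun x => x + (ρ x - ⟪ν₀, x⟫) • ν₀ with hΨ
  set D : E n → E n →L[ℝ] E n := fun x =>
    ContinuousLinearMap.id ℝ (E n) + (fderiv ℝ ρ x - innerSL ℝ ν₀).smulRight ν₀ with hD
  have hfd : ContinuousOn (fun x => fderiv ℝ ρ x) W :=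
    hρ.continuousOn_fderiv_of_isOpen hW le_rfl
  have hDc : ContinuousOn D W := by
    have hl : Continuous fun L : E n →L[ℝ] ℝ =>
        ContinuousLinearMap.id ℝ (E n) + (L - innerSL ℝ ν₀).smulRight ν₀ := by
      have : Continuous fun L : E n →L[ℝ] ℝ => L.smulRight ν₀ :=
        (ContinuousLinearMap.smulRightL ℝ (E n) (E n)).continuous.clm_apply continuous_const
      exact continuous_const.add (this.comp (continuous_id.sub continuous_const))
    exact hl.comp_continuousOn hfd
  have hΨd : ∀ x ∈ W, HasFDerivAt Ψ (D x) x := by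
    intro x hxW
    have hd : DifferentiableAt ℝ ρ x :=
      (hρ.contDiffAt (hW.mem_nhds hxW)).differentiableAt one_ne_zero
    exact (hasFDerivAt_id x).add ((hd.hasFDerivAt.sub (innerSL ℝ ν₀).hasFDerivAt).smul_const ν₀)
  have hν0 : fderiv ℝ ρ x₀ = innerSL ℝ ν₀ := by
    rw [← toDual_gradient, h0]; rfl
  have hDx : D x₀ = ContinuousLinearMap.id ℝ (E n) := by
    simp only [hD, hν0, sub_self]
    ext v; simp
  have hWn := hW.mem_nhds hx
  have hgr : ∀ x, ‖gradient ρ x - ν₀‖ = ‖fderiv ℝ ρ x - innerSL ℝ ν₀‖ := by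
    intro x
    rw [← (InnerProductSpace.toDual ℝ (E n)).norm_map, map_sub, toDual_gradient]; rfl
  -- The bound `c/2` rather than `c` leaves room for the inverse: its Lipschitz constant `1/(1 -
  -- c/2)` is at most `1 + c` when `c ≤ 1`.
  have hev1 : ∀ᶠ x in 𝓝 x₀, ‖gradient ρ x - ν₀‖ < c / 2 := by
    simp only [hgr]
    have : ContinuousAt (fun x => ‖fderiv ℝ ρ x - innerSL ℝ ν₀‖) x₀ :=
      ((hfd.continuousAt hWn).sub continuousAt_const).norm
    have ht := this.tendsto
    simp only [hν0, sub_self, norm_zero] at ht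
    exact ht.eventually (gt_mem_nhds (half_pos (by exact_mod_cast hc0)))
  have hdet : ContinuousAt (fun x => (D x).det) x₀ :=
    ContinuousLinearMap.continuous_det.continuousAt.comp (hDc.continuousAt hWn)
  have hdet1 : (D x₀).det = 1 := by rw [hDx]; simp [ContinuousLinearMap.det]
  have hev2 : ∀ᶠ x in 𝓝 x₀, (D x).det ≠ 0 :=
    hdet.eventually_ne (by rw [hdet1]; exact one_ne_zero)
  have hev3 : ∀ᶠ x in 𝓝 x₀, |(|(D x).det|)⁻¹ - 1| < c := by
    have : ContinuousAt (fun x => |(|(D x).det|)⁻¹ - 1|) x₀ :=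
      ((hdet.abs.inv₀ (by rw [hdet1]; simp)).sub continuousAt_const).abs
    have ht := this.tendsto
    simp only [hdet1, abs_one, inv_one, sub_self, abs_zero] at ht
    exact ht.eventually (gt_mem_nhds (by exact_mod_cast hc0))
  obtain ⟨r, hr, hball⟩ := Metric.eventually_nhds_iff_ball.1 ((hev1.and (hev2.and hev3)).and hWn)
  set B := Metric.ball x₀ r
  have hBW : B ⊆ W := fun x hx => (hball x hx).2
  have hlip : LipschitzOnWith (c / 2) (Ψ - ⇑(ContinuousLinearMap.id ℝ (E n))) B := by
    refine Convex.lipschitzOnWith_of_nnnorm_hasFDerivWithin_le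
      (f' := fun x => D x - ContinuousLinearMap.id ℝ (E n)) (fun x hx => ?_) (fun x hx => ?_)
      (convex_ball x₀ r)
    · exact ((hΨd x (hBW hx)).sub (ContinuousLinearMap.hasFDerivAt _)).hasFDerivWithinAt
    · have h5 := (hball x hx).1.1.le
      rw [hgr] at h5
      rw [← NNReal.coe_le_coe, coe_nnnorm]
      simp only [hD, add_sub_cancel_left, ContinuousLinearMap.norm_smulRight_apply, hν, mul_one]
      simpa using h5
  have happ : ApproximatesLinearOn Ψ
      ((ContinuousLinearEquiv.refl ℝ (E n) : E n ≃L[ℝ] E n) : E n →L[ℝ] E n) B (c / 2) :=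
    hlip.approximatesLinearOn
  have hcN : Subsingleton (E n) ∨ c / 2 <
      ‖((ContinuousLinearEquiv.refl ℝ (E n)).symm : E n →L[ℝ] E n)‖₊⁻¹ := by
    right
    have : ‖((ContinuousLinearEquiv.refl ℝ (E n)).symm : E n →L[ℝ] E n)‖₊ = 1 := by
      rw [← NNReal.coe_inj, coe_nnnorm]
      exact ContinuousLinearMap.norm_id
    rw [this, inv_one]
    exact (half_le_self zero_le).trans_lt hc1
  set φ := happ.toOpenPartialHomeomorph Ψ B hcN Metric.isOpen_ball with hφ
  have hsrc : φ.source = B := rfl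
  have hφΨ : ∀ x, φ x = Ψ x := fun x => rfl
  have hest : ∀ x ∈ B, ∀ y ∈ B, ‖Ψ x - Ψ y - (x - y)‖ ≤ (c : ℝ) / 2 * ‖x - y‖ := by
    intro x hx y hy
    simpa using happ x hx y hy
  have hc0' : (0 : ℝ) < c := by exact_mod_cast hc0
  have hc1' : (c : ℝ) < 1 := by exact_mod_cast hc1
  refine ⟨φ, ρ, D, Metric.mem_ball_self hr, ?_, ?_, hρ.mono hBW, ?_, hDc.mono hBW, ?_, ?_, ?_, ?_, ?_⟩
  · rw [hsrc]
    ext z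
    constructor
    · rintro ⟨hz, hzB⟩
      have : z ∈ V ∩ W := ⟨hz, hBW hzB⟩
      rw [h1] at this
      exact ⟨hzB, this.2⟩
    · rintro ⟨hzB, hz⟩
      have : z ∈ V ∩ W := by rw [h1]; exact ⟨hBW hzB, hz⟩
      exact ⟨this.1, hzB⟩
  · rw [hsrc]
    ext z
    constructor
    · rintro ⟨hz, hzB⟩
      have : z ∈ frontier V ∩ W := ⟨hz, hBW hzB⟩
      rw [h2] at this
      exact ⟨hzB, this.2⟩
    · rintro ⟨hzB, hz⟩
      have : z ∈ frontier V ∩ W := by rw [h2]; exact ⟨hBW hzB, hz⟩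
      exact ⟨this.1, hzB⟩
  · intro x _
    rw [hφΨ]
    simp only [hΨ, inner_add_right, inner_smul_right, real_inner_self_eq_norm_sq, hν]
    ring
  · exact fun x hx => hΨd x (hBW hx)
  · exact fun x hx => ⟨(hball x hx).1.2.1, (hball x hx).1.2.2.le⟩
  · rw [lipschitzOnWith_iff_norm_sub_le]
    intro x hx y hy
    have h5 := hest x hx y hy
    rw [hφΨ, hφΨ]
    have h6 : ‖Ψ x - Ψ y‖ ≤ ‖Ψ x - Ψ y - (x - y)‖ + ‖x - y‖ := by
      simpa using norm_add_le (Ψ x - Ψ y - (x - y)) (x - y)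
    push_cast
    nlinarith [norm_nonneg (x - y)]
  · rw [lipschitzOnWith_iff_norm_sub_le]
    intro u hu w hw
    have h5 := hest _ (φ.map_target hu) _ (φ.map_target hw)
    rw [← hφΨ, ← hφΨ, φ.right_inv hu, φ.right_inv hw] at h5
    have h6 : ‖φ.symm u - φ.symm w‖ ≤ ‖u - w - (φ.symm u - φ.symm w)‖ + ‖u - w‖ := by
      rw [norm_sub_rev (u - w)]
      simpa using norm_add_le (φ.symm u - φ.symm w - (u - w)) (u - w)
    push_cast
    have h7 : (1 - (c : ℝ) / 2) * ‖φ.symm u - φ.symm w‖ ≤ ‖u - w‖ := by linarith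
    have h8 : 1 ≤ (1 + (c : ℝ)) * (1 - c / 2) := by nlinarith
    calc ‖φ.symm u - φ.symm w‖ ≤ ((1 + (c : ℝ)) * (1 - c / 2)) * ‖φ.symm u - φ.symm w‖ :=
          le_mul_of_one_le_left (norm_nonneg _) h8
      _ = (1 + (c : ℝ)) * ((1 - c / 2) * ‖φ.symm u - φ.symm w‖) := by ring
      _ ≤ _ := by gcongr
  · intro x hx
    exact (hball x hx).1.1.le.trans (by linarith)

end HyperbolicClifford

/-! ### Smoothed indicators, level sets and Hausdorff measure under the flattening -/

namespace HyperbolicClifford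

open Filter Topology Measure Module
open scoped NNReal

variable {X : Type*} [NormedAddCommGroup X] [NormedSpace ℝ X]

theorem continuous_smul_of_tsupport_subset {α : Type*} [TopologicalSpace α] {a : α → ℝ} {f : α → X}
    {s : Set α} (hs : IsOpen s) (ha : ContinuousOn a s) (hf : Continuous f)
    (hfs : tsupport f ⊆ s) : Continuous fun x => a x • f x :=
  (ha.smul hf.continuousOn).continuous_of_tsupport_subset hs
    ((tsupport_smul_subset_right a f).trans hfs)

theorem deriv_smoothTransition_eq_zero {t : ℝ} (ht : t < 0 ∨ 1 < t) :
    deriv Real.smoothTransition t = 0 := by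
  rcases ht with ht | ht
  · have : Real.smoothTransition =ᶠ[𝓝 t] fun _ => 0 := by
      filter_upwards [gt_mem_nhds ht] with s hs using Real.smoothTransition.zero_of_nonpos hs.le
    rw [this.deriv_eq, deriv_const]
  · have : Real.smoothTransition =ᶠ[𝓝 t] fun _ => 1 := by
      filter_upwards [lt_mem_nhds ht] with s hs using Real.smoothTransition.one_of_one_le hs.le
    rw [this.deriv_eq, deriv_const]

theorem continuous_deriv_smoothTransition : Continuous (deriv Real.smoothTransition) :=
  (Real.smoothTransition.contDiff (n := 1)).continuous_deriv le_rfl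

theorem hasDerivAt_smoothTransition (t : ℝ) :
    HasDerivAt Real.smoothTransition (deriv Real.smoothTransition t) t :=
  ((Real.smoothTransition.contDiff (n := 1)).differentiable one_ne_zero t).hasDerivAt

theorem hasCompactSupport_deriv_smoothTransition :
    HasCompactSupport (deriv Real.smoothTransition) := by
  refine HasCompactSupport.intro (isCompact_Icc (a := (0 : ℝ)) (b := 1)) fun t ht => ?_
  rw [mem_Icc, not_and_or, not_le, not_le] at ht
  exact deriv_smoothTransition_eq_zero ht

theorem integral_deriv_smoothTransition : ∫ t, deriv Real.smoothTransition t = 1 := by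
  have := integral_of_hasDerivAt_of_tendsto (f := Real.smoothTransition)
    (f' := deriv Real.smoothTransition) (m := 0) (n := 1) hasDerivAt_smoothTransition
    (continuous_deriv_smoothTransition.integrable_of_hasCompactSupport
      hasCompactSupport_deriv_smoothTransition) ?_ ?_
  · simpa using this
  · exact tendsto_const_nhds.congr' (by
      filter_upwards [eventually_le_atBot (0 : ℝ)] with s hs
        using (Real.smoothTransition.zero_of_nonpos hs).symm)
  · exact tendsto_const_nhds.congr' (by
      filter_upwards [eventually_ge_atTop (1 : ℝ)] with s hs
        using (Real.smoothTransition.one_of_one_le hs).symm)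

/-- Integration by parts against a smoothed indicator of `{ρ < 0}`: as `δ → 0` the left side becomes
an integral over `V`, and the right side concentrates on `{ρ = 0}`. -/
theorem integral_smoothTransition_smul_fderiv {n : ℕ} {B : Set (E n)} (hB : IsOpen B)
    {ρ : E n → ℝ} (hρ : ContDiffOn ℝ 1 ρ B) {f : E n → X} (hf : ContDiff ℝ 1 f)
    (hfc : HasCompactSupport f) (hfB : tsupport f ⊆ B) (v : E n) (δ : ℝ) :
    ∫ x, Real.smoothTransition (δ⁻¹ * -ρ x) • fderiv ℝ f x v =
      ∫ x, (δ⁻¹ * deriv Real.smoothTransition (-(δ⁻¹ * ρ x))) • (fderiv ℝ ρ x v • f x) := by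
  have hd : ∀ x ∈ B, HasFDerivAt (fun x => Real.smoothTransition (δ⁻¹ * -ρ x))
      (deriv Real.smoothTransition (δ⁻¹ * -ρ x) • (δ⁻¹ • -fderiv ℝ ρ x)) x := by
    intro x hx
    have hdρ : DifferentiableAt ℝ ρ x :=
      (hρ.contDiffAt (hB.mem_nhds hx)).differentiableAt one_ne_zero
    exact (hasDerivAt_smoothTransition _).comp_hasFDerivAt x
      ((hdρ.hasFDerivAt.neg).const_mul δ⁻¹)
  have hcρ := hρ.continuousOn
  have hc1 : ContinuousOn (fun x => Real.smoothTransition (δ⁻¹ * -ρ x)) B :=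
    Real.smoothTransition.continuous.comp_continuousOn (continuousOn_const.mul hcρ.neg)
  have hcd : ContinuousOn (fun x => fderiv ℝ ρ x v) B :=
    (hρ.continuousOn_fderiv_of_isOpen hB le_rfl).clm_apply continuousOn_const
  have hc2 : ContinuousOn (fun x => deriv Real.smoothTransition (δ⁻¹ * -ρ x) *
      (δ⁻¹ * -fderiv ℝ ρ x v)) B :=
    (continuous_deriv_smoothTransition.comp_continuousOn (continuousOn_const.mul hcρ.neg)).mul
      (continuousOn_const.mul hcd.neg)
  have hfv : Continuous fun x => fderiv ℝ f x v :=
    (hf.continuous_fderiv one_ne_zero).clm_apply continuous_const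
  have hfvc : HasCompactSupport fun x => fderiv ℝ f x v := hfc.fderiv_apply ℝ v
  have hfvB : tsupport (fun x => fderiv ℝ f x v) ⊆ B :=
    (tsupport_fderiv_apply_subset ℝ v).trans hfB
  have hder : ∀ x, fderiv ℝ (fun x => Real.smoothTransition (δ⁻¹ * -ρ x)) x v • f x =
      (deriv Real.smoothTransition (δ⁻¹ * -ρ x) * (δ⁻¹ * -fderiv ℝ ρ x v)) • f x := by
    intro x
    by_cases hx : x ∈ tsupport f
    · rw [(hd x (hfB hx)).fderiv]; rfl
    · rw [image_eq_zero_of_notMem_tsupport hx, smul_zero, smul_zero]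
  rw [integral_smul_fderiv_eq_neg_fderiv_smul_of_integrable]
  · rw [← integral_neg]
    congr 1; funext x
    rw [hder, smul_smul, ← neg_smul]
    congr 1
    rw [mul_neg]; ring
  · simp only [hder]
    exact (continuous_smul_of_tsupport_subset hB hc2 hf.continuous hfB).integrable_of_hasCompactSupport
      hfc.smul_left
  · exact (continuous_smul_of_tsupport_subset hB hc1 hfv hfvB).integrable_of_hasCompactSupport
      hfvc.smul_left
  · exact (continuous_smul_of_tsupport_subset hB hc1 hf.continuous hfB).integrable_of_hasCompactSupport
      hfc.smul_left
  · exact fun x hx => (hd x (hfB hx)).differentiableAt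
  · exact fun x _ => hf.differentiable one_ne_zero x

theorem tendsto_integral_smoothTransition_smul {n : ℕ} {V B : Set (E n)} (hV : MeasurableSet V)
    (hB : IsOpen B) {ρ : E n → ℝ} (hρ : ContinuousOn ρ B) (hVB : V ∩ B = {z ∈ B | ρ z < 0})
    {g : E n → X} (hg : Continuous g) (hgc : HasCompactSupport g) (hgB : tsupport g ⊆ B) :
    Tendsto (fun δ : ℝ => ∫ x, Real.smoothTransition (δ⁻¹ * -ρ x) • g x) (𝓝[>] 0)
      (𝓝 (∫ x in V, g x)) := by
  rw [← integral_indicator hV]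
  refine tendsto_integral_filter_of_dominated_convergence (fun x => ‖g x‖) ?_ ?_ ?_ ?_
  · exact Eventually.of_forall fun δ => (continuous_smul_of_tsupport_subset hB
      (Real.smoothTransition.continuous.comp_continuousOn (continuousOn_const.mul hρ.neg)) hg
      hgB).aestronglyMeasurable
  · refine Eventually.of_forall fun δ => Eventually.of_forall fun x => ?_
    rw [norm_smul, Real.norm_of_nonneg (Real.smoothTransition.nonneg _)]
    exact mul_le_of_le_one_left (norm_nonneg _) (Real.smoothTransition.le_one _)
  · exact (hg.integrable_of_hasCompactSupport hgc).norm
  · refine Eventually.of_forall fun x => ?_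
    by_cases hx : x ∈ tsupport g
    · have hxB := hgB hx
      have hiff : x ∈ V ↔ ρ x < 0 := by
        have : x ∈ V ∩ B ↔ x ∈ {z ∈ B | ρ z < 0} := by rw [hVB]
        simpa [hxB] using this
      by_cases hxV : x ∈ V
      · rw [indicator_of_mem hxV]
        have h0 := hiff.1 hxV
        refine tendsto_const_nhds.congr' ?_
        have h1 : Ioc 0 (-ρ x) ∈ 𝓝[>] (0 : ℝ) := Ioc_mem_nhdsGT (neg_pos.2 h0)
        filter_upwards [h1] with δ hδ
        rw [Real.smoothTransition.one_of_one_le, one_smul]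
        rw [← div_eq_inv_mul, le_div_iff₀ hδ.1, one_mul]
        exact hδ.2
      · rw [indicator_of_notMem hxV]
        refine tendsto_const_nhds.congr' ?_
        filter_upwards [self_mem_nhdsWithin] with δ hδ
        rw [Real.smoothTransition.zero_of_nonpos, zero_smul]
        have : 0 ≤ ρ x := not_lt.1 fun h => hxV (hiff.2 h)
        exact mul_nonpos_of_nonneg_of_nonpos (inv_nonneg.2 (le_of_lt hδ)) (neg_nonpos.2 this)
    · have h0 := image_eq_zero_of_notMem_tsupport hx
      have : V.indicator g x = 0 := by simp [h0]
      simp [h0, this]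

/-- The change of variables `u = φ x` makes `ρ` the linear function `⟪ν, u⟫` at the cost of the
Jacobian `|det D|⁻¹`; the slab limit then applies. -/
theorem tendsto_integral_levelSet [CompleteSpace X] {n : ℕ} (φ : OpenPartialHomeomorph (E n) (E n)) {ρ : E n → ℝ}
    {D : E n → E n →L[ℝ] E n} {ν : E n} (hν : ‖ν‖ = 1) (hρφ : ∀ x ∈ φ.source, ⟪ν, φ x⟫ = ρ x)
    (hDc : ContinuousOn D φ.source) (hD : ∀ x ∈ φ.source, HasFDerivAt φ (D x) x)
    (hdet : ∀ x ∈ φ.source, (D x).det ≠ 0) {k : E n → X} (hk : Continuous k)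
    (hkc : HasCompactSupport k) (hkB : tsupport k ⊆ φ.source) :
    Tendsto (fun δ : ℝ => ∫ x, (δ⁻¹ * deriv Real.smoothTransition (-(δ⁻¹ * ρ x))) • k x) (𝓝[>] 0)
      (𝓝 (∫ u in {u : E n | ⟪ν, u⟫ = 0} ∩ φ.target,
        |(D (φ.symm u)).det|⁻¹ • k (φ.symm u) ∂μHE[n - 1])) := by
  classical
  have hdetc : ContinuousOn (fun x => |(D x).det|⁻¹) φ.source :=
    ((ContinuousLinearMap.continuous_det.comp_continuousOn hDc).abs).inv₀ fun x hx =>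
      abs_ne_zero.2 (hdet x hx)
  set k' : E n → X := fun x => |(D x).det|⁻¹ • k x with hk'
  have hk'c : Continuous k' := continuous_smul_of_tsupport_subset φ.open_source hdetc hk hkB
  -- Extension by zero is continuous because `k` is supported in a compact subset of the source.
  set m : E n → X := φ.target.indicator (fun u => k' (φ.symm u)) with hm
  have hKc : IsCompact (φ '' tsupport k) := hkc.isCompact.image_of_continuousOn (φ.continuousOn.mono hkB)
  have hm0 : ∀ u ∉ φ '' tsupport k, m u = 0 := by
    intro u hu
    rw [hm, indicator_apply]
    split_ifs with hut
    · have : φ.symm u ∉ tsupport k := fun h => hu ⟨_, h, φ.right_inv hut⟩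
      rw [hk']; simp [image_eq_zero_of_notMem_tsupport this]
    · rfl
  have hmc : HasCompactSupport m := HasCompactSupport.intro hKc hm0
  have hmt : tsupport m ⊆ φ.target := by
    refine (closure_minimal (fun u hu => ?_) hKc.isClosed).trans
      (image_subset_iff.2 fun x hx => φ.map_source (hkB hx))
    by_contra hcon
    exact hu (hm0 u hcon)
  have hmcont : Continuous m := by
    refine ContinuousOn.continuous_of_tsupport_subset (s := φ.target) ?_ φ.open_target hmt
    refine ContinuousOn.congr (f := fun u => k' (φ.symm u))
      (hk'c.comp_continuousOn φ.continuousOn_symm) fun u hu => ?_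
    rw [hm, indicator_of_mem hu]
  have hθc : HasCompactSupport fun t : ℝ => deriv Real.smoothTransition (-t) :=
    hasCompactSupport_deriv_smoothTransition.comp_homeomorph (Homeomorph.neg ℝ)
  have hlim := tendsto_integral_slab ν hν m hmcont hmc (fun t => deriv Real.smoothTransition (-t))
    (continuous_deriv_smoothTransition.comp continuous_neg) hθc
    (by rw [integral_neg_eq_self (deriv Real.smoothTransition) volume, integral_deriv_smoothTransition])
  have hmeas : MeasurableSet {u : E n | ⟪ν, u⟫ = 0} :=
    (isClosed_eq (by fun_prop) continuous_const).measurableSet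
  have hend : ∫ u in {u : E n | ⟪ν, u⟫ = 0}, m u ∂μHE[n - 1] =
      ∫ u in {u : E n | ⟪ν, u⟫ = 0} ∩ φ.target,
        |(D (φ.symm u)).det|⁻¹ • k (φ.symm u) ∂μHE[n - 1] := by
    rw [hm, setIntegral_indicator φ.open_target.measurableSet]
  rw [← hend]
  refine hlim.congr fun δ => ?_
  have e1 : ∫ u, (δ⁻¹ * deriv Real.smoothTransition (-(δ⁻¹ * ⟪ν, u⟫))) • m u =
      ∫ u in φ '' φ.source, (δ⁻¹ * deriv Real.smoothTransition (-(δ⁻¹ * ⟪ν, u⟫))) • m u := by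
    rw [φ.image_source_eq_target, setIntegral_eq_integral_of_forall_compl_eq_zero]
    intro u hu
    rw [hm, indicator_of_notMem hu, smul_zero]
  rw [e1, integral_image_eq_integral_abs_det_fderiv_smul volume φ.open_source.measurableSet
    (fun x hx => (hD x hx).hasFDerivWithinAt) φ.injOn]
  rw [← setIntegral_eq_integral_of_forall_compl_eq_zero (s := φ.source)
    (f := fun x => (δ⁻¹ * deriv Real.smoothTransition (-(δ⁻¹ * ρ x))) • k x)]
  · refine setIntegral_congr_fun φ.open_source.measurableSet fun x hx => ?_
    simp only [hm, hk', indicator_of_mem (φ.map_source hx), φ.left_inv hx, hρφ x hx]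
    rw [smul_comm (|(D x).det|), smul_smul (|(D x).det|),
      mul_inv_cancel₀ (abs_ne_zero.2 (hdet x hx)), one_smul]
  · intro x hx
    rw [image_eq_zero_of_notMem_tsupport fun h => hx (hkB h), smul_zero]

theorem _root_.LipschitzOnWith.euclideanHausdorffMeasure_image_le {α β : Type*} [MetricSpace α]
    [MeasurableSpace α] [BorelSpace α] [MetricSpace β] [MeasurableSpace β] [BorelSpace β]
    {K : ℝ≥0} {f : α → β} {s : Set α} (h : LipschitzOnWith K f s) (d : ℕ) :
    μHE[d] (f '' s) ≤ (K ^ d : ℝ≥0) * μHE[d] s := by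
  simp only [euclideanHausdorffMeasure_def, Measure.smul_apply]
  have := h.hausdorffMeasure_image_le (d := d) (by positivity)
  rw [ENNReal.smul_def, ENNReal.smul_def, smul_eq_mul, smul_eq_mul, mul_left_comm]
  gcongr
  simpa [ENNReal.rpow_natCast] using this

/-- A `K`-Lipschitz map enlarges `d`-dimensional Hausdorff measure by at most `K^d`; applied to `φ`
and to `φ.symm`, this traps each measure between multiples of the other. -/
theorem map_symm_hausdorff_comparison {n d : ℕ} (φ : OpenPartialHomeomorph (E n) (E n)) {K : ℝ≥0}
    (h1 : LipschitzOnWith K φ φ.source) (h2 : LipschitzOnWith K φ.symm φ.target)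
    {T₁ T₂ : Set (E n)} (hT₁ : MeasurableSet T₁) (hT₂ : MeasurableSet T₂)
    (h : ∀ x ∈ φ.source, x ∈ T₁ ↔ φ x ∈ T₂) :
    AEMeasurable φ.symm (μHE[d].restrict (T₂ ∩ φ.target)) ∧
    (μHE[d].restrict (T₂ ∩ φ.target)).map φ.symm ≤ K ^ d • μHE[d].restrict (T₁ ∩ φ.source) ∧
    μHE[d].restrict (T₁ ∩ φ.source) ≤ K ^ d • (μHE[d].restrict (T₂ ∩ φ.target)).map φ.symm := by
  have hm₂ := hT₂.inter φ.open_target.measurableSet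
  have hm₁ := hT₁.inter φ.open_source.measurableSet
  have hae : AEMeasurable φ.symm (μHE[d].restrict (T₂ ∩ φ.target)) :=
    (φ.continuousOn_symm.mono inter_subset_right).aemeasurable hm₂
  refine ⟨hae, ?_, ?_⟩
  · refine Measure.le_iff.2 fun A hA => ?_
    rw [map_apply_of_aemeasurable hae hA, restrict_apply' hm₂, Measure.smul_apply,
      restrict_apply' hm₁, ENNReal.smul_def, smul_eq_mul]
    have e : φ.symm ⁻¹' A ∩ (T₂ ∩ φ.target) ⊆ φ '' (A ∩ (T₁ ∩ φ.source)) := by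
      rintro u ⟨hu1, hu2, hu3⟩
      refine ⟨φ.symm u, ⟨hu1, ?_, φ.map_target hu3⟩, φ.right_inv hu3⟩
      rw [h _ (φ.map_target hu3), φ.right_inv hu3]
      exact hu2
    exact (measure_mono e).trans ((h1.mono (fun x hx => hx.2.2)).euclideanHausdorffMeasure_image_le d)
  · refine Measure.le_iff.2 fun A hA => ?_
    rw [Measure.smul_apply, map_apply_of_aemeasurable hae hA, restrict_apply' hm₂,
      restrict_apply' hm₁, ENNReal.smul_def, smul_eq_mul]
    have e : A ∩ (T₁ ∩ φ.source) ⊆ φ.symm '' (φ.symm ⁻¹' A ∩ (T₂ ∩ φ.target)) := by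
      rintro x ⟨hx1, hx2, hx3⟩
      refine ⟨φ x, ⟨?_, (h x hx3).1 hx2, φ.map_source hx3⟩, φ.left_inv hx3⟩
      rw [mem_preimage, φ.left_inv hx3]
      exact hx1
    exact (measure_mono e).trans ((h2.mono (fun x hx => hx.2.2)).euclideanHausdorffMeasure_image_le d)

end HyperbolicClifford

/-! ### Gauss-Green near one regular boundary point, up to a small error -/

namespace HyperbolicClifford

open Filter Topology Measure Module
open scoped NNReal

variable {X : Type*} [NormedAddCommGroup X] [NormedSpace ℝ X]

theorem exists_flattening_constant (d : ℕ) {ε : ℝ} (hε : 0 < ε) :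
    -- The `12` is `3` from comparing the measures times the bound `4` on the integrand's
    -- coefficient; `3 * c` is the price of replacing the Jacobian by `‖∇ρ‖⁻¹`.
    ∃ c : ℝ≥0, 0 < c ∧ c < 1 ∧ 12 * (((1 + c : ℝ≥0) : ℝ) ^ d - 1) + 3 * c ≤ ε := by
  have hc : Continuous fun c : ℝ => 12 * ((1 + c) ^ d - 1) + 3 * c := by fun_prop
  have h0 := hc.tendsto 0
  simp only [add_zero, one_pow, sub_self, mul_zero] at h0
  have h1 := (h0.eventually (gt_mem_nhds hε)).filter_mono (nhdsWithin_le_nhds (s := Ioi 0))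
  have h2 : Ioo (0 : ℝ) 1 ∈ 𝓝[>] (0 : ℝ) := Ioo_mem_nhdsGT one_pos
  obtain ⟨c, hc1, hc2⟩ := (h1.and h2).exists
  refine ⟨⟨c, hc2.1.le⟩, hc2.1, hc2.2, ?_⟩
  exact hc1.le

theorem abs_inv_mul_sub_inv_mul_le {n : ℕ} {g ν v : E n} {a c : ℝ} (hν : ‖ν‖ = 1) (hv : ‖v‖ ≤ 1)
    (hc1 : c < 1) (ha : |a - 1| ≤ c) (hg : ‖g - ν‖ ≤ c) :
    |a * ⟪g, v⟫ - ‖g‖⁻¹ * ⟪g, v⟫| ≤ 3 * c ∧ |a * ⟪g, v⟫| ≤ 4 := by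
  have hgn : |‖g‖ - 1| ≤ c := by
    rw [← hν]; exact (abs_norm_sub_norm_le g ν).trans hg
  have hc0 : 0 ≤ c := (abs_nonneg _).trans ha
  have hg' := abs_le.1 hgn
  have ha' := abs_le.1 ha
  have hgpos : 0 < ‖g‖ := by linarith
  have hin : |⟪g, v⟫| ≤ ‖g‖ :=
    (abs_real_inner_le_norm g v).trans (mul_le_of_le_one_right (norm_nonneg _) hv)
  have e : a - ‖g‖⁻¹ = (a - 1) + (‖g‖ - 1) * ‖g‖⁻¹ := by
    field_simp
    ring
  constructor
  · rw [← sub_mul, abs_mul]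
    have h1 : |a - ‖g‖⁻¹| ≤ c + c * ‖g‖⁻¹ := by
      rw [e]
      refine (abs_add_le _ _).trans (add_le_add ha ?_)
      rw [abs_mul, abs_of_pos (inv_pos.2 hgpos)]
      gcongr
    calc |a - ‖g‖⁻¹| * |⟪g, v⟫| ≤ (c + c * ‖g‖⁻¹) * ‖g‖ := by gcongr
      _ = c * ‖g‖ + c := by field_simp
      _ ≤ 3 * c := by nlinarith
  · rw [abs_mul]
    have : |a| ≤ 2 := abs_le.2 ⟨by linarith, by linarith⟩
    calc |a| * |⟪g, v⟫| ≤ 2 * 2 := by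
          gcongr
          linarith
      _ = 4 := by norm_num

theorem mem_regularBoundary_of_gradient_ne_zero {n : ℕ} {V W : Set (E n)} {ρ : E n → ℝ}
    (hW : IsOpen W) (hρ : ContDiffOn ℝ 1 ρ W) (h1 : V ∩ W = {z ∈ W | ρ z < 0})
    (h2 : frontier V ∩ W = {z ∈ W | ρ z = 0}) {x : E n} (hx : x ∈ frontier V ∩ W)
    (h0 : gradient ρ x ≠ 0) : IsOuterUnitNormal V x (‖gradient ρ x‖⁻¹ • gradient ρ x) :=
  ⟨W, ρ, hW, hx.2, hρ, h0, h1, h2, hx.1, rfl⟩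

/-- The volume integral is exactly an integral over the flattened boundary; only passing back to the
surface measure of `frontier V`, and from the Jacobian to the unit normal, costs an error. The
neighbourhood depends on `ε` but not on `f`, and the error is proportional to `∫ ‖f‖`; both are
needed for summing over a partition of unity. -/
theorem IsOuterUnitNormal.exists_local_estimate [CompleteSpace X] {n : ℕ} {V : Set (E n)}
    (hV : IsOpen V) (hfin : μHE[n - 1] (frontier V) < ⊤) {x₀ ν₀ : E n}
    (h : IsOuterUnitNormal V x₀ ν₀)
    {ν : E n → E n} (hν : ∀ x ∈ regularBoundary V, IsOuterUnitNormal V x (ν x))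
    {v : E n} (hv : ‖v‖ ≤ 1) {ε : ℝ} (hε : 0 < ε) :
    ∃ W : Set (E n), IsOpen W ∧ x₀ ∈ W ∧ ∀ f : E n → X, ContDiff ℝ 1 f → HasCompactSupport f →
      tsupport f ⊆ W → ‖(∫ x in V, fderiv ℝ f x v) - ∫ x in frontier V, ⟪ν x, v⟫ • f x ∂μHE[n - 1]‖
        ≤ ε * ∫ x in frontier V, ‖f x‖ ∂μHE[n - 1] := by
  obtain ⟨c, hc0, hc1, hcε⟩ := exists_flattening_constant (n - 1) hε
  obtain ⟨φ, ρ, D, hx₀, hVB, hSB, hρ, hρφ, hDc, hD, hdet, hL1, hL2, hgr⟩ :=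
    h.exists_flattening hc0 hc1
  refine ⟨φ.source, φ.open_source, hx₀, fun f hf hfc hfB => ?_⟩
  have hν₀ := h.norm_eq
  have hc1' : (c : ℝ) < 1 := by exact_mod_cast hc1
  set B := φ.source with hB
  have hBo : IsOpen B := φ.open_source
  have hg0 : ∀ x ∈ B, gradient ρ x ≠ 0 := by
    intro x hx h0
    have := hgr x hx
    rw [h0, zero_sub, norm_neg, hν₀] at this
    linarith
  have hcd : ContinuousOn (fun x => fderiv ℝ ρ x v) B :=
    (hρ.continuousOn_fderiv_of_isOpen hBo le_rfl).clm_apply continuousOn_const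
  have hgc : ContinuousOn (fun x => gradient ρ x) B :=
    (InnerProductSpace.toDual ℝ (E n)).symm.continuous.comp_continuousOn
      (hρ.continuousOn_fderiv_of_isOpen hBo le_rfl)
  have hdetc : ContinuousOn (fun x => |(D x).det|⁻¹) B :=
    ((ContinuousLinearMap.continuous_det.comp_continuousOn hDc).abs).inv₀ fun x hx =>
      abs_ne_zero.2 (hdet x hx).1
  set k : E n → X := fun x => fderiv ℝ ρ x v • f x with hk
  have hkc : Continuous k := continuous_smul_of_tsupport_subset hBo hcd hf.continuous hfB
  have hks : HasCompactSupport k := hfc.smul_left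
  have hkB : tsupport k ⊆ B := (tsupport_smul_subset_right _ f).trans hfB
  set k2 : E n → X := fun x => |(D x).det|⁻¹ • k x with hk2
  have hk2c : Continuous k2 := continuous_smul_of_tsupport_subset hBo hdetc hkc hkB
  have hk2s : HasCompactSupport k2 := hks.smul_left
  -- the volume integral as an integral over the flattened boundary
  have hfv : Continuous fun x => fderiv ℝ f x v :=
    (hf.continuous_fderiv one_ne_zero).clm_apply continuous_const
  have lim1 := tendsto_integral_smoothTransition_smul hV.measurableSet hBo hρ.continuousOn hVB hfv
    (hfc.fderiv_apply ℝ v) ((tsupport_fderiv_apply_subset ℝ v).trans hfB)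
  have lim2 := tendsto_integral_levelSet φ hν₀ hρφ hDc hD (fun x hx => (hdet x hx).1) hkc hks hkB
  have e1 := tendsto_nhds_unique lim1 (lim2.congr fun δ =>
    (integral_smoothTransition_smul_fderiv hBo hρ hf hfc hfB v δ).symm)
  -- comparison of the two surface measures
  have hT1 : MeasurableSet (frontier V) := isClosed_frontier.measurableSet
  have hT2 : MeasurableSet {u : E n | ⟪ν₀, u⟫ = 0} :=
    (isClosed_eq (by fun_prop) continuous_const).measurableSet
  have hiff : ∀ x ∈ φ.source, x ∈ frontier V ↔ φ x ∈ {u : E n | ⟪ν₀, u⟫ = 0} := by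
    intro x hx
    have : x ∈ frontier V ∩ φ.source ↔ x ∈ {z ∈ φ.source | ρ z = 0} := by rw [hSB]
    simpa [hx, hρφ x hx] using this
  obtain ⟨hae, hle1, hle2⟩ := map_symm_hausdorff_comparison (d := n - 1) φ hL1 hL2 hT1 hT2 hiff
  set μ₁ := (μHE[n - 1] : Measure (E n)).restrict (frontier V ∩ φ.source) with hμ₁
  set μ₂ := ((μHE[n - 1] : Measure (E n)).restrict ({u | ⟪ν₀, u⟫ = 0} ∩ φ.target)).map φ.symm with hμ₂
  have hf1 : IsFiniteMeasure μ₁ := ⟨by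
    rw [hμ₁, restrict_apply_univ]
    exact (measure_mono inter_subset_left).trans_lt hfin⟩
  have hf2 : IsFiniteMeasure μ₂ := ⟨by
    refine (hle1 univ).trans_lt ?_
    rw [Measure.smul_apply, ENNReal.smul_def, smul_eq_mul]
    exact ENNReal.mul_lt_top ENNReal.coe_lt_top (measure_lt_top _ _)⟩
  have hint : ∀ {Y : Type _} [NormedAddCommGroup Y] {g : E n → Y}, Continuous g →
      HasCompactSupport g → Integrable g μ₁ := fun hg hgs => hg.integrable_of_hasCompactSupport hgs
  have e2 : ∫ u in {u : E n | ⟪ν₀, u⟫ = 0} ∩ φ.target,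
      |(D (φ.symm u)).det|⁻¹ • k (φ.symm u) ∂μHE[n - 1] = ∫ x, k2 x ∂μ₂ := by
    rw [hμ₂, integral_map hae hk2c.aestronglyMeasurable]
  have hcmp := norm_integral_sub_integral_le (μ := μ₁) (μ' := μ₂) (K := (1 + c) ^ (n - 1))
    (one_le_pow₀ (by simp)) hle1 hle2 (hint hk2c hk2s)
  -- the normal
  have hνx : ∀ x ∈ frontier V ∩ B, ⟪ν x, v⟫ = ‖gradient ρ x‖⁻¹ * ⟪gradient ρ x, v⟫ := by
    intro x hx
    have h1 := mem_regularBoundary_of_gradient_ne_zero hBo hρ hVB hSB hx (hg0 x hx.2)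
    rw [(hν x ⟨_, h1⟩).unique h1, real_inner_smul_left]
  set q : E n → X := fun x => (‖gradient ρ x‖⁻¹ * ⟪gradient ρ x, v⟫) • f x with hq
  have hqc : Continuous q := by
    refine continuous_smul_of_tsupport_subset hBo ?_ hf.continuous hfB
    exact (hgc.norm.inv₀ fun x hx => norm_ne_zero_iff.2 (hg0 x hx)).mul
      (hgc.inner continuousOn_const)
  have hqs : HasCompactSupport q := hfc.smul_left
  have hzero : ∀ x ∈ frontier V \ (frontier V ∩ B), f x = 0 := fun x hx =>
    image_eq_zero_of_notMem_tsupport fun h => hx.2 ⟨hx.1, hfB h⟩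
  have hmem : ∀ᵐ x ∂μ₁, x ∈ frontier V ∩ B :=
    ae_restrict_mem (hT1.inter φ.open_source.measurableSet)
  have e3 : ∫ x in frontier V, ⟪ν x, v⟫ • f x ∂μHE[n - 1] = ∫ x, q x ∂μ₁ := by
    rw [setIntegral_eq_of_subset_of_forall_sdiff_eq_zero (s := frontier V ∩ B)
      (f := fun x => ⟪ν x, v⟫ • f x) hT1 inter_subset_left
      fun x hx => by simp only [hzero x hx, smul_zero]]
    refine integral_congr_ae ?_
    filter_upwards [hmem] with x hx
    rw [hq, hνx x hx]
  have e4 : ∫ x in frontier V, ‖f x‖ ∂μHE[n - 1] = ∫ x, ‖f x‖ ∂μ₁ :=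
    (setIntegral_eq_of_subset_of_forall_sdiff_eq_zero (s := frontier V ∩ B)
      (f := fun x => ‖f x‖) hT1 inter_subset_left
      fun x hx => by simp only [hzero x hx, norm_zero])
  have hcoef := fun x (hx : x ∈ B) =>
    abs_inv_mul_sub_inv_mul_le hν₀ hv hc1' (hdet x hx).2 (hgr x hx)
  have hfn : Integrable (fun x => ‖f x‖) μ₁ := (hint hf.continuous hfc).norm
  have b1 : ∫ x, ‖k2 x‖ ∂μ₁ ≤ 4 * ∫ x, ‖f x‖ ∂μ₁ := by
    rw [← integral_const_mul]
    refine integral_mono_ae (hint hk2c hk2s).norm (hfn.const_mul 4) ?_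
    filter_upwards [hmem] with x hx
    rw [hk2, hk]
    simp only [smul_smul, norm_smul, ← inner_gradient]
    rw [Real.norm_eq_abs]
    gcongr
    exact (hcoef x hx.2).2
  have b2 : ‖∫ x, k2 x ∂μ₁ - ∫ x, q x ∂μ₁‖ ≤ 3 * c * ∫ x, ‖f x‖ ∂μ₁ := by
    rw [← integral_sub (hint hk2c hk2s) (hint hqc hqs), ← integral_const_mul]
    refine norm_integral_le_of_norm_le (hfn.const_mul _) ?_
    filter_upwards [hmem] with x hx
    simp only [hk2, hk, hq, smul_smul, ← sub_smul, norm_smul, ← inner_gradient]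
    rw [Real.norm_eq_abs]
    gcongr
    exact (hcoef x hx.2).1
  rw [e1, e2, e3, e4]
  have hA : 0 ≤ ∫ x, ‖f x‖ ∂μ₁ := integral_nonneg fun x => norm_nonneg _
  have hK : (1 : ℝ) ≤ (((1 + c) ^ (n - 1) : ℝ≥0) : ℝ) :=
    NNReal.one_le_coe.2 (one_le_pow₀ (by simp))
  have htri : ‖∫ x, k2 x ∂μ₂ - ∫ x, q x ∂μ₁‖ ≤
      ‖∫ x, k2 x ∂μ₂ - ∫ x, k2 x ∂μ₁‖ + ‖∫ x, k2 x ∂μ₁ - ∫ x, q x ∂μ₁‖ :=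
    norm_sub_le_norm_sub_add_norm_sub _ _ _
  have hcε' : 12 * ((((1 + c) ^ (n - 1) : ℝ≥0) : ℝ) - 1) + 3 * c ≤ ε := by
    rw [NNReal.coe_pow]; exact hcε
  calc _ ≤ _ := htri
    _ ≤ 3 * ((((1 + c) ^ (n - 1) : ℝ≥0) : ℝ) - 1) * (4 * ∫ x, ‖f x‖ ∂μ₁)
        + 3 * c * ∫ x, ‖f x‖ ∂μ₁ := by
      refine add_le_add (hcmp.trans ?_) b2
      gcongr
    _ = (12 * ((((1 + c) ^ (n - 1) : ℝ≥0) : ℝ) - 1) + 3 * c) * ∫ x, ‖f x‖ ∂μ₁ := by ring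
    _ ≤ _ := by gcongr

end HyperbolicClifford

/-! ### The regular boundary, and Gauss-Green away from the singular set -/

namespace HyperbolicClifford

open Filter Topology Measure Module
open scoped NNReal Manifold ContDiff

variable {X : Type*} [NormedAddCommGroup X] [NormedSpace ℝ X]

theorem IsOuterUnitNormal.exists_nhds {n : ℕ} {V : Set (E n)} {x₀ ν₀ : E n}
    (h : IsOuterUnitNormal V x₀ ν₀) :
    ∃ (W : Set (E n)) (N : E n → E n), IsOpen W ∧ x₀ ∈ W ∧ ContinuousOn N W ∧
      ∀ x ∈ W ∩ frontier V, IsOuterUnitNormal V x (N x) := by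
  obtain ⟨W, ρ, hW, hx, hρ, h0, h1, h2, h3⟩ := h.exists_normalized
  have hgc : ContinuousOn (fun x => gradient ρ x) W :=
    (InnerProductSpace.toDual ℝ (E n)).symm.continuous.comp_continuousOn
      (hρ.continuousOn_fderiv_of_isOpen hW le_rfl)
  have hν := h.norm_eq
  refine ⟨W ∩ (fun x => gradient ρ x) ⁻¹' {0}ᶜ, fun x => ‖gradient ρ x‖⁻¹ • gradient ρ x,
    hgc.isOpen_inter_preimage hW isOpen_compl_singleton, ⟨hx, ?_⟩, ?_, ?_⟩
  · intro h'
    have h' : gradient ρ x₀ = 0 := h'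
    rw [← h0, h'] at hν
    simp at hν
  · have hg' := hgc.mono (inter_subset_left (t := (fun x => gradient ρ x) ⁻¹' {0}ᶜ))
    exact (hg'.norm.inv₀ fun x hx => norm_ne_zero_iff.2 hx.2).smul hg'
  · intro x hx
    exact mem_regularBoundary_of_gradient_ne_zero hW hρ h1 h2 ⟨hx.2, hx.1.1⟩ hx.1.2

theorem regularBoundary_subset_frontier {n : ℕ} {V : Set (E n)} : regularBoundary V ⊆ frontier V :=
  fun _ ⟨_, h⟩ => h.exists_normalized.choose_spec.choose_spec.2.2.2.2.2.2

/-- A defining function at a regular point has nonzero gradient nearby, so regularity is a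
relatively open condition. Closedness makes the singular set compact, as the finite covers below
require. -/
theorem isClosed_frontier_diff_regularBoundary {n : ℕ} {V : Set (E n)} :
    IsClosed (frontier V \ regularBoundary V) := by
  have : (frontier V \ regularBoundary V)ᶜ = (frontier V)ᶜ ∪
      ⋃ (x : regularBoundary V), x.2.choose_spec.exists_nhds.choose := by
    ext z
    simp only [mem_compl_iff, Set.mem_sdiff, not_and, not_not, mem_union, mem_iUnion]
    constructor
    · intro hz
      by_cases hzf : z ∈ frontier V
      · right
        exact ⟨⟨z, hz hzf⟩, (hz hzf).choose_spec.exists_nhds.choose_spec.choose_spec.2.1⟩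
      · exact Or.inl hzf
    · rintro (hz | ⟨x, hx⟩) hzf
      · exact absurd hzf hz
      · exact ⟨_, x.2.choose_spec.exists_nhds.choose_spec.choose_spec.2.2.2 z ⟨hx, hzf⟩⟩
  rw [← isOpen_compl_iff, this]
  exact isClosed_frontier.isOpen_compl.union
    (isOpen_iUnion fun x => x.2.choose_spec.exists_nhds.choose_spec.choose_spec.1)

theorem measurableSet_regularBoundary {n : ℕ} {V : Set (E n)} :
    MeasurableSet (regularBoundary V) := by
  have : regularBoundary V = frontier V \ (frontier V \ regularBoundary V) := by
    rw [sdiff_sdiff_right_self, inter_eq_right.2 regularBoundary_subset_frontier]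
  rw [this]
  exact isClosed_frontier.measurableSet.diff isClosed_frontier_diff_regularBoundary.measurableSet

theorem continuousOn_outerUnitNormal {n : ℕ} {V : Set (E n)} {ν : E n → E n}
    (hν : ∀ x ∈ regularBoundary V, IsOuterUnitNormal V x (ν x)) :
    ContinuousOn ν (regularBoundary V) := by
  intro x hx
  obtain ⟨W, N, hW, hxW, hN, hW2⟩ := (hν x hx).exists_nhds
  have h1 : ContinuousWithinAt N (regularBoundary V) x :=
    (hN.continuousAt (hW.mem_nhds hxW)).continuousWithinAt
  refine h1.congr_of_eventuallyEq ?_ ?_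
  · filter_upwards [self_mem_nhdsWithin, mem_nhdsWithin_of_mem_nhds (hW.mem_nhds hxW)] with z hz hzW
    exact (hν z hz).unique (hW2 z ⟨hzW, regularBoundary_subset_frontier hz⟩)
  · exact (hν x hx).unique (hW2 x ⟨hxW, regularBoundary_subset_frontier hx⟩)

theorem ae_mem_regularBoundary {n : ℕ} {V : Set (E n)} (hS : IsPiecewiseC1Boundary (frontier V) V) :
    ∀ᵐ x ∂(μHE[n - 1] : Measure (E n)).restrict (frontier V), x ∈ regularBoundary V := by
  rw [ae_restrict_iff' isClosed_frontier.measurableSet, ae_iff]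
  convert! hS.singular_null using 2
  ext x
  simp

theorem aestronglyMeasurable_outerUnitNormal {n : ℕ} {V : Set (E n)}
    (hS : IsPiecewiseC1Boundary (frontier V) V) {ν : E n → E n}
    (hν : ∀ x ∈ regularBoundary V, IsOuterUnitNormal V x (ν x)) :
    AEStronglyMeasurable ν ((μHE[n - 1] : Measure (E n)).restrict (frontier V)) := by
  have h1 := (continuousOn_outerUnitNormal hν).aestronglyMeasurable (μ := μHE[n - 1])
    measurableSet_regularBoundary
  have h2 : (μHE[n - 1] : Measure (E n)).restrict (frontier V) =
      (μHE[n - 1] : Measure (E n)).restrict (regularBoundary V) := by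
    refine restrict_congr_set ?_
    refine EventuallyLE.antisymm ?_ (Eventually.of_forall regularBoundary_subset_frontier)
    exact ae_le_set.2 hS.singular_null
  rwa [h2]

theorem integrableOn_inner_outerUnitNormal_smul {n : ℕ} {V : Set (E n)}
    (hS : IsPiecewiseC1Boundary (frontier V) V) {ν : E n → E n}
    (hν : ∀ x ∈ regularBoundary V, IsOuterUnitNormal V x (ν x)) (v : E n) {f : E n → X}
    (hf : ContinuousOn f (frontier V)) :
    IntegrableOn (fun x => ⟪ν x, v⟫ • f x) (frontier V) μHE[n - 1] := by
  have hfin : IsFiniteMeasure ((μHE[n - 1] : Measure (E n)).restrict (frontier V)) :=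
    ⟨by rw [restrict_apply_univ]; exact hS.area_lt_top⟩
  obtain ⟨C, hC⟩ := hS.isCompact.exists_bound_of_continuousOn hf
  refine Integrable.of_bound (C := ‖v‖ * C) ?_ ?_
  · have h1 := (aestronglyMeasurable_outerUnitNormal hS hν).inner
      (aestronglyMeasurable_const (b := v)) (𝕜 := ℝ)
    exact h1.smul (hf.aestronglyMeasurable_of_isCompact hS.isCompact hS.isCompact.measurableSet)
  · filter_upwards [ae_mem_regularBoundary hS,
      ae_restrict_mem isClosed_frontier.measurableSet] with x hx hxf
    rw [norm_smul]
    gcongr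
    · have := norm_inner_le_norm (𝕜 := ℝ) (ν x) v
      rwa [(hν x hx).norm_eq, one_mul] at this
    · exact hC x hxf

theorem integral_fderiv_apply_eq_zero [CompleteSpace X] {n : ℕ} {f : E n → X} (hf : ContDiff ℝ 1 f)
    (hfc : HasCompactSupport f) (v : E n) : ∫ x, fderiv ℝ f x v = 0 := by
  have hfv : Continuous fun x => fderiv ℝ f x v :=
    (hf.continuous_fderiv one_ne_zero).clm_apply continuous_const
  have := integral_smul_fderiv_eq_neg_fderiv_smul_of_integrable (μ := volume)
    (f := fun _ : E n => (1 : ℝ)) (g := f) (v := v) (by simp)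
    (by simpa using hfv.integrable_of_hasCompactSupport (hfc.fderiv_apply ℝ v))
    (by simpa using hf.continuous.integrable_of_hasCompactSupport hfc)
    (fun x _ => differentiableAt_const _) (fun x _ => hf.differentiable one_ne_zero x)
  simpa using this

/-- Off the boundary both integrals vanish for `f` supported near `x₀`: inside `V` because a
compactly supported derivative integrates to zero, outside `closure V` trivially. -/
theorem exists_nhds_gaussGreen_estimate [CompleteSpace X] {n : ℕ} {V : Set (E n)} (hV : IsOpen V)
    (hS : IsPiecewiseC1Boundary (frontier V) V) {ν : E n → E n}
    (hν : ∀ x ∈ regularBoundary V, IsOuterUnitNormal V x (ν x))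
    {v : E n} (hv : ‖v‖ ≤ 1) {ε : ℝ} (hε : 0 < ε) {x₀ : E n}
    (hx₀ : x₀ ∈ frontier V → x₀ ∈ regularBoundary V) :
    ∃ W : Set (E n), IsOpen W ∧ x₀ ∈ W ∧ ∀ f : E n → X, ContDiff ℝ 1 f → HasCompactSupport f →
      tsupport f ⊆ W → ‖(∫ x in V, fderiv ℝ f x v) - ∫ x in frontier V, ⟪ν x, v⟫ • f x ∂μHE[n - 1]‖
        ≤ ε * ∫ x in frontier V, ‖f x‖ ∂μHE[n - 1] := by
  by_cases hfr : x₀ ∈ frontier V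
  · exact (hν x₀ (hx₀ hfr)).exists_local_estimate hV hS.area_lt_top hν hv hε
  have hfrz : ∀ f : E n → X, (∀ x ∈ frontier V, f x = 0) →
      ∫ x in frontier V, ⟪ν x, v⟫ • f x ∂μHE[n - 1] = 0 := by
    intro f hf
    rw [setIntegral_congr_fun (g := fun _ => 0) isClosed_frontier.measurableSet]
    · simp
    · intro x hx
      simp [hf x hx]
  have hpos : ∀ f : E n → X, 0 ≤ ε * ∫ x in frontier V, ‖f x‖ ∂μHE[n - 1] := fun f =>
    mul_nonneg hε.le (integral_nonneg fun x => norm_nonneg _)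
  by_cases hxV : x₀ ∈ V
  · refine ⟨V, hV, hxV, fun f hf hfc hfW => ?_⟩
    rw [hfrz f, setIntegral_eq_integral_of_forall_compl_eq_zero,
      integral_fderiv_apply_eq_zero hf hfc, sub_zero, norm_zero]
    · exact hpos f
    · intro x hx
      have : x ∉ tsupport (fun x => fderiv ℝ f x v) := fun h =>
        hx (hfW (tsupport_fderiv_apply_subset ℝ v h))
      exact image_eq_zero_of_notMem_tsupport (f := fun x => fderiv ℝ f x v) this
    · intro x hx
      rw [hV.frontier_eq] at hx
      exact image_eq_zero_of_notMem_tsupport fun h => hx.2 (hfW h)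
  · have hxc : x₀ ∉ closure V := fun h => hfr (by rw [hV.frontier_eq]; exact ⟨h, hxV⟩)
    refine ⟨(closure V)ᶜ, isClosed_closure.isOpen_compl, hxc, fun f hf hfc hfW => ?_⟩
    rw [hfrz f, setIntegral_congr_fun (g := fun _ => 0) hV.measurableSet]
    · simpa using hpos f
    · intro x hx
      have : x ∉ tsupport (fun x => fderiv ℝ f x v) := fun h =>
        hfW (tsupport_fderiv_apply_subset ℝ v h) (subset_closure hx)
      exact image_eq_zero_of_notMem_tsupport (f := fun x => fderiv ℝ f x v) this
    · intro x hx
      exact image_eq_zero_of_notMem_tsupport fun h => hfW h (frontier_subset_closure hx)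

theorem gaussGreen_of_tsupport_inter_frontier_subset [CompleteSpace X] {n : ℕ} {V : Set (E n)}
    (hV : IsOpen V) (hS : IsPiecewiseC1Boundary (frontier V) V) {ν : E n → E n}
    (hν : ∀ x ∈ regularBoundary V, IsOuterUnitNormal V x (ν x))
    {v : E n} (hv : ‖v‖ ≤ 1) {f : E n → X} (hf : ContDiff ℝ 1 f) (hfc : HasCompactSupport f)
    (hfs : tsupport f ∩ frontier V ⊆ regularBoundary V) :
    ∫ x in V, fderiv ℝ f x v = ∫ x in frontier V, ⟪ν x, v⟫ • f x ∂μHE[n - 1] := by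
  have hfin : IsFiniteMeasure ((μHE[n - 1] : Measure (E n)).restrict (frontier V)) :=
    ⟨by rw [restrict_apply_univ]; exact hS.area_lt_top⟩
  suffices H : ∀ ε > 0, ‖(∫ x in V, fderiv ℝ f x v) -
      ∫ x in frontier V, ⟪ν x, v⟫ • f x ∂μHE[n - 1]‖ ≤
        ε * ∫ x in frontier V, ‖f x‖ ∂μHE[n - 1] by
    have hlim : Tendsto (fun ε : ℝ => ε * ∫ x in frontier V, ‖f x‖ ∂μHE[n - 1]) (𝓝[>] 0) (𝓝 0) := by
      have : Continuous fun ε : ℝ => ε * ∫ x in frontier V, ‖f x‖ ∂μHE[n - 1] := by fun_prop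
      simpa using (this.tendsto 0).mono_left (nhdsWithin_le_nhds (s := Ioi 0))
    have := ge_of_tendsto hlim (by filter_upwards [self_mem_nhdsWithin] with ε hε using H ε hε)
    exact sub_eq_zero.1 (norm_le_zero_iff.1 this)
  intro ε hε
  have hx : ∀ x : tsupport f, ∃ W : Set (E n), IsOpen W ∧ (x : E n) ∈ W ∧ ∀ f : E n → X,
      ContDiff ℝ 1 f → HasCompactSupport f →
      tsupport f ⊆ W → ‖(∫ x in V, fderiv ℝ f x v) - ∫ x in frontier V, ⟪ν x, v⟫ • f x ∂μHE[n - 1]‖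
        ≤ ε * ∫ x in frontier V, ‖f x‖ ∂μHE[n - 1] := fun x =>
    exists_nhds_gaussGreen_estimate hV hS hν hv hε fun h => hfs ⟨x.2, h⟩
  choose W hWo hxW hW using hx
  obtain ⟨t, ht⟩ := hfc.isCompact.elim_finite_subcover W hWo
    (fun x hx => mem_iUnion.2 ⟨⟨x, hx⟩, hxW ⟨x, hx⟩⟩)
  obtain ⟨ψ, hψ⟩ := SmoothPartitionOfUnity.exists_isSubordinate 𝓘(ℝ, E n)
    (isClosed_tsupport f) (fun i : t => W i) (fun i => hWo i) (by
      intro x hx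
      obtain ⟨i, hi, hxi⟩ := mem_iUnion₂.1 (ht hx)
      exact mem_iUnion.2 ⟨⟨i, hi⟩, hxi⟩)
  set F : t → E n → X := fun i x => ψ i x • f x with hF
  have hFd : ∀ i, ContDiff ℝ 1 (F i) := fun i =>
    (((ψ i).contMDiff.contDiff).of_le (by simp)).smul hf
  have hFc : ∀ i, HasCompactSupport (F i) := fun i => hfc.smul_left
  have hFW : ∀ i, tsupport (F i) ⊆ W i := fun i =>
    (tsupport_smul_subset_left (ψ i) f).trans (hψ i)
  have hsum : ∀ x, ∑ i, F i x = f x := by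
    intro x
    by_cases hx : x ∈ tsupport f
    · rw [hF, ← Finset.sum_smul, ← finsum_eq_sum_of_fintype, ψ.sum_eq_one hx, one_smul]
    · simp [hF, image_eq_zero_of_notMem_tsupport hx]
  -- Nonnegativity of the partition makes the local errors sum to `ε ∫ ‖f‖`, whatever the number of
  -- pieces, which itself depends on `ε`.
  have hnsum : ∀ x, ∑ i, ‖F i x‖ = ‖f x‖ := by
    intro x
    by_cases hx : x ∈ tsupport f
    · simp only [hF, norm_smul, Real.norm_of_nonneg (ψ.nonneg _ x)]
      rw [← Finset.sum_mul, ← finsum_eq_sum_of_fintype, ψ.sum_eq_one hx, one_mul]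
    · simp [hF, image_eq_zero_of_notMem_tsupport hx]
  have hfF : f = fun x => ∑ i, F i x := funext fun x => (hsum x).symm
  have hcv : ∀ i, Continuous fun x => fderiv ℝ (F i) x v := fun i =>
    ((hFd i).continuous_fderiv one_ne_zero).clm_apply continuous_const
  have e1 : ∫ x in V, fderiv ℝ f x v = ∑ i, ∫ x in V, fderiv ℝ (F i) x v := by
    rw [← integral_finsetSum]
    · congr 1; funext x
      conv_lhs => rw [hfF]
      rw [fderiv_fun_sum fun i _ => (hFd i).differentiable one_ne_zero x,
        _root_.sum_apply]
    · intro i _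
      exact ((hcv i).integrable_of_hasCompactSupport ((hFc i).fderiv_apply ℝ v)).integrableOn
  have e2 : ∫ x in frontier V, ⟪ν x, v⟫ • f x ∂μHE[n - 1] =
      ∑ i, ∫ x in frontier V, ⟪ν x, v⟫ • F i x ∂μHE[n - 1] := by
    rw [← integral_finsetSum]
    · congr 1; funext x
      rw [← Finset.smul_sum, hsum]
    · intro i _
      exact integrableOn_inner_outerUnitNormal_smul hS hν v (hFd i).continuous.continuousOn
  have e3 : ∫ x in frontier V, ‖f x‖ ∂μHE[n - 1] =
      ∑ i, ∫ x in frontier V, ‖F i x‖ ∂μHE[n - 1] := by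
    rw [← integral_finsetSum]
    · simp only [hnsum]
    · intro i _
      exact ((hFd i).continuous.integrable_of_hasCompactSupport (hFc i)).norm
  rw [e1, e2, e3, ← Finset.sum_sub_distrib, Finset.mul_sum]
  exact (norm_sum_le _ _).trans (Finset.sum_le_sum fun i _ => hW i _ (hFd i) (hFc i) (hFW i))

end HyperbolicClifford

/-! ### Cutoffs around compact sets of zero surface measure -/

namespace HyperbolicClifford

open Filter Topology Measure Module
open scoped NNReal ENNReal Manifold ContDiff

variable {X : Type*} [NormedAddCommGroup X] [NormedSpace ℝ X]

theorem euclideanHausdorffMeasure_eq_zero_iff {α : Type*} [MetricSpace α] [MeasurableSpace α]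
    [BorelSpace α] {d : ℕ} {s : Set α} :
    (μHE[d] : Measure α) s = 0 ↔ (μH[d] : Measure α) s = 0 := by
  rw [euclideanHausdorffMeasure_def, Measure.smul_apply, ENNReal.smul_def, smul_eq_mul,
    mul_eq_zero, ENNReal.coe_eq_zero]
  exact or_iff_right (addHaarScalarFactor_volume_hausdorffMeasure_ne_zero d)

theorem exists_radius_gt {d : ℕ} {a : ℝ≥0∞} {b ε : ℝ} (hb : a ≤ ENNReal.ofReal b) (hε : 0 < ε)
    (hb0 : 0 ≤ b) :
    ∃ r : ℝ, 0 < r ∧ a < ENNReal.ofReal r ∧ r < b + ε ∧ r ^ d ≤ (a ^ d).toReal + ε := by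
  have hafin : a ≠ ⊤ := (hb.trans_lt ENNReal.ofReal_lt_top).ne
  lift a to ℝ≥0 using hafin
  have hab : (a : ℝ) ≤ b := by
    rw [← ENNReal.ofReal_coe_nnreal, ENNReal.ofReal_le_ofReal_iff hb0] at hb
    exact hb
  have hc : Continuous fun r : ℝ => r ^ d := by fun_prop
  have h1 : ∀ᶠ r in 𝓝[>] (a : ℝ), r ^ d < (a : ℝ) ^ d + ε :=
    ((hc.tendsto (a : ℝ)).mono_left nhdsWithin_le_nhds).eventually
      (gt_mem_nhds (lt_add_of_pos_right _ hε))
  have h2 : Ioo (a : ℝ) (b + ε) ∈ 𝓝[>] (a : ℝ) := Ioo_mem_nhdsGT (by linarith)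
  obtain ⟨r, hr1, hr2⟩ := (h1.and h2).exists
  have hr0 : 0 < r := a.2.trans_lt hr2.1
  refine ⟨r, hr0, ?_, hr2.2, ?_⟩
  · rw [← ENNReal.ofReal_coe_nnreal]
    exact (ENNReal.ofReal_lt_ofReal_iff hr0).2 hr2.1
  · rw [← ENNReal.coe_pow, ENNReal.coe_toReal, NNReal.coe_pow]
    exact hr1.le

/-- Each set of an efficient Hausdorff cover that meets `Z` is replaced by an open ball centred at
one of its points of `Z`, with radius just above its diameter. The slacks `ε' i` sum to less than
`ε/2`; compactness leaves finitely many balls. -/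
theorem exists_finite_cover_balls {n d : ℕ} {Z : Set (E n)} (hZ : IsCompact Z)
    (h0 : (μHE[d] : Measure (E n)) Z = 0) {ε : ℝ} (hε : 0 < ε) :
    ∃ (ι : Type) (t : Finset ι) (z : ι → E n) (r : ι → ℝ), (∀ i, z i ∈ Z) ∧ (∀ i, 0 < r i) ∧
      (∀ i, r i < ε) ∧ Z ⊆ ⋃ i ∈ t, Metric.ball (z i) (r i) ∧ ∑ i ∈ t, r i ^ d ≤ ε := by
  rw [euclideanHausdorffMeasure_eq_zero_iff, hausdorffMeasure_apply] at h0
  have hε2 : 0 < ε / 2 := half_pos hε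
  have h1 : (⨅ (t : ℕ → Set (E n)) (_ : Z ⊆ ⋃ n, t n)
      (_ : ∀ n, Metric.ediam (t n) ≤ ENNReal.ofReal (ε / 2)),
      ∑' n, ⨆ _ : (t n).Nonempty, Metric.ediam (t n) ^ (d : ℝ)) < ENNReal.ofReal (ε / 2) := by
    refine lt_of_le_of_lt ?_ (ENNReal.ofReal_pos.2 hε2)
    rw [← h0]
    exact le_iSup₂_of_le (ENNReal.ofReal (ε / 2)) (ENNReal.ofReal_pos.2 hε2) le_rfl
  simp only [iInf_lt_iff] at h1
  obtain ⟨t, htZ, htd, hts⟩ := h1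
  obtain ⟨ε', hε'0, hε's⟩ := ENNReal.exists_pos_sum_of_countable
    (ENNReal.ofReal_pos.2 hε2).ne' ℕ
  have hrad : ∀ i, ∃ r : ℝ, 0 < r ∧ Metric.ediam (t i) < ENNReal.ofReal r ∧
      r < ε ∧ r ^ d ≤ (Metric.ediam (t i) ^ d).toReal + ε' i := by
    intro i
    obtain ⟨r, hr1, hr2, hr3, hr4⟩ := exists_radius_gt (d := d) (htd i)
      (lt_min hε2 (show (0 : ℝ) < ε' i from hε'0 i)) hε2.le
    exact ⟨r, hr1, hr2, hr3.trans_le (by linarith [min_le_left (ε / 2) (ε' i : ℝ)]),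
      hr4.trans (by gcongr; exact min_le_right _ _)⟩
  choose r hr1 hr2 hr3 hr4 using hrad
  have hz : ∀ i : {i // (t i ∩ Z).Nonempty}, ∃ z, z ∈ t i ∩ Z := fun i => i.2
  choose z hz using hz
  have hcov : Z ⊆ ⋃ i : {i // (t i ∩ Z).Nonempty}, Metric.ball (z i) (r i) := by
    intro x hx
    obtain ⟨i, hi⟩ := mem_iUnion.1 (htZ hx)
    refine mem_iUnion.2 ⟨⟨i, x, hi, hx⟩, ?_⟩
    rw [Metric.mem_ball, ← ENNReal.ofReal_lt_ofReal_iff (hr1 i), ← edist_dist]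
    exact (Metric.edist_le_ediam_of_mem hi (hz ⟨i, x, hi, hx⟩).1).trans_lt (hr2 i)
  obtain ⟨s, hs⟩ := hZ.elim_finite_subcover (fun i : {i // (t i ∩ Z).Nonempty} =>
    Metric.ball (z i) (r i)) (fun i => Metric.isOpen_ball) hcov
  refine ⟨_, s, z, fun i => r i, fun i => (hz i).2, fun i => hr1 i, fun i => hr3 i, hs, ?_⟩
  have hterm : ∀ i : {i // (t i ∩ Z).Nonempty},
      (⨆ _ : (t i).Nonempty, Metric.ediam (t i) ^ (d : ℝ)) = Metric.ediam (t i) ^ d := by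
    intro i
    have : (t i).Nonempty := i.2.mono inter_subset_left
    simp [this]
  have hsum1 : ∑ i ∈ s, Metric.ediam (t i) ^ d ≤ ENNReal.ofReal (ε / 2) := by
    refine le_trans ?_ hts.le
    rw [← Finset.sum_congr rfl fun i _ => hterm i]
    refine (ENNReal.sum_le_tsum s).trans ?_
    exact ENNReal.tsum_comp_le_tsum_of_injective Subtype.val_injective _
  have hsum2 : ∑ i ∈ s, (ε' i : ℝ≥0∞) ≤ ENNReal.ofReal (ε / 2) := by
    refine le_trans ((ENNReal.sum_le_tsum s).trans ?_) hε's.le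
    exact ENNReal.tsum_comp_le_tsum_of_injective Subtype.val_injective (fun i => (ε' i : ℝ≥0∞))
  have hfin : ∀ i ∈ s, Metric.ediam (t i) ^ d ≠ ⊤ := fun i _ =>
    ENNReal.pow_ne_top ((htd i).trans_lt ENNReal.ofReal_lt_top).ne
  have r1 : ∑ i ∈ s, (Metric.ediam (t i) ^ d).toReal ≤ ε / 2 := by
    rw [← ENNReal.toReal_sum hfin]
    exact ENNReal.toReal_le_of_le_ofReal hε2.le hsum1
  have r2 : ∑ i ∈ s, (ε' i : ℝ) ≤ ε / 2 := by
    have := ENNReal.toReal_le_of_le_ofReal hε2.le hsum2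
    rw [ENNReal.toReal_sum fun i _ => ENNReal.coe_ne_top] at this
    simpa using this
  calc ∑ i ∈ s, r i ^ d ≤ ∑ i ∈ s, ((Metric.ediam (t i) ^ d).toReal + ε' i) :=
        Finset.sum_le_sum fun i _ => hr4 i
    _ ≤ ε := by rw [Finset.sum_add_distrib]; linarith

theorem norm_fderiv_finset_prod_le {F ι : Type*} [NormedAddCommGroup F] [NormedSpace ℝ F]
    (s : Finset ι) {g : ι → F → ℝ} (hg : ∀ i, ContDiff ℝ ∞ (g i)) (h0 : ∀ i x, 0 ≤ g i x)
    (h1 : ∀ i x, g i x ≤ 1) (x : F) :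
    ‖fderiv ℝ (fun x => ∏ i ∈ s, g i x) x‖ ≤ ∑ i ∈ s, ‖fderiv ℝ (g i) x‖ := by
  classical
  induction s using Finset.induction_on with
  | empty => simp
  | insert a s ha ih =>
    have hd : DifferentiableAt ℝ (fun x => ∏ i ∈ s, g i x) x :=
      (contDiff_prod fun i _ => hg i).differentiable (by simp) x
    simp only [Finset.prod_insert ha, Finset.sum_insert ha]
    rw [fderiv_fun_mul ((hg a).differentiable (by simp) x) hd]
    have hp0 : 0 ≤ ∏ i ∈ s, g i x := Finset.prod_nonneg fun i _ => h0 i x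
    have hp1 : ∏ i ∈ s, g i x ≤ 1 := Finset.prod_le_one (fun i _ => h0 i x) fun i _ => h1 i x
    refine (norm_add_le _ _).trans ?_
    rw [norm_smul, norm_smul, Real.norm_of_nonneg (h0 a x), Real.norm_of_nonneg hp0, add_comm]
    exact add_le_add (mul_le_of_le_one_left (norm_nonneg _) hp1)
      ((mul_le_of_le_one_left (norm_nonneg _) (h1 a x)).trans ih)

/-- A smooth radial bump on `ℝⁿ`, equal to `1` on the unit ball and `0` outside the ball of
radius `2`. -/
noncomputable def unitBump (n : ℕ) (x : E n) : ℝ := Real.smoothTransition (2 - ‖x‖ ^ 2)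

theorem contDiff_unitBump (n : ℕ) : ContDiff ℝ ∞ (unitBump n) :=
  Real.smoothTransition.contDiff.comp (contDiff_const.sub (contDiff_norm_sq ℝ))

theorem unitBump_eq_one {n : ℕ} {x : E n} (hx : ‖x‖ ≤ 1) : unitBump n x = 1 :=
  Real.smoothTransition.one_of_one_le (by nlinarith [norm_nonneg x])

theorem unitBump_eq_zero {n : ℕ} {x : E n} (hx : 2 ≤ ‖x‖) : unitBump n x = 0 :=
  Real.smoothTransition.zero_of_nonpos (by nlinarith)

/-- The gradient scales like `r⁻¹` and volume like `r^n`. The resulting exponent `n - 1` is what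
makes sets of zero surface measure removable. -/
theorem integral_norm_fderiv_scaled_bump {n : ℕ} (hn : 0 < n) (z : E n) {r : ℝ} (hr : 0 < r) :
    ∫ x, ‖fderiv ℝ (fun x => unitBump n (r⁻¹ • (x - z))) x‖ =
      r ^ (n - 1) * ∫ x, ‖fderiv ℝ (unitBump n) x‖ := by
  have h1 : ∀ x, ‖fderiv ℝ (fun x => unitBump n (r⁻¹ • (x - z))) x‖ =
      r⁻¹ * ‖fderiv ℝ (unitBump n) (r⁻¹ • (x - z))‖ := by
    intro x
    have hl : HasFDerivAt (fun x : E n => r⁻¹ • (x - z)) (r⁻¹ • ContinuousLinearMap.id ℝ (E n)) x :=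
      ((hasFDerivAt_id x).sub_const z).const_smul r⁻¹
    have hd := ((contDiff_unitBump n).differentiable (by simp) (r⁻¹ • (x - z))).hasFDerivAt.comp x hl
    have := hd.fderiv
    rw [show (fun x => unitBump n (r⁻¹ • (x - z))) = unitBump n ∘ fun x => r⁻¹ • (x - z) from rfl,
      this, ContinuousLinearMap.comp_smul, ContinuousLinearMap.comp_id, norm_smul,
      Real.norm_of_nonneg (inv_nonneg.2 hr.le)]
  simp only [h1]
  rw [integral_const_mul, integral_sub_right_eq_self
    (fun x => ‖fderiv ℝ (unitBump n) (r⁻¹ • x)‖) z,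
    Measure.integral_comp_inv_smul volume (fun x => ‖fderiv ℝ (unitBump n) x‖) r, smul_eq_mul,
    ← mul_assoc]
  congr 1
  rw [finrank_euclideanSpace_fin, abs_of_pos (pow_pos hr n)]
  obtain ⟨k, rfl⟩ := Nat.exists_eq_succ_of_ne_zero hn.ne'
  rw [Nat.succ_eq_add_one, Nat.add_sub_cancel, pow_succ]
  field_simp

/-- Take the product of the functions `1 - b i` over a fine cover. Its factors lie in `[0, 1]`, so
the `L¹` norm of the gradient is at most `A ∑ r_i^{n-1}`. -/
theorem exists_cutoff {n : ℕ} (hn : 0 < n) {Z : Set (E n)} (hZ : IsCompact Z)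
    (h0 : (μHE[n - 1] : Measure (E n)) Z = 0) {ε : ℝ} (hε : 0 < ε) :
    ∃ η : E n → ℝ, ContDiff ℝ ∞ η ∧ (∀ x, 0 ≤ η x) ∧ (∀ x, η x ≤ 1) ∧
      (∃ O, IsOpen O ∧ Z ⊆ O ∧ ∀ x ∈ O, η x = 0) ∧
      (∀ x, (∀ z ∈ Z, ε ≤ dist x z) → η x = 1) ∧
      Integrable (fun x => ‖fderiv ℝ η x‖) ∧ ∫ x, ‖fderiv ℝ η x‖ ≤ ε := by
  set A : ℝ := ∫ x, ‖fderiv ℝ (unitBump n) x‖ with hA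
  have hA0 : 0 ≤ A := integral_nonneg fun x => norm_nonneg _
  -- The bound `ε/2` is there because `b i` vanishes only beyond radius `2 * r i`; in `ε/(A + 1)`
  -- the `+ 1` avoids dividing by zero.
  set ε₁ := min (ε / 2) (ε / (A + 1)) with hε₁
  have hε₁0 : 0 < ε₁ := lt_min (half_pos hε) (div_pos hε (by linarith))
  obtain ⟨ι, s, z, r, hz, hr0, hr1, hcov, hsum⟩ := exists_finite_cover_balls hZ h0 hε₁0
  set b : ι → E n → ℝ := fun i x => unitBump n ((r i)⁻¹ • (x - z i)) with hb
  have hbd : ∀ i, ContDiff ℝ ∞ (b i) := fun i =>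
    (contDiff_unitBump n).comp ((contDiff_id.sub contDiff_const).const_smul (r i)⁻¹)
  have hbn : ∀ i x, ‖(r i)⁻¹ • (x - z i)‖ = (r i)⁻¹ * dist x (z i) := fun i x => by
    rw [norm_smul, Real.norm_of_nonneg (inv_nonneg.2 (hr0 i).le), dist_eq_norm]
  have hb0 : ∀ i x, 2 * r i ≤ dist x (z i) → b i x = 0 := fun i x hx => by
    refine unitBump_eq_zero ?_
    rw [hbn, ← div_eq_inv_mul, le_div_iff₀ (hr0 i)]
    exact hx
  have hb1 : ∀ i, ∀ x ∈ Metric.ball (z i) (r i), b i x = 1 := fun i x hx => by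
    refine unitBump_eq_one ?_
    rw [hbn, ← div_eq_inv_mul, div_le_one (hr0 i)]
    exact (Metric.mem_ball.1 hx).le
  have hbs : ∀ i, HasCompactSupport (b i) := fun i =>
    HasCompactSupport.intro (isCompact_closedBall (z i) (2 * r i)) fun x hx =>
      hb0 i x (by rw [Metric.mem_closedBall, not_le] at hx; exact hx.le)
  have hgd : ∀ i, ContDiff ℝ ∞ fun x => 1 - b i x := fun i => contDiff_const.sub (hbd i)
  have hg0 : ∀ i x, 0 ≤ 1 - b i x := fun i x => sub_nonneg.2 (Real.smoothTransition.le_one _)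
  have hg1 : ∀ i x, 1 - b i x ≤ 1 := fun i x => by
    linarith [Real.smoothTransition.nonneg (2 - ‖(r i)⁻¹ • (x - z i)‖ ^ 2),
      show b i x = Real.smoothTransition (2 - ‖(r i)⁻¹ • (x - z i)‖ ^ 2) from rfl]
  have hfd : ∀ i x, ‖fderiv ℝ (fun x => 1 - b i x) x‖ = ‖fderiv ℝ (b i) x‖ := fun i x => by
    rw [fderiv_const_sub, norm_neg]
  have hint : ∀ i, Integrable fun x => ‖fderiv ℝ (b i) x‖ := fun i =>
    ((((hbd i).of_le (by simp)).continuous_fderiv one_ne_zero).integrable_of_hasCompactSupport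
      ((hbs i).fderiv ℝ)).norm
  have hηd : ContDiff ℝ ∞ fun x => ∏ i ∈ s, (1 - b i x) := contDiff_prod fun i _ => hgd i
  have hle : ∀ x, ‖fderiv ℝ (fun x => ∏ i ∈ s, (1 - b i x)) x‖ ≤ ∑ i ∈ s, ‖fderiv ℝ (b i) x‖ :=
    fun x => (norm_fderiv_finset_prod_le s hgd hg0 hg1 x).trans_eq
      (Finset.sum_congr rfl fun i _ => hfd i x)
  have hints : Integrable fun x => ∑ i ∈ s, ‖fderiv ℝ (b i) x‖ :=
    integrable_finsetSum _ fun i _ => hint i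
  have hintη : Integrable fun x => ‖fderiv ℝ (fun x => ∏ i ∈ s, (1 - b i x)) x‖ := by
    refine hints.mono' ?_ (Eventually.of_forall fun x => by rw [norm_norm]; exact hle x)
    exact ((hηd.of_le (by simp)).continuous_fderiv one_ne_zero).norm.aestronglyMeasurable
  refine ⟨_, hηd, fun x => Finset.prod_nonneg fun i _ => hg0 i x,
    fun x => Finset.prod_le_one (fun i _ => hg0 i x) fun i _ => hg1 i x,
    ⟨_, isOpen_biUnion fun i _ => Metric.isOpen_ball, hcov, ?_⟩, ?_, hintη, ?_⟩
  · intro x hx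
    obtain ⟨i, hi, hxi⟩ := mem_iUnion₂.1 hx
    exact Finset.prod_eq_zero hi (by rw [hb1 i x hxi, sub_self])
  · intro x hx
    refine Finset.prod_eq_one fun i _ => ?_
    rw [hb0 i x, sub_zero]
    refine le_trans ?_ (hx (z i) (hz i))
    have := (hr1 i).le.trans (min_le_left _ _)
    linarith
  · calc _ ≤ ∫ x, ∑ i ∈ s, ‖fderiv ℝ (b i) x‖ := integral_mono hintη hints hle
      _ = ∑ i ∈ s, r i ^ (n - 1) * A := by
        rw [integral_finsetSum _ fun i _ => hint i]
        exact Finset.sum_congr rfl fun i _ => integral_norm_fderiv_scaled_bump hn (z i) (hr0 i)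
      _ = (∑ i ∈ s, r i ^ (n - 1)) * A := by rw [Finset.sum_mul]
      _ ≤ ε / (A + 1) * (A + 1) := by
        gcongr
        · exact hsum.trans (min_le_right _ _)
        · linarith
      _ = ε := by field_simp

end HyperbolicClifford

/-! ### The Gauss-Green formula with a singular set -/

namespace HyperbolicClifford

open Filter Topology Measure Module
open scoped NNReal ENNReal Manifold ContDiff

variable {X : Type*} [NormedAddCommGroup X] [NormedSpace ℝ X]

/-- Apply the previous case to `η_k f`, where `η_k` vanishes near the singular set and tends to `1`
off it. The product-rule term `f ∂_v η_k` vanishes in the limit because `f` is bounded and `∇η_k →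
0` in `L¹`; dominated convergence handles the other integrals. -/
theorem gaussGreen_of_hasCompactSupport [CompleteSpace X] {n : ℕ} (hn : 0 < n) {V : Set (E n)}
    (hV : IsOpen V) (hS : IsPiecewiseC1Boundary (frontier V) V) {ν : E n → E n}
    (hν : ∀ x ∈ regularBoundary V, IsOuterUnitNormal V x (ν x))
    {v : E n} (hv : ‖v‖ ≤ 1) {f : E n → X} (hf : ContDiff ℝ 1 f) (hfc : HasCompactSupport f) :
    ∫ x in V, fderiv ℝ f x v = ∫ x in frontier V, ⟪ν x, v⟫ • f x ∂μHE[n - 1] := by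
  set Z := frontier V \ regularBoundary V with hZdef
  have hZc : IsClosed Z := isClosed_frontier_diff_regularBoundary
  have hZk : IsCompact Z := hS.isCompact.of_isClosed_subset hZc sdiff_subset
  have hpos : ∀ k : ℕ, (0 : ℝ) < 1 / ((k : ℝ) + 1) := fun k => Nat.one_div_pos_of_nat
  choose η hηd hη0 hη1 hηO hηe hηi hηle using fun k : ℕ =>
    exists_cutoff hn hZk hS.singular_null (hpos k)
  have hηlim : ∀ x ∉ Z, ∀ᶠ k in atTop, η k x = 1 := by
    intro x hx
    obtain ⟨δ, hδ, hball⟩ := Metric.isOpen_iff.1 hZc.isOpen_compl x hx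
    filter_upwards [(tendsto_one_div_add_atTop_nhds_zero_nat (𝕜 := ℝ)).eventually (gt_mem_nhds hδ)]
      with k hk
    refine hηe k x fun z hz => ?_
    by_contra hcon
    exact hball (Metric.mem_ball'.2 ((not_le.1 hcon).trans hk)) hz
  have hfd : ∀ k, ContDiff ℝ 1 fun x => η k x • f x := fun k =>
    ((hηd k).of_le (by simp)).smul hf
  have hkey : ∀ k, ∫ x in V, fderiv ℝ (fun x => η k x • f x) x v =
      ∫ x in frontier V, ⟪ν x, v⟫ • (η k x • f x) ∂μHE[n - 1] := by
    intro k
    refine gaussGreen_of_tsupport_inter_frontier_subset hV hS hν hv (hfd k) hfc.smul_left ?_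
    rintro x ⟨hx, hxf⟩
    by_contra hxr
    obtain ⟨O, hO, hZO, hO0⟩ := hηO k
    have hxO : x ∈ O := hZO ⟨hxf, hxr⟩
    have : x ∉ tsupport fun x => η k x • f x := by
      rw [notMem_tsupport_iff_eventuallyEq]
      filter_upwards [hO.mem_nhds hxO] with z hz
      simp [hO0 z hz]
    exact this hx
  have hfv : Continuous fun x => fderiv ℝ f x v :=
    (hf.continuous_fderiv one_ne_zero).clm_apply continuous_const
  have hfvi : Integrable fun x => fderiv ℝ f x v :=
    hfv.integrable_of_hasCompactSupport (hfc.fderiv_apply ℝ v)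
  obtain ⟨C, hC⟩ := hfc.exists_bound_of_continuous hf.continuous
  have hC0 : 0 ≤ C := (norm_nonneg _).trans (hC 0)
  have hηv : ∀ k, Continuous fun x => fderiv ℝ (η k) x v := fun k =>
    (((hηd k).of_le (by simp)).continuous_fderiv one_ne_zero (n := 1)).clm_apply continuous_const
  have hprod : ∀ k x, fderiv ℝ (fun x => η k x • f x) x v =
      η k x • fderiv ℝ f x v + fderiv ℝ (η k) x v • f x := by
    intro k x
    rw [fderiv_fun_smul ((hηd k).differentiable (by simp) x) (hf.differentiable one_ne_zero x)]
    simp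
  have hb : ∀ k x, ‖fderiv ℝ (η k) x v • f x‖ ≤ ‖fderiv ℝ (η k) x‖ * C := by
    intro k x
    rw [norm_smul]
    have := (fderiv ℝ (η k) x).le_opNorm v
    have h2 : ‖fderiv ℝ (η k) x v‖ ≤ ‖fderiv ℝ (η k) x‖ :=
      this.trans (mul_le_of_le_one_right (norm_nonneg _) hv)
    gcongr
    exact hC x
  have hi2 : ∀ k, Integrable fun x => fderiv ℝ (η k) x v • f x := fun k =>
    ((hηv k).smul hf.continuous).integrable_of_hasCompactSupport hfc.smul_left
  have hi1 : ∀ k, Integrable fun x => η k x • fderiv ℝ f x v := fun k =>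
    ((hηd k).continuous.smul hfv).integrable_of_hasCompactSupport (hfc.fderiv_apply ℝ v).smul_left
  have lim1 : Tendsto (fun k => ∫ x in V, η k x • fderiv ℝ f x v) atTop
      (𝓝 (∫ x in V, fderiv ℝ f x v)) := by
    refine tendsto_integral_of_dominated_convergence (fun x => ‖fderiv ℝ f x v‖)
      (fun k => (hi1 k).aestronglyMeasurable.restrict) hfvi.norm.integrableOn ?_ ?_
    · refine fun k => Eventually.of_forall fun x => ?_
      rw [norm_smul, Real.norm_of_nonneg (hη0 k x)]
      exact mul_le_of_le_one_left (norm_nonneg _) (hη1 k x)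
    · filter_upwards [ae_restrict_mem hV.measurableSet] with x hx
      have hxZ : x ∉ Z := fun h => by
        have := h.1
        rw [hV.frontier_eq] at this
        exact this.2 hx
      exact tendsto_const_nhds.congr' (by
        filter_upwards [hηlim x hxZ] with k hk
        rw [hk, one_smul])
  have lim2 : Tendsto (fun k => ∫ x in V, fderiv ℝ (η k) x v • f x) atTop (𝓝 0) := by
    have hlim0 : Tendsto (fun k : ℕ => 1 / ((k : ℝ) + 1) * C) atTop (𝓝 0) := by
      simpa using (tendsto_one_div_add_atTop_nhds_zero_nat (𝕜 := ℝ)).mul_const C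
    refine squeeze_zero_norm (fun k => ?_) hlim0
    calc ‖∫ x in V, fderiv ℝ (η k) x v • f x‖
        ≤ ∫ x in V, ‖fderiv ℝ (η k) x‖ * C :=
          norm_integral_le_of_norm_le ((hηi k).mul_const C).integrableOn
            (Eventually.of_forall (hb k))
      _ ≤ ∫ x, ‖fderiv ℝ (η k) x‖ * C :=
          setIntegral_le_integral ((hηi k).mul_const C)
            (Eventually.of_forall fun x => mul_nonneg (norm_nonneg _) hC0)
      _ = (∫ x, ‖fderiv ℝ (η k) x‖) * C := integral_mul_const _ _
      _ ≤ _ := by gcongr; exact hηle k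
  have lim3 : Tendsto (fun k => ∫ x in frontier V, ⟪ν x, v⟫ • (η k x • f x) ∂μHE[n - 1]) atTop
      (𝓝 (∫ x in frontier V, ⟪ν x, v⟫ • f x ∂μHE[n - 1])) := by
    refine tendsto_integral_of_dominated_convergence (fun x => ‖⟪ν x, v⟫ • f x‖)
      (fun k => (integrableOn_inner_outerUnitNormal_smul hS hν v
        (hfd k).continuous.continuousOn).aestronglyMeasurable)
      (integrableOn_inner_outerUnitNormal_smul hS hν v hf.continuous.continuousOn).norm ?_ ?_
    · refine fun k => Eventually.of_forall fun x => ?_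
      rw [smul_comm, norm_smul, Real.norm_of_nonneg (hη0 k x)]
      exact mul_le_of_le_one_left (norm_nonneg _) (hη1 k x)
    · filter_upwards [ae_mem_regularBoundary hS] with x hx
      exact tendsto_const_nhds.congr' (by
        filter_upwards [hηlim x fun h => h.2 hx] with k hk
        rw [hk, one_smul])
  have lim4 := lim1.add lim2
  rw [add_zero] at lim4
  refine tendsto_nhds_unique (lim4.congr fun k => ?_) lim3
  rw [← hkey k, ← integral_add (hi1 k).integrableOn (hi2 k).integrableOn]
  simp only [hprod]

/-- The Gauss-Green formula on a bounded open set with piecewise `C¹` boundary. -/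
theorem gaussGreen [CompleteSpace X] {n : ℕ} (hn : 0 < n) {V : Set (E n)}
    (hV : IsOpen V) (hVb : Bornology.IsBounded V) (hS : IsPiecewiseC1Boundary (frontier V) V)
    {ν : E n → E n} (hν : ∀ x ∈ regularBoundary V, IsOuterUnitNormal V x (ν x))
    {v : E n} (hv : ‖v‖ ≤ 1) {O : Set (E n)} (hO : IsOpen O) (hVO : closure V ⊆ O)
    {f : E n → X} (hf : ContDiffOn ℝ 1 f O) :
    IntegrableOn (fun x => fderiv ℝ f x v) V ∧
    ∫ x in V, fderiv ℝ f x v = ∫ x in frontier V, ⟪ν x, v⟫ • f x ∂μHE[n - 1] := by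
  have hcV : IsCompact (closure V) := hVb.isCompact_closure
  obtain ⟨K, hK, hVK, hKO⟩ := exists_compact_between hcV hO hVO
  obtain ⟨χ, hχ1, hχ0, -⟩ := exists_contMDiffMap_one_nhds_of_subset_interior (n := 1) 𝓘(ℝ, E n)
    isClosed_closure hVK
  have hχs : tsupport χ ⊆ K := closure_minimal (fun x hx => by
    by_contra hxK
    exact hx (hχ0 x hxK)) hK.isClosed
  have hχc : HasCompactSupport χ := hK.of_isClosed_subset (isClosed_tsupport _) hχs
  have hχd : ContDiff ℝ 1 χ := χ.contMDiff.contDiff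
  -- Cutting `f` off outside a compact neighbourhood of `closure V` changes neither integral and
  -- reduces to the compactly supported case.
  set g : E n → X := fun x => χ x • f x with hg
  have hgd : ContDiff ℝ 1 g := by
    rw [contDiff_iff_contDiffAt]
    intro x
    by_cases hx : x ∈ O
    · exact hχd.contDiffAt.smul (hf.contDiffAt (hO.mem_nhds hx))
    · have : g =ᶠ[𝓝 x] fun _ => 0 := by
        have hx' : x ∉ tsupport χ := fun h => hx (hKO (hχs h))
        filter_upwards [notMem_tsupport_iff_eventuallyEq.1 hx'] with z hz
        simp [hg, hz]
      exact contDiffAt_const.congr_of_eventuallyEq this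
  have hgc : HasCompactSupport g := hχc.smul_right
  have hev : ∀ x ∈ closure V, g =ᶠ[𝓝 x] f := by
    intro x hx
    filter_upwards [(eventually_nhdsSet_iff_forall.1 hχ1) x hx] with z hz
    simp [hg, hz]
  have e1 : ∀ x ∈ V, fderiv ℝ g x v = fderiv ℝ f x v := fun x hx => by
    rw [(hev x (subset_closure hx)).fderiv_eq]
  have hgi : Integrable fun x => fderiv ℝ g x v :=
    ((hgd.continuous_fderiv one_ne_zero).clm_apply
      continuous_const).integrable_of_hasCompactSupport (hgc.fderiv_apply ℝ v)
  refine ⟨hgi.integrableOn.congr_fun e1 hV.measurableSet, ?_⟩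
  rw [← setIntegral_congr_fun hV.measurableSet e1,
    gaussGreen_of_hasCompactSupport hn hV hS hν hv hgd hgc]
  refine setIntegral_congr_fun isClosed_frontier.measurableSet fun x hx => ?_
  rw [(hev x (frontier_subset_closure hx)).self_of_nhds]

end HyperbolicClifford

/-! ### The Clifford algebra behind Green's identity -/

namespace HyperbolicClifford

open Filter Topology Module
open scoped ContDiff

variable {n : ℕ} [NeZero n]

theorem P_add (A B : Cl n) : P (A + B) = P A + P B := by
  simp only [P, map_add, ← smul_add]; congr 1; abel

theorem P_smul (c : ℝ) (A : Cl n) : P (c • A) = c • P A := by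
  rw [P, P, map_smul, ← smul_add, smul_comm]

/-- The projection `P` as a continuous linear map. -/
noncomputable def projL (n : ℕ) [NeZero n] : Cl n →L[ℝ] Cl n :=
  LinearMap.toContinuousLinearMap ⟨⟨P, P_add⟩, P_smul⟩

theorem projL_apply (A : Cl n) : projL n A = P A := rfl

/-- Left multiplication by `a` as a continuous linear map. -/
noncomputable def mulLeftL (a : Cl n) : Cl n →L[ℝ] Cl n :=
  LinearMap.toContinuousLinearMap (LinearMap.mulLeft ℝ a)

/-- The continuous linear map `A ↦ P(e_i e_j A)`. -/
noncomputable def projMul (i j : Fin n) : Cl n →L[ℝ] Cl n := projL n ∘L mulLeftL (e i * e j)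

theorem projMul_apply (i j : Fin n) (A : Cl n) : projMul i j A = P (e i * e j * A) := rfl

theorem P_of_mem {A : Cl n} (hA : A ∈ ClBase n) : P A = A := by
  have := P_add_mul hA (ClBase n).zero_mem
  rwa [zero_mul, add_zero] at this

theorem Q_of_mem {A : Cl n} (hA : A ∈ ClBase n) : Q A = 0 := by
  have := Q_add_mul hA (ClBase n).zero_mem
  rwa [zero_mul, add_zero] at this

theorem Q'_of_mem {A : Cl n} (hA : A ∈ ClBase n) : Q' A = 0 := by
  rw [Q', Q_of_mem hA, mul_zero, zero_mul, neg_zero]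

theorem projMul_self (i : Fin n) (A : Cl n) : projMul i i A = -P A := by
  rw [projMul_apply, e_mul_self, neg_one_mul, ← projL_apply, map_neg, projL_apply]

theorem projMul_swap {i j : Fin n} (hij : i ≠ j) (A : Cl n) : projMul i j A = -projMul j i A := by
  rw [projMul_apply, e_mul_e hij, neg_mul, ← projL_apply, map_neg, projL_apply, projMul_apply]

/-- The product contains exactly one factor `e_n`, so `hat` changes its sign and `P` annihilates it.
-/
theorem projMul_last_of_ne {j : Fin n} (hj : j ≠ last n) {A : Cl n} (hA : A ∈ ClBase n) :
    projMul j (last n) A = 0 := by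
  rw [projMul_apply, P, map_mul, map_mul, hat_of_mem hA, hat_e_last, hat_e_of_ne hj]
  simp

theorem projMul_last_left_of_ne {j : Fin n} (hj : j ≠ last n) {A : Cl n} (hA : A ∈ ClBase n) :
    projMul (last n) j A = 0 := by
  rw [projMul_swap hj.symm, projMul_last_of_ne hj hA, neg_zero]

/-- Projected form of `D² = -Δ`: anticommutation cancels the off-diagonal terms in pairs, and `e_i²
= -1` gives the diagonal. -/
theorem sum_projMul_of_symm {T : Fin n → Fin n → Cl n} (hT : ∀ i j, T i j = T j i) :
    ∑ i, ∑ j, projMul i j (T i j) = -∑ i, P (T i i) := by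
  have h1 : ∑ i, ∑ j, projMul i j (T i j) = ∑ i, ∑ j, projMul j i (T i j) := by
    rw [Finset.sum_comm]
    exact Finset.sum_congr rfl fun i _ => Finset.sum_congr rfl fun j _ => by rw [hT]
  have h2 : ∑ i, ∑ j, projMul i j (T i j) + ∑ i, ∑ j, projMul j i (T i j) =
      -((2 : ℝ) • ∑ i, P (T i i)) := by
    rw [← Finset.sum_add_distrib, Finset.smul_sum, ← Finset.sum_neg_distrib]
    refine Finset.sum_congr rfl fun i _ => ?_
    rw [← Finset.sum_add_distrib, Finset.sum_eq_single i]
    · rw [projMul_self, two_smul, neg_add]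
    · intro j _ hji
      rw [projMul_swap hji.symm, neg_add_cancel]
    · intro h; exact absurd (Finset.mem_univ i) h
  rw [← h1, ← two_smul ℝ, ← smul_neg] at h2
  exact smul_right_injective _ (two_ne_zero (α := ℝ)) h2

/-- The divergence of `greenField` at one point: `a`, `s` are the gradient and Hessian of `γ`, `w`
and `b` the weight and its gradient, `H`, `H2` the first and second derivatives of `h`, and `c =
(n-2)/x_n`. The two mixed sums coincide (`S14`), and the `γ` terms `S2` and `S3` cancel by `β = -(c
* w)` and the equation for `h`. -/
theorem green_algebra {a b : Fin n → ℝ} {s : Fin n → Fin n → ℝ} {w γ β c : ℝ} {h : Cl n}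
    {H : Fin n → Cl n} {H2 : Fin n → Fin n → Cl n} (hs : ∀ i j, s i j = s j i)
    (hH2 : ∀ i j, H2 i j = H2 j i) (hh : h ∈ ClBase n) (hH : ∀ i, H i ∈ ClBase n)
    (hb : ∀ i, b i = if i = last n then β else 0) (hβ : β = -(c * w))
    (hlap : ∑ i, H2 i i = c • H (last n)) :
    ∑ i, ∑ j, ((a i * w + γ * b i) • projMul i j (H j) + (γ * w) • projMul i j (H2 i j)
      - ((b i * a j + w * s i j) • projMul j i h + (w * a j) • projMul j i (H i))) =
    (∑ i, (b i * a i + w * s i i)) • h := by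
  have S14 : ∑ i, ∑ j, (a i * w) • projMul i j (H j) = ∑ i, ∑ j, (w * a j) • projMul j i (H i) := by
    rw [Finset.sum_comm]
    exact Finset.sum_congr rfl fun i _ => Finset.sum_congr rfl fun j _ => by rw [mul_comm w]
  have S2 : ∑ i, ∑ j, (γ * b i) • projMul i j (H j) = -((γ * β) • H (last n)) := by
    rw [Finset.sum_eq_single (last n)]
    · rw [Finset.sum_eq_single (last n)]
      · rw [projMul_self, P_of_mem (hH _), hb, if_pos rfl, smul_neg]
      · intro j _ hj
        rw [projMul_last_left_of_ne hj (hH j), smul_zero]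
      · intro h; exact absurd (Finset.mem_univ _) h
    · intro i _ hi
      simp [hb, hi]
    · intro h; exact absurd (Finset.mem_univ _) h
  have S3 : ∑ i, ∑ j, (γ * w) • projMul i j (H2 i j) = -((γ * w * c) • H (last n)) := by
    simp only [← Finset.smul_sum]
    rw [sum_projMul_of_symm hH2]
    have : ∑ i, P (H2 i i) = c • H (last n) := by
      simp only [← projL_apply]
      rw [← map_sum, hlap, projL_apply, P_smul, P_of_mem (hH _)]
    rw [this, smul_neg, smul_smul]
  have S5 : ∑ i, ∑ j, (b i * a j) • projMul j i h = -((β * a (last n)) • h) := by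
    rw [Finset.sum_eq_single (last n)]
    · rw [Finset.sum_eq_single (last n)]
      · rw [projMul_self, P_of_mem hh, hb, if_pos rfl, smul_neg]
      · intro j _ hj
        rw [projMul_last_of_ne hj hh, smul_zero]
      · intro h; exact absurd (Finset.mem_univ _) h
    · intro i _ hi
      simp [hb, hi]
    · intro h; exact absurd (Finset.mem_univ _) h
  have S6 : ∑ i, ∑ j, (w * s i j) • projMul j i h = -(∑ i, (w * s i i)) • h := by
    have := sum_projMul_of_symm (T := fun i j => (w * s i j) • h) fun i j => by rw [hs]
    rw [Finset.sum_comm] at this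
    simp only [map_smul, P_smul, P_of_mem hh, ← Finset.sum_smul] at this
    rw [neg_smul, ← this]
    exact Finset.sum_congr rfl fun i _ => Finset.sum_congr rfl fun j _ => by rw [hs]
  have S7 : ∑ i, b i * a i = β * a (last n) := by
    rw [Finset.sum_eq_single (last n)]
    · rw [hb, if_pos rfl]
    · intro i _ hi
      simp [hb, hi]
    · intro h; exact absurd (Finset.mem_univ _) h
  simp only [add_smul, Finset.sum_add_distrib, Finset.sum_sub_distrib]
  rw [S14, S2, S3, S5, S6, S7, hβ, neg_smul]
  module

/-! ### The vector field of Green's formula -/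

/-- The weight `x_n^{-(n-2)}`. -/
noncomputable def weight (x : E n) : ℝ := 1 / x (last n) ^ (n - 2)

/-- The field `F_i` with `∑ ν_i F_i = G n Mh x_n^{2-n} - p n h x_n^{2-n}`, where `γ = G(·, y)`. -/
noncomputable def greenForm (γ : E n → ℝ) (h : E n → Cl n) (i : Fin n) (x : E n) : Cl n :=
  ∑ j, ((γ x * weight x) • (e i * e j * fderiv ℝ h x (stdVec j)) -
    (weight x * fderiv ℝ γ x (stdVec j)) • (e j * e i * h x))

/-- The projection to `Cl_{n-1}` of `greenForm`. -/
noncomputable def greenField (γ : E n → ℝ) (h : E n → Cl n) (i : Fin n) (x : E n) : Cl n :=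
  ∑ j, ((γ x * weight x) • projMul i j (fderiv ℝ h x (stdVec j)) -
    (weight x * fderiv ℝ γ x (stdVec j)) • projMul j i (h x))

theorem P_greenForm (γ : E n → ℝ) (h : E n → Cl n) (i : Fin n) (x : E n) :
    P (greenForm γ h i x) = greenField γ h i x := by
  rw [greenForm, ← projL_apply, map_sum]
  simp only [map_sub, map_smul, projL_apply, greenField, projMul_apply]

theorem vec_eq_sum {d : ℕ} (v : E d) : vec v = ∑ i, v i • (e i : Cl d) := by
  have hm' : v = ∑ i, v i • stdVec i := by
    ext j
    simp [stdVec, Finset.sum_apply, Pi.single_apply]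
  conv_lhs => rw [hm']
  simp [map_sum, e]

theorem fderiv_algebraMap_comp {d : ℕ} {γ : E d → ℝ} {x : E d} (hγ : DifferentiableAt ℝ γ x) (v : E d) :
    fderiv ℝ (fun z => algebraMap ℝ (Cl d) (γ z)) x v = algebraMap ℝ (Cl d) (fderiv ℝ γ x v) := by
  have h := ((Algebra.linearMap ℝ (Cl d)).toContinuousLinearMap.hasFDerivAt (x := γ x)).comp x
    hγ.hasFDerivAt
  have h' : fderiv ℝ (fun z => algebraMap ℝ (Cl d) (γ z)) x = _ := h.fderiv
  rw [h']
  rfl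

theorem diracHodge_of_mem {h : E n → Cl n} {x : E n} (hx : h x ∈ ClBase n) :
    diracHodge h x = ∑ j, e j * fderiv ℝ h x (stdVec j) := by
  rw [diracHodge, Q'_of_mem hx, smul_zero, add_zero, dirac]

/-- In the first term the normal stands left of the Dirac operator, giving `e_i e_j`; in the second
`p` stands left of the normal, giving `e_j e_i`. -/
theorem integrand_eq_sum_greenForm {h : E n → Cl n} {x y v : E n} (hx : h x ∈ ClBase n)
    (hγ : DifferentiableAt ℝ (fun z => G z y) x) :
    G x y • ((1 / x (last n) ^ (n - 2)) • vec v * diracHodge h x)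
          - p x y * ((1 / x (last n) ^ (n - 2)) • vec v) * h x =
      ∑ i, v i • greenForm (fun z => G z y) h i x := by
  rw [diracHodge_of_mem hx, p, dirac]
  simp only [fderiv_algebraMap_comp hγ, vec_eq_sum v, greenForm, weight]
  simp only [Finset.smul_sum, Finset.sum_mul, Finset.mul_sum, smul_sub, Finset.sum_sub_distrib,
    Algebra.algebraMap_eq_smul_one, mul_smul_comm, smul_mul_assoc, mul_one, smul_smul, mul_assoc]
  congr 1
  · rw [Finset.sum_comm]
    refine Finset.sum_congr rfl fun i _ => Finset.sum_congr rfl fun j _ => ?_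
    congr 1; ring
  · refine Finset.sum_congr rfl fun i _ => Finset.sum_congr rfl fun j _ => ?_
    congr 1; ring

/-- Near `x` one has `h = P ∘ h`, and the linear map `P` commutes with differentiation. -/
theorem fderiv_mem_ClBase {h : E n → Cl n} {U : Set (E n)} (hU : IsOpen U)
    (hh : ∀ x ∈ U, h x ∈ ClBase n) {x : E n} (hx : x ∈ U) (hd : DifferentiableAt ℝ h x) (v : E n) :
    fderiv ℝ h x v ∈ ClBase n := by
  have h1 : (fun z => projL n (h z)) =ᶠ[𝓝 x] h := by
    filter_upwards [hU.mem_nhds hx] with z hz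
    rw [projL_apply, P_of_mem (hh z hz)]
  have h2 : fderiv ℝ (fun z => projL n (h z)) x v = P (fderiv ℝ h x v) := by
    have h' : fderiv ℝ (fun z => projL n (h z)) x = _ :=
      ((projL n).hasFDerivAt.comp x hd.hasFDerivAt).fderiv
    rw [h']; rfl
  rw [h1.fderiv_eq] at h2
  rw [h2]
  exact P_mem _

end HyperbolicClifford

/-! ### The divergence of the Green field -/

namespace HyperbolicClifford

open Filter Topology Module
open scoped ContDiff

variable {n : ℕ} [NeZero n]

theorem hasFDerivAt_coord {d : ℕ} (x : E d) (i : Fin d) :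
    HasFDerivAt (fun z : E d => z i) (EuclideanSpace.proj i : E d →L[ℝ] ℝ) x :=
  (EuclideanSpace.proj i : E d →L[ℝ] ℝ).hasFDerivAt

theorem hasFDerivAt_weight {x : E n} (hx : x ∈ upperHalfSpace n) (hn : 2 ≤ n) :
    HasFDerivAt (weight (n := n))
      (-((((n : ℝ) - 2) / x (last n)) * weight x) • (EuclideanSpace.proj (last n) : E n →L[ℝ] ℝ)) x := by
  have hx0 : x (last n) ≠ 0 := ne_of_gt hx
  have h1 : HasDerivAt (fun t : ℝ => 1 / t ^ (n - 2))
      (-((((n : ℝ) - 2) / x (last n)) * weight x)) (x (last n)) := by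
    have h2 := ((hasDerivAt_pow (n - 2) (x (last n))).inv (pow_ne_zero _ hx0))
    simp only [one_div]
    refine h2.congr_deriv ?_
    rw [weight, Nat.cast_sub hn]
    rcases Nat.eq_zero_or_pos (n - 2) with h0 | h0
    · have : (n : ℝ) = 2 := by exact_mod_cast (show n = 2 by omega)
      simp [this]
    · obtain ⟨k, hk⟩ := Nat.exists_eq_succ_of_ne_zero h0.ne'
      rw [hk, Nat.succ_eq_add_one, Nat.add_sub_cancel]
      field_simp
      push_cast
      ring
  exact HasDerivAt.comp_hasFDerivAt (f := fun z : E n => z (last n)) x h1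
    (hasFDerivAt_coord x (last n))

theorem contDiffAt_weight {x : E n} (hx : x ∈ upperHalfSpace n) {k : ℕ∞ω} :
    ContDiffAt ℝ k (weight (n := n)) x :=
  contDiffAt_const.div ((EuclideanSpace.proj (last n) : E n →L[ℝ] ℝ).contDiff.contDiffAt.pow _)
    (pow_ne_zero _ (ne_of_gt hx))

theorem contDiffAt_greenForm {γ : E n → ℝ} {h : E n → Cl n} {x : E n}
    (hx : x ∈ upperHalfSpace n) (hγ : ContDiffAt ℝ 2 γ x) (hh : ContDiffAt ℝ 2 h x) (i : Fin n) :
    ContDiffAt ℝ 1 (greenForm γ h i) x := by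
  have h12 : (1 : ℕ∞ω) + 1 ≤ 2 := by norm_num
  have hdγ : ∀ v, ContDiffAt ℝ 1 (fun z => fderiv ℝ γ z v) x := fun v =>
    (hγ.fderiv_right h12).clm_apply contDiffAt_const
  have hdh : ∀ v, ContDiffAt ℝ 1 (fun z => fderiv ℝ h z v) x := fun v =>
    (hh.fderiv_right h12).clm_apply contDiffAt_const
  have hw := contDiffAt_weight hx (k := 1)
  have h1 : (1 : ℕ∞ω) ≤ 2 := by norm_num
  refine ContDiffAt.sum fun j _ => ((hγ.of_le h1).mul hw |>.smul ?_).sub ((hw.mul (hdγ _)).smul ?_)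
  · exact (mulLeftL (e i * e j)).contDiff.contDiffAt.comp x (hdh _)
  · exact (mulLeftL (e j * e i)).contDiff.contDiffAt.comp x (hh.of_le h1)

theorem contDiffAt_greenField {γ : E n → ℝ} {h : E n → Cl n} {x : E n}
    (hx : x ∈ upperHalfSpace n) (hγ : ContDiffAt ℝ 2 γ x) (hh : ContDiffAt ℝ 2 h x) (i : Fin n) :
    ContDiffAt ℝ 1 (greenField γ h i) x := by
  have : greenField γ h i = fun x => projL n (greenForm γ h i x) :=
    funext fun x => (P_greenForm γ h i x).symm
  rw [this]
  exact (projL n).contDiff.contDiffAt.comp x (contDiffAt_greenForm hx hγ hh i)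

/-- Green's identity: the divergence of `greenField` is `div (x_n^{2-n} ∇γ) h`. -/
theorem sum_fderiv_greenField (hn : 2 ≤ n) {U : Set (E n)} (hU : IsOpen U)
    (hUH : U ⊆ upperHalfSpace n) {h : E n → Cl n} (hh : IsHyperbolicHarmonicOn h U) {γ : E n → ℝ}
    {x : E n} (hx : x ∈ U) (hγ : ContDiffAt ℝ 2 γ x) :
    ∑ i, fderiv ℝ (greenField γ h i) x (stdVec i) =
      (∑ i, fderiv ℝ (fun z => weight z * fderiv ℝ γ z (stdVec i)) x (stdVec i)) • h x := by
  have h12 : (1 : ℕ∞ω) + 1 ≤ 2 := by norm_num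
  have hhx : ContDiffAt ℝ 2 h x := hh.1.contDiffAt (hU.mem_nhds hx)
  have hdh : DifferentiableAt ℝ h x := hhx.differentiableAt two_ne_zero
  have hdγ : DifferentiableAt ℝ γ x := hγ.differentiableAt two_ne_zero
  have hd2h : DifferentiableAt ℝ (fderiv ℝ h) x :=
    (hhx.fderiv_right h12).differentiableAt one_ne_zero
  have hd2γ : DifferentiableAt ℝ (fderiv ℝ γ) x :=
    (hγ.fderiv_right h12).differentiableAt one_ne_zero
  have hw := hasFDerivAt_weight (hUH hx) hn
  have hsh : IsSymmSndFDerivAt ℝ h x := hhx.isSymmSndFDerivAt (by simp)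
  have hsγ : IsSymmSndFDerivAt ℝ γ x := hγ.isSymmSndFDerivAt (by simp)
  have hfh : ∀ v, HasFDerivAt (fun z => fderiv ℝ h z v) ((fderiv ℝ (fderiv ℝ h) x).flip v) x := by
    intro v
    exact ((ContinuousLinearMap.apply ℝ (Cl n) v).hasFDerivAt).comp x hd2h.hasFDerivAt
  have hfγ : ∀ v, HasFDerivAt (fun z => fderiv ℝ γ z v) ((fderiv ℝ (fderiv ℝ γ) x).flip v) x := by
    intro v
    exact ((ContinuousLinearMap.apply ℝ ℝ v).hasFDerivAt).comp x hd2γ.hasFDerivAt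
  have hwγ : ∀ v, HasFDerivAt (fun z => weight z * fderiv ℝ γ z v) _ x := fun v => hw.mul (hfγ v)
  have hfield : ∀ i, HasFDerivAt (greenField γ h i) _ x := fun i =>
    HasFDerivAt.fun_sum (u := Finset.univ) fun j _ =>
      ((hdγ.hasFDerivAt.mul hw).smul
        ((projMul i j).hasFDerivAt.comp x (hfh (stdVec j)))).sub
      ((hwγ (stdVec j)).smul ((projMul j i).hasFDerivAt.comp x hdh.hasFDerivAt))
  have hlapx := hh.2.2 x hx
  rw [hyperbolicLaplacian, sub_eq_zero, InnerProductSpace.laplacian_eq_iteratedFDeriv_orthonormalBasis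
    h (EuclideanSpace.basisFun (Fin n) ℝ)] at hlapx
  simp only [iteratedFDeriv_two_apply, Matrix.cons_val_zero, Matrix.cons_val_one,
    EuclideanSpace.basisFun_apply] at hlapx
  have key := green_algebra (n := n) (a := fun i => fderiv ℝ γ x (stdVec i))
    (b := fun i => -((((n : ℝ) - 2) / x (last n)) * weight x) * (stdVec i : E n) (last n))
    (s := fun i j => fderiv ℝ (fderiv ℝ γ) x (stdVec i) (stdVec j))
    (w := weight x) (γ := γ x) (β := -((((n : ℝ) - 2) / x (last n)) * weight x))
    (c := ((n : ℝ) - 2) / x (last n)) (h := h x) (H := fun i => fderiv ℝ h x (stdVec i))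
    (H2 := fun i j => fderiv ℝ (fderiv ℝ h) x (stdVec i) (stdVec j))
    (fun i j => hsγ _ _) (fun i j => hsh _ _) (hh.2.1 x hx)
    (fun i => fderiv_mem_ClBase hU hh.2.1 hx hdh _) (fun i => by
      by_cases hi : i = last n
      · subst hi; simp [stdVec]
      · simp [stdVec, hi, Ne.symm hi]) rfl hlapx
  have e1 : ∀ i, fderiv ℝ (fun z => weight z * fderiv ℝ γ z (stdVec i)) x (stdVec i) =
      -((((n : ℝ) - 2) / x (last n)) * weight x) * (stdVec i : E n) (last n) *
        fderiv ℝ γ x (stdVec i) + weight x * fderiv ℝ (fderiv ℝ γ) x (stdVec i) (stdVec i) := by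
    intro i
    rw [(hwγ (stdVec i)).fderiv]
    simp
    ring
  simp only [e1]
  rw [← key]
  refine Finset.sum_congr rfl fun i _ => ?_
  rw [(hfield i).fderiv]
  simp only [_root_.sum_apply]
  refine Finset.sum_congr rfl fun j _ => ?_
  simp
  module

end HyperbolicClifford

/-! ### The kernel `G`: gradient, equation, growth at the pole -/

namespace HyperbolicClifford

open Filter Topology Module
open scoped ContDiff

theorem hasFDerivAt_inv_norm_sub_pow {V : Type*} [NormedAddCommGroup V] [InnerProductSpace ℝ V]
    {x c : V} (hx : x ≠ c) (k : ℕ) :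
    HasFDerivAt (fun z => (‖z - c‖ ^ k)⁻¹)
      ((-((k : ℝ) * (‖x - c‖ ^ (k + 2))⁻¹)) • innerSL ℝ (x - c)) x := by
  have h0 : ‖x - c‖ ≠ 0 := norm_ne_zero_iff.2 (sub_ne_zero.2 hx)
  have h1 : HasFDerivAt (fun z => ‖z - c‖ ^ 2) (2 • innerSL ℝ (x - c)) x := by
    have := (hasStrictFDerivAt_norm_sq (x - c)).hasFDerivAt.comp x ((hasFDerivAt_id x).sub_const c)
    refine HasFDerivAt.congr_fderiv (f := fun z => ‖z - c‖ ^ 2) this ?_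
    ext v
    simp
  have h2 : HasFDerivAt (fun z => ‖z - c‖) ((‖x - c‖⁻¹) • innerSL ℝ (x - c)) x := by
    have := h1.sqrt (pow_ne_zero 2 h0)
    simp only [Real.sqrt_sq (norm_nonneg _)] at this
    refine this.congr_fderiv ?_
    ext v
    simp
    field_simp
  have h3 : HasDerivAt (fun t : ℝ => (t ^ k)⁻¹) (-((k : ℝ) * (‖x - c‖ ^ (k + 1))⁻¹)) ‖x - c‖ := by
    refine ((hasDerivAt_pow k ‖x - c‖).inv (pow_ne_zero _ h0)).congr_deriv ?_
    rcases Nat.eq_zero_or_pos k with rfl | hk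
    · simp
    · obtain ⟨j, rfl⟩ := Nat.exists_eq_succ_of_ne_zero hk.ne'
      rw [Nat.succ_eq_add_one, Nat.add_sub_cancel]
      field_simp
      ring
  refine (HasDerivAt.comp_hasFDerivAt (f := fun z => ‖z - c‖) x h3 h2).congr_fderiv ?_
  rw [smul_smul]
  congr 1
  rw [pow_succ _ (k + 1), mul_inv]
  ring

theorem sum_fderiv_inner_smul_sub {n : ℕ} {A : E n → ℝ} {x c w : E n}
    (hA : HasFDerivAt A (innerSL ℝ w) x) (v : Fin n → E n) (hv : v = fun i => stdVec i) :
    ∑ i, fderiv ℝ (fun z => ⟪A z • (z - c), v i⟫) x (v i) = n * A x + ⟪w, x - c⟫ := by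
  subst hv
  have h1 : HasFDerivAt (fun z => A z • (z - c)) _ x :=
    hA.smul ((hasFDerivAt_id x).sub_const c)
  have h2 : ∀ i, fderiv ℝ (fun z => ⟪A z • (z - c), stdVec i⟫) x (stdVec i) =
      A x + w i * (x - c) i := by
    intro i
    have h3 := (h1.inner ℝ (hasFDerivAt_const (stdVec i : E n) x)).fderiv
    rw [h3]
    simp [stdVec, inner_add_left, EuclideanSpace.inner_single_right]
  simp only [h2, Finset.sum_add_distrib, Finset.sum_const, Finset.card_univ, Fintype.card_fin,
    nsmul_eq_mul]
  congr 1
  rw [PiLp.inner_apply]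
  exact Finset.sum_congr rfl fun i _ => by simp [mul_comm]

variable {n : ℕ} [NeZero n]

/-- With `t = ‖x - y‖/‖x - ŷ‖` this says `1 - t² = 4 x_n y_n/‖x - ŷ‖²`. It is the source of the
factor `x_n^{n-2}` in `∇G` that cancels the weight. -/
theorem norm_sub_reflect_sq_sub (x y : E n) :
    ‖x - reflect n y‖ ^ 2 - ‖x - y‖ ^ 2 = 4 * x (last n) * y (last n) := by
  rw [EuclideanSpace.norm_sq_eq, EuclideanSpace.norm_sq_eq, ← Finset.sum_sub_distrib,
    Finset.sum_eq_single (last n)]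
  · simp [reflect_apply]; ring
  · intro i _ hi
    simp [reflect_apply, hi]
  · intro h; exact absurd (Finset.mem_univ _) h

theorem ne_reflect {x y : E n} (hx : x ∈ upperHalfSpace n) (hy : y ∈ upperHalfSpace n) :
    x ≠ reflect n y := by
  rintro rfl
  have hx' : 0 < (reflect n y) (last n) := hx
  have hy' : 0 < y (last n) := hy
  rw [reflect_apply, if_pos rfl] at hx'
  linarith

theorem isOpen_upperHalfSpace : IsOpen (upperHalfSpace n) :=
  isOpen_lt continuous_const (EuclideanSpace.proj (last n) : E n →L[ℝ] ℝ).continuous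

/-- The vector field `x_n^{2-n} ∇_x G(x, y)` in closed form. -/
noncomputable def greenGrad (y x : E n) : E n :=
  (-(4 * y (last n)) ^ (n - 2)) •
    (((‖x - y‖ ^ n)⁻¹ * (‖x - reflect n y‖ ^ (n - 2))⁻¹) • (x - y) -
      ((‖x - reflect n y‖ ^ n)⁻¹ * (‖x - y‖ ^ (n - 2))⁻¹) • (x - reflect n y))

theorem hasDerivAt_integral_kernel (k l : ℕ) {s : ℝ} (hs : 0 < s) :
    HasDerivAt (fun s : ℝ => ∫ t in s..1, (1 - t ^ 2) ^ k / t ^ l) (-((1 - s ^ 2) ^ k / s ^ l)) s := by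
  have hc : ContinuousOn (fun t : ℝ => (1 - t ^ 2) ^ k / t ^ l) (Ioi 0) :=
    (by fun_prop : ContinuousOn (fun t : ℝ => (1 - t ^ 2) ^ k) (Ioi 0)).div (by fun_prop)
      fun t ht => pow_ne_zero _ (ne_of_gt ht)
  refine intervalIntegral.integral_hasDerivAt_left ?_ ?_ ?_
  · refine (hc.mono fun t ht => ?_).intervalIntegrable
    exact (lt_min hs one_pos).trans_le ht.1
  · exact hc.stronglyMeasurableAtFilter isOpen_Ioi s hs
  · exact hc.continuousAt (Ioi_mem_nhds hs)

theorem hasFDerivAt_G (hn : 2 < n) {x y : E n} (hx : x ∈ upperHalfSpace n)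
    (hy : y ∈ upperHalfSpace n) (hxy : x ≠ y) :
    HasFDerivAt (fun z => G z y) (x (last n) ^ (n - 2) • innerSL ℝ (greenGrad y x)) x := by
  have ha0 : 0 < ‖x - y‖ := norm_pos_iff.2 (sub_ne_zero.2 hxy)
  have hb0 : 0 < ‖x - reflect n y‖ := norm_pos_iff.2 (sub_ne_zero.2 (ne_reflect hx hy))
  have hA : HasFDerivAt (fun z => ‖z - y‖) (‖x - y‖⁻¹ • innerSL ℝ (x - y)) x := by
    have h1 := (hasFDerivAt_inv_norm_sub_pow hxy 1)
    simp only [pow_one] at h1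
    have h2 := (hasDerivAt_inv (inv_ne_zero ha0.ne')).comp_hasFDerivAt x h1
    simp only [Function.comp_def, inv_inv] at h2
    refine h2.congr_fderiv ?_
    rw [smul_smul]; congr 1
    push_cast
    field_simp
  have hB : HasFDerivAt (fun z => (‖z - reflect n y‖)⁻¹)
      (-(‖x - reflect n y‖ ^ 3)⁻¹ • innerSL ℝ (x - reflect n y)) x := by
    have h1 := (hasFDerivAt_inv_norm_sub_pow (ne_reflect hx hy) 1)
    simpa using h1
  have hq : HasFDerivAt (fun z => ‖z - y‖ / ‖z - reflect n y‖) _ x := hA.mul hB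
  have hG : HasFDerivAt (fun z => G z y) _ x :=
    HasDerivAt.comp_hasFDerivAt
      (h₂ := fun s : ℝ => ∫ t in s..1, (1 - t ^ 2) ^ (n - 2) / t ^ (n - 1))
      (f := fun z => ‖z - y‖ / ‖z - reflect n y‖) x
      (hasDerivAt_integral_kernel (n - 2) (n - 1) (div_pos ha0 hb0)) hq
  refine hG.congr_fderiv ?_
  obtain ⟨m, rfl⟩ : ∃ m, n = m + 2 := ⟨n - 2, by omega⟩
  have hsq := norm_sub_reflect_sq_sub x y
  set a := ‖x - y‖ with ha
  set b := ‖x - reflect (m + 2) y‖ with hb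
  have hone : 1 - (a / b) ^ 2 = (x (last (m + 2)) * (4 * y (last (m + 2)))) / b ^ 2 := by
    field_simp
    linarith
  rw [hone, div_pow, div_pow, mul_pow]
  ext v
  simp only [greenGrad, Nat.add_sub_cancel, show m + 2 - 1 = m + 1 by omega, ← ha, ← hb]
  simp only [smul_apply, add_apply, innerSL_apply_apply,
    smul_eq_mul, inner_smul_left, inner_sub_left]
  simp only [conj_trivial]
  field_simp
  ring

theorem weight_mul_fderiv_G (hn : 2 < n) {x y : E n} (hx : x ∈ upperHalfSpace n)
    (hy : y ∈ upperHalfSpace n) (hxy : x ≠ y) (v : E n) :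
    weight x * fderiv ℝ (fun z => G z y) x v = ⟪greenGrad y x, v⟫ := by
  have hx0 : x (last n) ≠ 0 := ne_of_gt hx
  rw [(hasFDerivAt_G hn hx hy hxy).fderiv, weight]
  simp only [smul_apply, innerSL_apply_apply, smul_eq_mul]
  field_simp

theorem contDiffAt_greenGrad {x y : E n} (hx : x ∈ upperHalfSpace n)
    (hy : y ∈ upperHalfSpace n) (hxy : x ≠ y) {k : ℕ∞ω} : ContDiffAt ℝ k (greenGrad y) x := by
  have h1 : ∀ (c : E n) (j : ℕ), x ≠ c → ContDiffAt ℝ k (fun z => (‖z - c‖ ^ j)⁻¹) x := by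
    intro c j hc
    have h0 := sub_ne_zero.2 hc
    exact (((contDiffAt_id.sub contDiffAt_const).norm ℝ h0).pow j).inv
      (pow_ne_zero _ (norm_ne_zero_iff.2 h0))
  have hr := ne_reflect hx hy
  exact (contDiffAt_const (c := -(4 * y (last n)) ^ (n - 2))).smul ((((h1 _ _ hxy).mul (h1 _ _ hr)).smul
    (contDiffAt_id.sub contDiffAt_const)).sub
    (((h1 _ _ hr).mul (h1 _ _ hxy)).smul (contDiffAt_id.sub contDiffAt_const)))

/-- The closed form of the gradient is itself smooth away from `y`, which upgrades differentiability
of `G` to `C²`. -/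
theorem contDiffAt_G (hn : 2 < n) {x y : E n} (hx : x ∈ upperHalfSpace n)
    (hy : y ∈ upperHalfSpace n) (hxy : x ≠ y) : ContDiffAt ℝ 2 (fun z => G z y) x := by
  set O : Set (E n) := upperHalfSpace n ∩ {y}ᶜ with hO
  have hOo : IsOpen O := isOpen_upperHalfSpace.inter isOpen_compl_singleton
  have hC : ContDiffOn ℝ 2 (fun z => G z y) O := by
    rw [show (2 : ℕ∞ω) = 1 + 1 by norm_num, contDiffOn_succ_iff_fderiv_of_isOpen hOo]
    refine ⟨fun z hz => (hasFDerivAt_G hn hz.1 hy hz.2).differentiableAt.differentiableWithinAt,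
      by simp, ?_⟩
    refine ContDiffOn.congr (f := fun z => z (last n) ^ (n - 2) • innerSL ℝ (greenGrad y z)) ?_
      fun z hz => (hasFDerivAt_G hn hz.1 hy hz.2).fderiv
    intro z hz
    refine ContDiffAt.contDiffWithinAt ?_
    exact ((EuclideanSpace.proj (last n) : E n →L[ℝ] ℝ).contDiff.contDiffAt.pow _).smul
      ((innerSL ℝ (E := E n)).contDiff.contDiffAt.comp z (contDiffAt_greenGrad hz.1 hy hz.2))
  exact hC.contDiffAt (hOo.mem_nhds ⟨hx, hxy⟩)

/-- `x ↦ G(x, y)` satisfies the hyperbolic Laplace equation in divergence form. -/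
theorem sum_fderiv_weight_mul_fderiv_G (hn : 2 < n) {x y : E n} (hx : x ∈ upperHalfSpace n)
    (hy : y ∈ upperHalfSpace n) (hxy : x ≠ y) :
    ∑ i, fderiv ℝ (fun z => weight z * fderiv ℝ (fun z => G z y) z (stdVec i)) x (stdVec i) = 0 := by
  have hr := ne_reflect hx hy
  have hev : ∀ i : Fin n, (fun z => weight z * fderiv ℝ (fun z => G z y) z (stdVec i)) =ᶠ[𝓝 x]
      fun z => ⟪greenGrad y z, stdVec i⟫ := by
    intro i
    filter_upwards [isOpen_upperHalfSpace.mem_nhds hx, isOpen_compl_singleton.mem_nhds hxy]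
      with z hz hzy using weight_mul_fderiv_G hn hz hy hzy _
  rw [Finset.sum_congr rfl fun i _ => by rw [(hev i).fderiv_eq]]
  have ha0 : 0 < ‖x - y‖ := norm_pos_iff.2 (sub_ne_zero.2 hxy)
  have hb0 : 0 < ‖x - reflect n y‖ := norm_pos_iff.2 (sub_ne_zero.2 hr)
  have key : ∀ {c d : E n}, x ≠ c → x ≠ d →
      HasFDerivAt (fun z => (‖z - c‖ ^ n)⁻¹ * (‖z - d‖ ^ (n - 2))⁻¹)
      (innerSL ℝ (((‖x - c‖ ^ n)⁻¹ * -(((n - 2 : ℕ) : ℝ) * (‖x - d‖ ^ (n - 2 + 2))⁻¹)) • (x - d) +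
        ((‖x - d‖ ^ (n - 2))⁻¹ * -((n : ℝ) * (‖x - c‖ ^ (n + 2))⁻¹)) • (x - c))) x := by
    intro c d hc hd
    refine ((hasFDerivAt_inv_norm_sub_pow hc n).mul
      (hasFDerivAt_inv_norm_sub_pow hd (n - 2))).congr_fderiv ?_
    rw [map_add, map_smul, map_smul, smul_smul, smul_smul]
  have d1 := sum_fderiv_inner_smul_sub (c := y) (key hxy hr) _ rfl
  have d2 := sum_fderiv_inner_smul_sub (c := reflect n y) (key hr hxy) _ rfl
  have hd : ∀ {c d : E n}, x ≠ c → x ≠ d → ∀ i, DifferentiableAt ℝ (fun z =>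
      ⟪((‖z - c‖ ^ n)⁻¹ * (‖z - d‖ ^ (n - 2))⁻¹) • (z - c), stdVec i⟫) x := fun hc hd i =>
    ((key hc hd).differentiableAt.smul (differentiableAt_id.sub_const _)).inner ℝ
      (differentiableAt_const _)
  have hsplit : ∀ i : Fin n, fderiv ℝ (fun z => ⟪greenGrad y z, stdVec i⟫) x (stdVec i) =
      (-(4 * y (last n)) ^ (n - 2)) * (fderiv ℝ (fun z =>
        ⟪((‖z - y‖ ^ n)⁻¹ * (‖z - reflect n y‖ ^ (n - 2))⁻¹) • (z - y), stdVec i⟫) x (stdVec i) -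
        fderiv ℝ (fun z =>
        ⟪((‖z - reflect n y‖ ^ n)⁻¹ * (‖z - y‖ ^ (n - 2))⁻¹) • (z - reflect n y), stdVec i⟫) x
          (stdVec i)) := by
    intro i
    have := (((hd hxy hr i).hasFDerivAt.sub (hd hr hxy i).hasFDerivAt).const_mul
      (-(4 * y (last n)) ^ (n - 2))).fderiv
    simp only [greenGrad, real_inner_smul_left (r := -(4 * y (last n)) ^ (n - 2)), inner_sub_left]
    refine (congrArg (fun L => L (stdVec i)) this).trans ?_
    simp
  simp only [hsplit, ← Finset.mul_sum, Finset.sum_sub_distrib]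
  -- Both fields have divergence `-(n-2) ⟪x - y, x - ŷ⟫ / (‖x - y‖^n ‖x - ŷ‖^n)`, an expression
  -- symmetric in `y` and `ŷ`, so their difference is divergence free.
  rw [d1, d2]
  simp only [inner_add_left, real_inner_smul_left, real_inner_self_eq_norm_sq,
    real_inner_comm (x - y) (x - reflect n y)]
  obtain ⟨m, rfl⟩ : ∃ m, n = m + 2 := ⟨n - 2, by omega⟩
  simp only [Nat.add_sub_cancel]
  push_cast
  field_simp
  ring

theorem abs_G_le (hn : 2 < n) {x y : E n} (hx : x ∈ upperHalfSpace n)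
    (hy : y ∈ upperHalfSpace n) (hxy : x ≠ y) :
    |G x y| ≤ (‖x - reflect n y‖ / ‖x - y‖) ^ (n - 2) := by
  have ha0 : 0 < ‖x - y‖ := norm_pos_iff.2 (sub_ne_zero.2 hxy)
  have hb0 : 0 < ‖x - reflect n y‖ := norm_pos_iff.2 (sub_ne_zero.2 (ne_reflect hx hy))
  have hq0 := div_pos ha0 hb0
  have hsq := norm_sub_reflect_sq_sub x y
  have hle : ‖x - y‖ ≤ ‖x - reflect n y‖ := by
    have hxy' : 0 < x (last n) * y (last n) := mul_pos hx hy
    exact (sq_le_sq₀ ha0.le hb0.le).1 (by nlinarith)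
  have hq1 : ‖x - y‖ / ‖x - reflect n y‖ ≤ 1 := (div_le_one hb0).2 hle
  rw [G, ← inv_div ‖x - y‖, inv_pow]
  set q := ‖x - y‖ / ‖x - reflect n y‖
  obtain ⟨m, hm⟩ : ∃ m, n = m + 3 := ⟨n - 3, by omega⟩
  have e1 : n - 2 = m + 1 := by omega
  have e2 : n - 1 = m + 2 := by omega
  rw [e1, e2]
  -- The integrand is at most `1/t^(m+2)`; the harmless extra factor `m + 1 ≥ 1` makes the majorant
  -- an exact derivative.
  have hder : ∀ t ∈ uIcc q 1, HasDerivAt (fun t : ℝ => -(t ^ (m + 1))⁻¹)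
      (((m : ℝ) + 1) / t ^ (m + 2)) t := by
    intro t ht
    rw [uIcc_of_le hq1] at ht
    have ht0 : 0 < t := hq0.trans_le ht.1
    refine ((hasDerivAt_pow (m + 1) t).inv (pow_ne_zero _ ht0.ne')).neg.congr_deriv ?_
    rw [Nat.add_sub_cancel]
    push_cast
    field_simp
    ring
  have hint : IntervalIntegrable (fun t : ℝ => ((m : ℝ) + 1) / t ^ (m + 2)) volume q 1 := by
    refine ContinuousOn.intervalIntegrable ?_
    refine continuousOn_const.div (by fun_prop) fun t ht => ?_
    rw [uIcc_of_le hq1] at ht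
    exact pow_ne_zero _ (hq0.trans_le ht.1).ne'
  have h1 := intervalIntegral.norm_integral_le_of_norm_le (f := fun t : ℝ =>
    (1 - t ^ 2) ^ (m + 1) / t ^ (m + 2)) hq1 (Eventually.of_forall fun t ht => ?_) hint
  · rw [intervalIntegral.integral_eq_sub_of_hasDerivAt hder hint, Real.norm_eq_abs] at h1
    refine h1.trans ?_
    simp
  · have ht0 : 0 < t := hq0.trans ht.1
    have ht1 : t ≤ 1 := ht.2
    have h2 : 0 ≤ 1 - t ^ 2 := by nlinarith
    have h3 : 1 - t ^ 2 ≤ 1 := by nlinarith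
    rw [Real.norm_of_nonneg (by positivity)]
    gcongr
    calc (1 - t ^ 2) ^ (m + 1) ≤ 1 := pow_le_one₀ h2 h3
      _ ≤ (m : ℝ) + 1 := by linarith [Nat.cast_nonneg (α := ℝ) m]

end HyperbolicClifford

/-! ### Limits over an annulus and the radial bump -/

namespace HyperbolicClifford

open Filter Topology Module
open scoped ContDiff

theorem tendsto_integral_of_continuousOn_prod {E' X : Type*} [TopologicalSpace E']
    [SecondCountableTopology E'] [T2Space E'] [MeasurableSpace E'] [BorelSpace E'] {μ : Measure E'}
    [IsFiniteMeasureOnCompacts μ] [NormedAddCommGroup X] [NormedSpace ℝ X]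
    {F : ℝ → E' → X} {K : Set E'} (hK : IsCompact K) {r₀ : ℝ} (hr₀ : 0 < r₀)
    (hF : ContinuousOn (fun q : ℝ × E' => F q.1 q.2) (Icc 0 r₀ ×ˢ K))
    (h0 : ∀ r z, z ∉ K → F r z = 0) :
    Tendsto (fun r => ∫ z, F r z ∂μ) (𝓝[>] 0) (𝓝 (∫ z, F 0 z ∂μ)) := by
  have hset : ∀ r, ∫ z, F r z ∂μ = ∫ z in K, F r z ∂μ := fun r =>
    (setIntegral_eq_integral_of_forall_compl_eq_zero fun z hz => h0 r z hz).symm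
  simp only [hset]
  obtain ⟨C, hC⟩ := (isCompact_Icc.prod hK).exists_bound_of_continuousOn hF
  have hev : ∀ᶠ r in 𝓝[>] (0 : ℝ), r ∈ Icc 0 r₀ := by
    filter_upwards [Ioc_mem_nhdsGT hr₀] with r hr using ⟨hr.1.le, hr.2⟩
  have hslice : ∀ r ∈ Icc 0 r₀, ContinuousOn (F r) K := fun r hr =>
    hF.comp (f := fun z => (r, z)) (by fun_prop) fun z hz => ⟨hr, hz⟩
  refine tendsto_integral_filter_of_dominated_convergence (fun _ => C) ?_ ?_ ?_ ?_
  · filter_upwards [hev] with r hr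
    exact (hslice r hr).aestronglyMeasurable_of_isCompact hK hK.measurableSet
  · filter_upwards [hev] with r hr
    filter_upwards [ae_restrict_mem hK.measurableSet] with z hz using hC (r, z) ⟨hr, hz⟩
  · exact integrableOn_const hK.measure_lt_top.ne
  · filter_upwards [ae_restrict_mem hK.measurableSet] with z hz
    have h1 : ContinuousOn (fun r => F r z) (Icc 0 r₀) :=
      hF.comp (f := fun r => (r, z)) (by fun_prop) fun r hr => ⟨hr, hz⟩
    have h2 := (h1 0 ⟨le_rfl, hr₀.le⟩).tendsto
    exact h2.mono_left (le_inf (nhdsWithin_le_nhds) (le_principal_iff.2 hev))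

theorem fderiv_unitBump {n : ℕ} (z v : E n) :
    fderiv ℝ (unitBump n) z v = -(2 * deriv Real.smoothTransition (2 - ‖z‖ ^ 2)) * ⟪z, v⟫ := by
  have h1 : HasFDerivAt (fun z : E n => 2 - ‖z‖ ^ 2) (-(2 • innerSL ℝ z)) z :=
    (hasStrictFDerivAt_norm_sq z).hasFDerivAt.const_sub 2
  have h2 : HasFDerivAt (unitBump n) _ z :=
    HasDerivAt.comp_hasFDerivAt (f := fun z : E n => 2 - ‖z‖ ^ 2) z (hasDerivAt_smoothTransition _) h1
  rw [h2.fderiv]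
  simp
  ring

theorem fderiv_unitBump_eq_zero {n : ℕ} {z : E n} (hz : z ∉ {z : E n | 1 ≤ ‖z‖ ∧ ‖z‖ ≤ 2}) (v : E n) :
    fderiv ℝ (unitBump n) z v = 0 := by
  rw [fderiv_unitBump, deriv_smoothTransition_eq_zero, mul_zero, neg_zero, zero_mul]
  by_cases h1 : 1 ≤ ‖z‖
  · have h2 : 2 < ‖z‖ := by
      by_contra h2
      exact hz ⟨h1, not_lt.1 h2⟩
    left; nlinarith
  · right; nlinarith [norm_nonneg z]

theorem isCompact_annulus (n : ℕ) : IsCompact {z : E n | 1 ≤ ‖z‖ ∧ ‖z‖ ≤ 2} := by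
  refine (isCompact_closedBall (0 : E n) 2).of_isClosed_subset ?_ ?_
  · exact (isClosed_le continuous_const continuous_norm).inter
      (isClosed_le continuous_norm continuous_const)
  · intro z hz
    simpa using hz.2

theorem integral_two_mul_deriv_smoothTransition :
    ∫ s in Ioi (0 : ℝ), 2 * s * deriv Real.smoothTransition (2 - s ^ 2) = 1 := by
  have hd : ∀ s : ℝ, HasDerivAt (fun s => -Real.smoothTransition (2 - s ^ 2))
      (2 * s * deriv Real.smoothTransition (2 - s ^ 2)) s := by
    intro s
    have h1 : HasDerivAt (fun s : ℝ => 2 - s ^ 2) (-(2 * s)) s := by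
      simpa using (hasDerivAt_pow 2 s).const_sub 2
    refine ((hasDerivAt_smoothTransition _).comp s h1).neg.congr_deriv ?_
    ring
  have hlarge : ∀ s : ℝ, 2 < s → 2 - s ^ 2 < 0 := fun s hs => by nlinarith
  have hcont : Continuous fun s : ℝ => 2 * s * deriv Real.smoothTransition (2 - s ^ 2) :=
    (by fun_prop : Continuous fun s : ℝ => 2 * s).mul
      (continuous_deriv_smoothTransition.comp (by fun_prop))
  have hint : IntegrableOn (fun s : ℝ => 2 * s * deriv Real.smoothTransition (2 - s ^ 2))
      (Ioi 0) := by
    have : IntegrableOn (fun s : ℝ => 2 * s * deriv Real.smoothTransition (2 - s ^ 2))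
      (Icc 0 2) := hcont.integrableOn_Icc
    refine this.of_forall_sdiff_eq_zero measurableSet_Ioi fun s hs => ?_
    have h2 : 2 < s := by
      by_contra h
      exact hs.2 ⟨le_of_lt hs.1, not_lt.1 h⟩
    rw [deriv_smoothTransition_eq_zero (Or.inl (hlarge s h2)), mul_zero]
  have hlim : Tendsto (fun s : ℝ => -Real.smoothTransition (2 - s ^ 2)) atTop (𝓝 0) := by
    refine tendsto_const_nhds.congr' ?_
    filter_upwards [eventually_gt_atTop 2] with s hs
    rw [Real.smoothTransition.zero_of_nonpos (hlarge s hs).le, neg_zero]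
  have := integral_Ioi_of_hasDerivAt_of_tendsto' (fun s _ => hd s) hint hlim
  rw [this, Real.smoothTransition.one_of_one_le (by norm_num)]
  norm_num

/-- In polar coordinates the powers `s^{n-1} s² s^{-n}` collapse to `s`, so the radial integral is
that of the derivative of `-smoothTransition (2 - s²)`, which is `1`. -/
theorem integral_deriv_smoothTransition_norm {n : ℕ} (hn : 0 < n) :
    ∫ z : E n, 2 * deriv Real.smoothTransition (2 - ‖z‖ ^ 2) * (‖z‖ ^ 2 * (‖z‖ ^ n)⁻¹) =
      sphereArea n := by
  have : NeZero n := ⟨hn.ne'⟩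
  have : Nontrivial (E n) := by
    refine ⟨⟨stdVec ⟨0, hn⟩, 0, fun h => ?_⟩⟩
    have := congrArg (fun v : E n => v ⟨0, hn⟩) h
    simp [stdVec] at this
  have h1 := integral_fun_norm_addHaar (volume : Measure (E n))
    (fun s : ℝ => 2 * deriv Real.smoothTransition (2 - s ^ 2) * (s ^ 2 * (s ^ n)⁻¹))
  rw [h1, sphereArea, Measure.toSphere_real_apply_univ]
  have h2 : ∫ s in Ioi (0 : ℝ), s ^ (finrank ℝ (E n) - 1) •
      (2 * deriv Real.smoothTransition (2 - s ^ 2) * (s ^ 2 * (s ^ n)⁻¹)) = 1 := by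
    rw [← integral_two_mul_deriv_smoothTransition]
    refine setIntegral_congr_fun measurableSet_Ioi fun s hs => ?_
    have hs0 : s ≠ 0 := ne_of_gt hs
    rw [finrank_euclideanSpace_fin]
    obtain ⟨m, rfl⟩ := Nat.exists_eq_succ_of_ne_zero hn.ne'
    simp only [Nat.succ_eq_add_one, Nat.add_sub_cancel, smul_eq_mul]
    field_simp
    ring
  rw [h2]
  simp

end HyperbolicClifford

/-! ### The averaged flux near the pole -/

namespace HyperbolicClifford

open Filter Topology Module
open scoped ContDiff

variable {n : ℕ} [NeZero n]

/-- The field `r^{n-1} greenGrad y (y + r z)`, extended to `r = 0`. -/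
noncomputable def scaledGreenGrad (y : E n) (r : ℝ) (z : E n) : E n :=
  (-(4 * y (last n)) ^ (n - 2)) •
    (((‖z‖ ^ n)⁻¹ * (‖y + r • z - reflect n y‖ ^ (n - 2))⁻¹) • z -
      r • ((‖y + r • z - reflect n y‖ ^ n)⁻¹ * (‖z‖ ^ (n - 2))⁻¹) • (y + r • z - reflect n y))

theorem scaledGreenGrad_eq (hn : 2 ≤ n) (y z : E n) {r : ℝ} (hr : 0 < r) :
    scaledGreenGrad y r z = r ^ (n - 1) • greenGrad y (y + r • z) := by
  obtain ⟨m, rfl⟩ : ∃ m, n = m + 2 := ⟨n - 2, by omega⟩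
  rw [scaledGreenGrad, greenGrad, smul_comm (r ^ _), add_sub_cancel_left, norm_smul,
    Real.norm_of_nonneg hr.le, smul_sub (r ^ _)]
  simp only [Nat.add_sub_cancel, show m + 2 - 1 = m + 1 by omega]
  congr 2
  · rw [smul_smul, smul_smul]
    congr 1
    rw [mul_pow]
    field_simp
    ring
  · rw [smul_smul, smul_smul]
    congr 1
    rw [mul_pow]
    field_simp
    ring

theorem norm_sub_reflect_self {y : E n} (hy : y ∈ upperHalfSpace n) :
    ‖y - reflect n y‖ = 2 * y (last n) := by
  have hy0 : 0 < y (last n) := hy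
  have h := norm_sub_reflect_sq_sub y y
  rw [sub_self y, norm_zero] at h
  refine (sq_eq_sq₀ (norm_nonneg _) (by linarith)).1 ?_
  linarith

/-- Here `‖y - ŷ‖ = 2 y_n`, and `(4 y_n)^{n-2}/(2 y_n)^{n-2}` is the constant `2^{n-2}` of Green's
formula. -/
theorem scaledGreenGrad_zero {y : E n} (hy : y ∈ upperHalfSpace n) (z : E n) :
    scaledGreenGrad y 0 z = (-2 ^ (n - 2) * (‖z‖ ^ n)⁻¹) • z := by
  have hy0 : y (last n) ≠ 0 := ne_of_gt hy
  rw [scaledGreenGrad, zero_smul, zero_smul, add_zero, sub_zero, norm_sub_reflect_self hy, smul_smul]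
  congr 1
  rw [show (4 : ℝ) = 2 * 2 by norm_num, mul_assoc, mul_pow]
  have : (2 * y (last n)) ^ (n - 2) ≠ 0 := by positivity
  field_simp

theorem continuousOn_scaledGreenGrad {y : E n} (hy : y ∈ upperHalfSpace n) {T : Set (ℝ × E n)}
    (hT : ∀ q ∈ T, q.2 ≠ 0 ∧ y + q.1 • q.2 ∈ upperHalfSpace n) :
    ContinuousOn (fun q : ℝ × E n => scaledGreenGrad y q.1 q.2) T := by
  have h1 : ∀ k : ℕ, ContinuousOn (fun q : ℝ × E n => (‖q.2‖ ^ k)⁻¹) T := fun k =>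
    ContinuousOn.inv₀ (by fun_prop) fun q hq => pow_ne_zero _ (norm_ne_zero_iff.2 (hT q hq).1)
  have h2 : ∀ k : ℕ, ContinuousOn
      (fun q : ℝ × E n => (‖y + q.1 • q.2 - reflect n y‖ ^ k)⁻¹) T := fun k =>
    ContinuousOn.inv₀ (by fun_prop) fun q hq =>
      pow_ne_zero _ (norm_ne_zero_iff.2 (sub_ne_zero.2 (ne_reflect (hT q hq).2 hy)))
  have h3 : ContinuousOn (fun q : ℝ × E n => y + q.1 • q.2 - reflect n y) T := by fun_prop
  exact ((((h1 n).mul (h2 (n - 2))).smul continuousOn_snd).sub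
    (continuousOn_fst.smul (((h2 n).mul (h1 (n - 2))).smul h3))).const_smul (-(4 * y (last n)) ^ (n - 2))

/-- Since `G` grows at most like `‖x - y‖^{2-n}`, the product is `O(r)`. At `r = 0` the factor
`r^{n-1}` is zero, so the value assigned to `G` at its pole plays no role. -/
theorem continuousOn_scaled_G (hn : 2 < n) {y : E n} (hy : y ∈ upperHalfSpace n)
    {T : Set (ℝ × E n)}
    (hT : ∀ q ∈ T, 0 ≤ q.1 ∧ q.2 ≠ 0 ∧ y + q.1 • q.2 ∈ upperHalfSpace n) :
    ContinuousOn (fun q : ℝ × E n => q.1 ^ (n - 1) * G (y + q.1 • q.2) y) T := by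
  intro q hq
  rcases (hT q hq).1.eq_or_lt with h0 | hpos
  · have hq2 := (hT q hq).2.1
    have hbound : ∀ᶠ p in 𝓝[T] q, ‖p.1 ^ (n - 1) * G (y + p.1 • p.2) y‖ ≤
        p.1 * (‖y + p.1 • p.2 - reflect n y‖ / ‖p.2‖) ^ (n - 2) := by
      filter_upwards [self_mem_nhdsWithin] with p hp
      obtain ⟨hp0, hp2, hpu⟩ := hT p hp
      rcases hp0.eq_or_lt with hp0 | hp0
      · rw [← hp0, zero_pow (by omega), zero_mul, norm_zero, zero_mul]
      · have hne : y + p.1 • p.2 ≠ y := by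
          intro h
          rw [add_eq_left] at h
          exact (smul_ne_zero hp0.ne' hp2) h
        have hG := abs_G_le hn hpu hy hne
        rw [add_sub_cancel_left, norm_smul, Real.norm_of_nonneg hp0.le] at hG
        rw [norm_mul, Real.norm_of_nonneg (pow_nonneg hp0.le _), Real.norm_eq_abs]
        refine (mul_le_mul_of_nonneg_left hG (pow_nonneg hp0.le _)).trans_eq ?_
        rw [show n - 1 = n - 2 + 1 by omega, div_pow, div_pow, mul_pow]
        have := norm_ne_zero_iff.2 hp2
        field_simp
        ring
    have hlim : Tendsto (fun p : ℝ × E n => p.1 * (‖y + p.1 • p.2 - reflect n y‖ / ‖p.2‖) ^ (n - 2))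
        (𝓝[T] q) (𝓝 0) := by
      have hc : ContinuousAt (fun p : ℝ × E n =>
          p.1 * (‖y + p.1 • p.2 - reflect n y‖ / ‖p.2‖) ^ (n - 2)) q :=
        continuousAt_fst.mul ((ContinuousAt.div
          (f := fun p : ℝ × E n => ‖y + p.1 • p.2 - reflect n y‖) (g := fun p => ‖p.2‖)
          (by fun_prop) (by fun_prop) (norm_ne_zero_iff.2 hq2)).pow _)
      have := hc.tendsto
      rw [← h0, zero_mul] at this
      exact this.mono_left nhdsWithin_le_nhds
    change Tendsto _ _ (𝓝 (q.1 ^ (n - 1) * G (y + q.1 • q.2) y))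
    rw [← h0, zero_pow (by omega), zero_mul]
    exact squeeze_zero_norm' hbound hlim
  · obtain ⟨-, hq2, hqu⟩ := hT q hq
    have hne : y + q.1 • q.2 ≠ y := by
      intro h
      rw [add_eq_left] at h
      exact (smul_ne_zero hpos.ne' hq2) h
    have h1 : ContinuousAt (fun x => G x y) (y + q.1 • q.2) :=
      (contDiffAt_G hn hqu hy hne).continuousAt
    have h2 : ContinuousAt (fun p : ℝ × E n => y + p.1 • p.2) q := by fun_prop
    have h3 : ContinuousAt (fun p : ℝ × E n => G (y + p.1 • p.2) y) q :=
      ContinuousAt.comp (f := fun p : ℝ × E n => y + p.1 • p.2) h1 h2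
    exact ((continuousAt_fst.pow _).mul h3).continuousWithinAt

/-- The flux of `greenField` through a small sphere around the pole, averaged over its radius. -/
theorem tendsto_integral_greenField (hn : 2 < n) {U : Set (E n)} (hU : IsOpen U)
    (hUH : U ⊆ upperHalfSpace n) {h : E n → Cl n} (hh : IsHyperbolicHarmonicOn h U)
    {y : E n} (hy : y ∈ U) :
    Tendsto (fun r : ℝ => ∫ z, ∑ i, fderiv ℝ (unitBump n) z (stdVec i) •
        r ^ (n - 1) • greenField (fun x => G x y) h i (y + r • z)) (𝓝[>] 0)
      (𝓝 ((2 ^ (n - 2) * sphereArea n) • h y)) := by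
  obtain ⟨ε, hε, hεU⟩ := Metric.isOpen_iff.1 hU y hy
  have hyH := hUH hy
  set K : Set (E n) := {z | 1 ≤ ‖z‖ ∧ ‖z‖ ≤ 2} with hK
  set r₀ := ε / 4 with hr₀
  have hr₀0 : 0 < r₀ := by positivity
  have hmem : ∀ q ∈ Icc 0 r₀ ×ˢ K, y + q.1 • q.2 ∈ U := by
    rintro ⟨r, z⟩ ⟨⟨h0, h1⟩, h2, h3⟩
    refine hεU ?_
    rw [mem_ball_iff_norm, add_sub_cancel_left, norm_smul, Real.norm_of_nonneg h0]
    simp only at h0 h1 h2 h3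
    calc r * ‖z‖ ≤ ε / 4 * 2 := mul_le_mul h1 h3 (norm_nonneg _) (by positivity)
      _ < ε := by linarith
  have hz0 : ∀ z ∈ K, z ≠ 0 := fun z hz h0 => by
    have := hz.1
    rw [h0, norm_zero] at this
    linarith
  -- `F` is the integrand with `r^{n-1}` absorbed into the kernel terms, so that it extends
  -- continuously to `r = 0` on the annulus carrying the gradient of the bump.
  set F : ℝ → E n → Cl n := fun r z => ∑ i, fderiv ℝ (unitBump n) z (stdVec i) •
    ∑ j, (((r ^ (n - 1) * G (y + r • z) y) * weight (y + r • z)) •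
        projMul i j (fderiv ℝ h (y + r • z) (stdVec j)) -
      ⟪scaledGreenGrad y r z, stdVec j⟫ • projMul j i (h (y + r • z))) with hF
  have hFc : ContinuousOn (fun q : ℝ × E n => F q.1 q.2) (Icc 0 r₀ ×ˢ K) := by
    have hpt : ContinuousOn (fun q : ℝ × E n => y + q.1 • q.2) (Icc 0 r₀ ×ˢ K) := by fun_prop
    have c1 : ContinuousOn (fun q : ℝ × E n => h (y + q.1 • q.2)) (Icc 0 r₀ ×ˢ K) :=
      hh.1.continuousOn.comp hpt hmem
    have c2 : ∀ v, ContinuousOn (fun q : ℝ × E n => fderiv ℝ h (y + q.1 • q.2) v)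
        (Icc 0 r₀ ×ˢ K) := fun v =>
      ((hh.1.continuousOn_fderiv_of_isOpen hU (by norm_num)).comp hpt hmem).clm_apply
        continuousOn_const
    have c3 : ContinuousOn (fun q : ℝ × E n => weight (y + q.1 • q.2)) (Icc 0 r₀ ×ˢ K) := by
      have : ContinuousOn (weight (n := n)) U := fun x hx =>
        (contDiffAt_weight (hUH hx) (k := 0)).continuousAt.continuousWithinAt
      exact this.comp hpt hmem
    have c4 := continuousOn_scaled_G hn hyH (T := Icc 0 r₀ ×ˢ K) fun q hq =>
      ⟨hq.1.1, hz0 _ hq.2, hUH (hmem q hq)⟩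
    have c5 := continuousOn_scaledGreenGrad hyH (T := Icc 0 r₀ ×ˢ K) fun q hq =>
      ⟨hz0 _ hq.2, hUH (hmem q hq)⟩
    have c6 : ∀ v, Continuous fun q : ℝ × E n => fderiv ℝ (unitBump n) q.2 v := fun v =>
      (((contDiff_unitBump n).continuous_fderiv (by simp)).comp continuous_snd).clm_apply
        continuous_const
    refine continuousOn_finsetSum _ fun i _ => (c6 _).continuousOn.smul
      (continuousOn_finsetSum _ fun j _ => ?_)
    have c7 : ContinuousOn (fun q : ℝ × E n => ⟪scaledGreenGrad y q.1 q.2, stdVec j⟫)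
        (Icc 0 r₀ ×ˢ K) := c5.inner continuousOn_const
    exact ((c4.mul c3).smul ((projMul i j).continuous.comp_continuousOn (c2 _))).sub
      (c7.smul ((projMul j i).continuous.comp_continuousOn c1))
  have hF0 : ∀ r z, z ∉ K → F r z = 0 := fun r z hz => by
    simp only [hF, fderiv_unitBump_eq_zero hz, zero_smul, Finset.sum_const_zero]
  have hlim := tendsto_integral_of_continuousOn_prod (μ := volume) (isCompact_annulus n) hr₀0 hFc hF0
  have hval : ∫ z, F 0 z = (2 ^ (n - 2) * sphereArea n) • h y := by
    have hpw : ∀ z, F 0 z = (2 ^ (n - 2) * (2 * deriv Real.smoothTransition (2 - ‖z‖ ^ 2) *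
        (‖z‖ ^ 2 * (‖z‖ ^ n)⁻¹))) • h y := by
      intro z
      have hPh : P (h y) = h y := P_of_mem (hh.2.1 y hy)
      have hinner : ∀ j, ⟪z, (stdVec j : E n)⟫ = z j := fun j => by
        simp [stdVec, EuclideanSpace.inner_single_right]
      set c : ℝ := 2 ^ (n - 2) * (2 * deriv Real.smoothTransition (2 - ‖z‖ ^ 2) * (‖z‖ ^ n)⁻¹)
        with hc
      -- At `r = 0` only the term with `∇G` survives. The coefficients `z_i z_j` are symmetric, so
      -- the double sum collapses to `‖z‖²`.
      have h1 : F 0 z = -∑ i, ∑ j, projMul j i ((c * (z i * z j)) • h y) := by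
        simp only [hF, zero_pow (show n - 1 ≠ 0 by omega), zero_mul, zero_smul, zero_sub, add_zero,
          scaledGreenGrad_zero hyH, real_inner_smul_left, fderiv_unitBump, hinner,
          Finset.smul_sum, map_smul, smul_smul, smul_neg, Finset.sum_neg_distrib]
        congr 1
        refine Finset.sum_congr rfl fun i _ => Finset.sum_congr rfl fun j _ => ?_
        congr 1
        rw [hc]; ring
      rw [h1, Finset.sum_comm, sum_projMul_of_symm fun i j => by rw [mul_comm (z j)], neg_neg]
      simp only [P_smul, hPh, ← Finset.sum_smul, ← Finset.mul_sum]
      congr 1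
      have hsum : ∑ i, z i * z i = ‖z‖ ^ 2 := by
        rw [EuclideanSpace.norm_sq_eq]
        exact Finset.sum_congr rfl fun i _ => by rw [Real.norm_eq_abs, sq_abs, sq]
      rw [hsum, hc]
      ring
    simp only [hpw]
    rw [integral_smul_const, integral_const_mul, integral_deriv_smoothTransition_norm (by omega)]
  rw [hval] at hlim
  refine hlim.congr' ?_
  filter_upwards [Ioc_mem_nhdsGT hr₀0] with r hr
  refine integral_congr_ae (Eventually.of_forall fun z => ?_)
  by_cases hz : z ∈ K
  · have hxU : y + r • z ∈ U := hmem (r, z) ⟨⟨hr.1.le, hr.2⟩, hz⟩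
    have hne : y + r • z ≠ y := by
      intro h
      rw [add_eq_left] at h
      exact (smul_ne_zero hr.1.ne' (hz0 z hz)) h
    simp only [hF, greenField, weight_mul_fderiv_G hn (hUH hxU) hyH hne,
      scaledGreenGrad_eq hn.le y z hr.1, real_inner_smul_left, Finset.smul_sum, smul_sub, smul_smul,
      mul_assoc]
  · rw [hF0 r z hz]
    simp only [fderiv_unitBump_eq_zero hz, zero_smul, Finset.sum_const_zero]

end HyperbolicClifford

/-! ### The flux through the boundary -/

namespace HyperbolicClifford

open Filter Topology Module
open scoped ContDiff

/-- The Gauss-Green formula for fields `g i` that are divergence free away from a point `y`. -/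
theorem sum_integral_frontier_eq_integral_scaled {X : Type*} [NormedAddCommGroup X]
    [NormedSpace ℝ X] [CompleteSpace X] {n : ℕ} (hn : 0 < n) {V : Set (E n)} (hV : IsOpen V)
    (hVb : Bornology.IsBounded V) (hS : IsPiecewiseC1Boundary (frontier V) V) {ν : E n → E n}
    (hν : ∀ x ∈ regularBoundary V, IsOuterUnitNormal V x (ν x)) {O : Set (E n)} (hO : IsOpen O)
    (hVO : closure V ⊆ O) {y : E n} {g : Fin n → E n → X}
    (hg : ∀ i, ∀ x ∈ O, x ≠ y → ContDiffAt ℝ 1 (g i) x)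
    (hdiv : ∀ x ∈ V, x ≠ y → ∑ i, fderiv ℝ (g i) x (stdVec i) = 0)
    {r : ℝ} (hr : 0 < r) (hrV : Metric.closedBall y (2 * r) ⊆ V) :
    ∑ i, ∫ x in frontier V, ⟪ν x, stdVec i⟫ • g i x ∂μHE[n - 1] =
      -∫ z, ∑ i, fderiv ℝ (unitBump n) z (stdVec i) • r ^ (n - 1) • g i (y + r • z) := by
  -- `φ` vanishes near the pole and equals `1` outside `V`: the product `φ • g i` is `C¹` across `y`
  -- and unchanged on the boundary.
  set φ : E n → ℝ := fun x => 1 - unitBump n (r⁻¹ • (x - y)) with hφ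
  have hφd : ContDiff ℝ 1 φ := contDiff_const.sub
    (((contDiff_unitBump n).of_le (by simp)).comp ((contDiff_id.sub contDiff_const).const_smul r⁻¹))
  have hnorm : ∀ x, ‖r⁻¹ • (x - y)‖ = r⁻¹ * dist x y := fun x => by
    rw [norm_smul, Real.norm_of_nonneg (inv_nonneg.2 hr.le), dist_eq_norm]
  have hφ0 : ∀ᶠ x in 𝓝 y, φ x = 0 := by
    filter_upwards [Metric.ball_mem_nhds y hr] with x hx
    rw [hφ]
    simp only
    rw [unitBump_eq_one, sub_self]
    rw [hnorm, ← div_eq_inv_mul, div_le_one hr]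
    exact (Metric.mem_ball.1 hx).le
  have hfar : ∀ x ∉ V, 2 < ‖r⁻¹ • (x - y)‖ := fun x hx => by
    rw [hnorm, ← div_eq_inv_mul, lt_div_iff₀ hr]
    by_contra h
    exact hx (hrV (not_lt.1 h))
  have hφ1 : ∀ x ∉ V, φ x = 1 := fun x hx => by
    rw [hφ]
    simp only
    rw [unitBump_eq_zero (hfar x hx).le, sub_zero]
  have hfd : ∀ x v, fderiv ℝ φ x v = -(r⁻¹ * fderiv ℝ (unitBump n) (r⁻¹ • (x - y)) v) := by
    intro x v
    have hl : HasFDerivAt (fun x : E n => r⁻¹ • (x - y)) (r⁻¹ • ContinuousLinearMap.id ℝ (E n)) x :=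
      ((hasFDerivAt_id x).sub_const y).const_smul r⁻¹
    have hd := ((contDiff_unitBump n).differentiable (by simp) (r⁻¹ • (x - y))).hasFDerivAt.comp x hl
    have h1 : HasFDerivAt φ _ x := hd.const_sub 1
    rw [h1.fderiv]
    simp
  have hf : ∀ i, ContDiffOn ℝ 1 (fun x => φ x • g i x) O := by
    intro i x hx
    refine ContDiffAt.contDiffWithinAt ?_
    by_cases hxy : x = y
    · subst hxy
      refine (contDiffAt_const (c := (0 : X))).congr_of_eventuallyEq ?_
      filter_upwards [hφ0] with z hz
      rw [hz, zero_smul]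
    · exact hφd.contDiffAt.smul (hg i x hx hxy)
  have hgg := fun i => gaussGreen hn hV hVb hS hν (v := stdVec i)
    (by simp [stdVec]) hO hVO (hf i)
  have hcut : ∀ i, ∫ x in frontier V, ⟪ν x, stdVec i⟫ • g i x ∂μHE[n - 1] =
      ∫ x in V, fderiv ℝ (fun x => φ x • g i x) x (stdVec i) := by
    intro i
    rw [(hgg i).2]
    refine setIntegral_congr_fun isClosed_frontier.measurableSet fun x hx => ?_
    have hxV : x ∉ V := fun h => (hV.frontier_eq ▸ hx).2 h
    simp only [hφ1 x hxV, one_smul]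
  -- Only `∇φ · g` remains of the divergence. The factor `r⁻¹` in `∇φ` and the `r^n` from
  -- substituting `x = y + r z` combine to `r^{n-1}`.
  set H : E n → X := fun x =>
    ∑ i, (-(r⁻¹ * fderiv ℝ (unitBump n) (r⁻¹ • (x - y)) (stdVec i))) • g i x with hH
  have hpt : ∀ x ∈ V, ∑ i, fderiv ℝ (fun x => φ x • g i x) x (stdVec i) = H x := by
    intro x hx
    by_cases hxy : x = y
    · subst hxy
      have h1 : ∀ i, fderiv ℝ (fun x => φ x • g i x) x = 0 := fun i => by
        have : (fun x => φ x • g i x) =ᶠ[𝓝 x] fun _ => 0 := by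
          filter_upwards [hφ0] with z hz
          rw [hz, zero_smul]
        rw [this.fderiv_eq]
        simp
      have h2 : ∀ i : Fin n, fderiv ℝ (unitBump n) (r⁻¹ • (x - x)) (stdVec i) = 0 := fun i => by
        refine fderiv_unitBump_eq_zero (fun h => ?_) _
        have := h.1
        rw [sub_self, smul_zero, norm_zero] at this
        linarith
      simp only [hH, h1, h2, mul_zero, neg_zero, zero_smul, zero_apply]
    · have h1 : ∀ i, fderiv ℝ (fun x => φ x • g i x) x (stdVec i) =
          φ x • fderiv ℝ (g i) x (stdVec i) + fderiv ℝ φ x (stdVec i) • g i x := fun i => by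
        have := ((hφd.differentiable one_ne_zero x).hasFDerivAt.smul
          ((hg i x (hVO (subset_closure hx)) hxy).differentiableAt one_ne_zero).hasFDerivAt)
        have h2 : HasFDerivAt (fun x => φ x • g i x) _ x := this
        rw [h2.fderiv]
        simp
      simp only [h1, Finset.sum_add_distrib, ← Finset.smul_sum, hdiv x hx hxy, smul_zero, zero_add,
        hfd, hH]
  have hH0 : ∀ x, x ∉ V → H x = 0 := by
    intro x hx
    have h2 : ∀ i : Fin n, fderiv ℝ (unitBump n) (r⁻¹ • (x - y)) (stdVec i) = 0 := fun i =>
      fderiv_unitBump_eq_zero (fun h => (hfar x hx).not_ge h.2) _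
    simp only [hH, h2, mul_zero, neg_zero, zero_smul, Finset.sum_const_zero]
  calc ∑ i, ∫ x in frontier V, ⟪ν x, stdVec i⟫ • g i x ∂μHE[n - 1]
      = ∫ x in V, ∑ i, fderiv ℝ (fun x => φ x • g i x) x (stdVec i) := by
        rw [integral_finsetSum _ fun i _ => (hgg i).1]
        exact Finset.sum_congr rfl fun i _ => hcut i
    _ = ∫ x in V, H x := setIntegral_congr_fun hV.measurableSet hpt
    _ = ∫ x, H x := setIntegral_eq_integral_of_forall_compl_eq_zero hH0
    _ = ∫ x, H (y + x) := (integral_add_left_eq_self H y).symm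
    _ = r ^ n • ∫ z, H (y + r • z) := by
        rw [Measure.integral_comp_smul volume (fun x => H (y + x)) r, finrank_euclideanSpace_fin,
          smul_smul, abs_of_pos (inv_pos.2 (pow_pos hr n)), mul_inv_cancel₀ (pow_pos hr n).ne',
          one_smul]
    _ = _ := by
        rw [← integral_smul, ← integral_neg]
        refine integral_congr_ae (Eventually.of_forall fun z => ?_)
        simp only [hH, add_sub_cancel_left, smul_smul, inv_mul_cancel₀ hr.ne', one_smul,
          Finset.smul_sum, ← Finset.sum_neg_distrib, ← neg_smul]
        refine Finset.sum_congr rfl fun i _ => ?_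
        congr 1
        rw [← pow_sub_one_mul hn.ne' r]
        field_simp

theorem sphereArea_pos {n : ℕ} (hn : 0 < n) : 0 < sphereArea n := by
  rw [sphereArea, Measure.toSphere_real_apply_univ, finrank_euclideanSpace_fin]
  exact mul_pos (by exact_mod_cast hn)
    (ENNReal.toReal_pos (Metric.measure_ball_pos volume _ one_pos).ne' measure_ball_lt_top.ne)

/-- The flux of `greenField` through the boundary of a domain containing the pole. -/
theorem sum_integral_frontier_greenField {n : ℕ} [NeZero n] (hn : 2 < n) {U : Set (E n)}
    (hU : IsOpen U) (hUH : U ⊆ upperHalfSpace n) {h : E n → Cl n} (hh : IsHyperbolicHarmonicOn h U)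
    {V : Set (E n)} (hV : IsOpen V) (hVbdd : Bornology.IsBounded V) (hcl : closure V ⊆ U)
    (hS : IsPiecewiseC1Boundary (frontier V) V) {ν : E n → E n}
    (hν : ∀ x ∈ regularBoundary V, IsOuterUnitNormal V x (ν x)) {y : E n} (hy : y ∈ V) :
    ∑ i, ∫ x in frontier V, ⟪ν x, stdVec i⟫ • greenField (fun z => G z y) h i x ∂μHE[n - 1] =
      -((2 ^ (n - 2) * sphereArea n) • h y) := by
  have hVU := subset_closure.trans hcl
  have hyU := hVU hy
  have hyH := hUH hyU
  have hγ : ∀ x ∈ U, x ≠ y → ContDiffAt ℝ 2 (fun z => G z y) x := fun x hx hxy =>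
    contDiffAt_G hn (hUH hx) hyH hxy
  have hhd : ∀ x ∈ U, ContDiffAt ℝ 2 h x := fun x hx => hh.1.contDiffAt (hU.mem_nhds hx)
  have hflux : ∀ᶠ r in 𝓝[>] (0 : ℝ),
      -∑ i, ∫ x in frontier V, ⟪ν x, stdVec i⟫ • greenField (fun z => G z y) h i x ∂μHE[n - 1] =
      ∫ z, ∑ i, fderiv ℝ (unitBump n) z (stdVec i) •
        r ^ (n - 1) • greenField (fun x => G x y) h i (y + r • z) := by
    obtain ⟨ε, hε, hεV⟩ := Metric.isOpen_iff.1 hV y hy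
    filter_upwards [Ioo_mem_nhdsGT (show 0 < ε / 2 by linarith)] with r hr
    rw [sum_integral_frontier_eq_integral_scaled (by omega) hV hVbdd hS hν hU hcl
      (fun i x hx hxy => contDiffAt_greenField (hUH hx) (hγ x hx hxy) (hhd x hx) i) ?_ hr.1
      ((Metric.closedBall_subset_ball (by linarith [hr.2])).trans hεV), neg_neg]
    intro x hx hxy
    rw [sum_fderiv_greenField hn.le hU hUH hh (hVU hx) (hγ x (hVU hx) hxy),
      sum_fderiv_weight_mul_fderiv_G hn (hUH (hVU hx)) hyH hxy, zero_smul]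
  exact neg_eq_iff_eq_neg.1 <| tendsto_nhds_unique (tendsto_const_nhds.congr' hflux)
    (tendsto_integral_greenField hn hU hUH hh hyU)

end HyperbolicClifford

/-! ### Green's formula -/

theorem theorem2 (n : ℕ) [NeZero n] (hn : 2 < n)
    (U : Set (E n)) (hU : IsOpen U) (hUconn : IsConnected U) (hUH : U ⊆ upperHalfSpace n)
    (h : E n → Cl n) (hh : IsHyperbolicHarmonicOn h U)
    (V : Set (E n)) (hV : IsOpen V) (hVconn : IsConnected V) (hVbdd : Bornology.IsBounded V)
    (hVU : V ⊆ U)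
    (S : Set (E n)) (hSU : S ⊆ U) (hS : IsPiecewiseC1Boundary S V)
    (ν : E n → E n) (hν : ∀ x ∈ regularBoundary V, IsOuterUnitNormal V x (ν x))
    (y : E n) (hy : y ∈ V) :
    IntegrableOn (fun x : E n =>
        G x y • ((1 / x (last n) ^ (n - 2)) • vec (ν x) * diracHodge h x)
          - p x y * ((1 / x (last n) ^ (n - 2)) • vec (ν x)) * h x) S μHE[n - 1] ∧
    h y = (-1 / (2 ^ (n - 2) * sphereArea n)) •
      P (∫ x in S,
        (G x y • ((1 / x (last n) ^ (n - 2)) • vec (ν x) * diracHodge h x)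
          - p x y * ((1 / x (last n) ^ (n - 2)) • vec (ν x)) * h x) ∂μHE[n - 1]) := by
  obtain rfl := hS.eq_frontier
  have hyU := hVU hy
  have hyH := hUH hyU
  have hcl : closure V ⊆ U := by
    rw [closure_eq_self_union_frontier]
    exact union_subset hVU hSU
  have hγ : ∀ x ∈ U, x ≠ y → ContDiffAt ℝ 2 (fun z => G z y) x := fun x hx hxy =>
    contDiffAt_G hn (hUH hx) hyH hxy
  have hhd : ∀ x ∈ U, ContDiffAt ℝ 2 h x := fun x hx => hh.1.contDiffAt (hU.mem_nhds hx)
  have hne : ∀ x ∈ frontier V, x ≠ y := by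
    rintro x hx rfl
    exact (hV.frontier_eq ▸ hx).2 hy
  have hint : ∀ i, IntegrableOn (fun x => ⟪ν x, stdVec i⟫ • greenForm (fun z => G z y) h i x)
      (frontier V) μHE[n - 1] := fun i =>
    integrableOn_inner_outerUnitNormal_smul hS hν _ fun x hx =>
      (contDiffAt_greenForm (hUH (hSU hx)) (hγ x (hSU hx) (hne x hx)) (hhd x (hSU hx))
        i).continuousAt.continuousWithinAt
  have hcoord : ∀ (v : E n) i, ⟪v, stdVec i⟫ = v i := fun v i => by
    simp [stdVec, EuclideanSpace.inner_single_right]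
  have heq : EqOn (fun x : E n =>
        G x y • ((1 / x (last n) ^ (n - 2)) • vec (ν x) * diracHodge h x)
          - p x y * ((1 / x (last n) ^ (n - 2)) • vec (ν x)) * h x)
      (fun x => ∑ i, ⟪ν x, stdVec i⟫ • greenForm (fun z => G z y) h i x) (frontier V) := by
    intro x hx
    simp only [hcoord]
    exact integrand_eq_sum_greenForm (hh.2.1 x (hSU hx))
      ((hγ x (hSU hx) (hne x hx)).differentiableAt two_ne_zero)
  have hmeas := (isClosed_frontier (s := V)).measurableSet
  refine ⟨(integrableOn_congr_fun heq hmeas).2 (integrable_finsetSum _ fun i _ => hint i), ?_⟩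
  rw [setIntegral_congr_fun hmeas heq, integral_finsetSum _ fun i _ => hint i, ← projL_apply,
    map_sum]
  -- `P` is linear and continuous, so it passes under the integral. Integrability holds for the
  -- unprojected `greenForm`, whereas only the projected field is divergence free.
  simp only [← (projL n).integral_comp_comm (hint _), map_smul, projL_apply, P_greenForm]
  rw [sum_integral_frontier_greenField hn hU hUH hh hV hVbdd hcl hS hν hy]
  have hc : (2 : ℝ) ^ (n - 2) * sphereArea n ≠ 0 :=
    (mul_pos (by positivity) (sphereArea_pos (by omega))).ne'
  rw [smul_neg, smul_smul, ← neg_smul]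
  rw [show -(-1 / (2 ^ (n - 2) * sphereArea n) * (2 ^ (n - 2) * sphereArea n)) = 1 by
    rw [div_mul_cancel₀ _ hc, neg_neg], one_smul]
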